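/- \textbf{Setting.} Let $D=\mathrm{diag}(1,-1)$. Let $(\Lambda SL_2\mathbb C)_\sigma$ be the group of smooth maps $\gamma:S^1\to SL_2\mathbb C$ with $D\gamma(-\lambda)D=\gamma(\lambda)$, let $(\Lambda SU_{1,1})_\sigma$ be the subgroup of those with $D(\overline{\gamma(\lambda)}^{\,t})^{-1}D=\gamma(\lambda)$ for all $\lambda\in S^1$, and let $(\Lambda_+SL_2\mathbb C)_\sigma$ be the subgroup of those that extend continuously to the closed unit disk and holomorphically to its interior. Put $w(\lambda)=\begin{pmatrix}0&\lambda\\-1/\lambda&0\end{pmatrix}$ and $d(\epsilon)=\mathrm{diag}(1,\epsilon)$. With $$f_0=\sum_{i\ge0}\frac{z^i}{(i!)^2\lambda^{2i}},\qquad f_1=-\frac2\lambda\sum_{i\ge1}\Bigl(1+\tfrac12+\cdots+\tfrac1i\Bigr)\frac{z^i}{(i!)^2\lambda^{2i}},\qquad \partial=z\frac{d}{dz},$$ let $$L=\begin{pmatrix}1&0\\ \tfrac1\lambda\log z&1\end{pmatrix}\begin{pmatrix}f_0&\lambda\partial f_0\\ f_1&f_0+\lambda\partial f_1\end{pmatrix}$$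 on $\mathbb C-(-\infty,0]$ (principal branch of $\log$); it satisfies $L^{-1}dL=\frac1\lambda\begin{pmatrix}0&1\\1/z&0\end{pmatrix}dz$. For $a>0$ let $\gamma_0(\lambda)=\begin{pmatrix}1/\sqrt a&-\lambda/\sqrt a\\0&\sqrt a\end{pmatrix}$. For an open neighbourhood $V$ of $0$ in $\mathbb C$ and $U=V\cap(\mathbb C-(-\infty,0])$, an Iwasawa factorization of $\gamma_0^{-1}L$ on $U$ is an identity $\gamma_0^{-1}L=FwB$, where $F,B$ depend smoothly on $(z,\lambda)\in U\times S^1$, take values in $(\Lambda SU_{1,1})_\sigma$ and $(\Lambda_+SL_2\mathbb C)_\sigma$ respectively, and $B=\mathrm{diag}(k,k^{-1})+O(\lambda)$ with $k=k(z)>0$. The Gauss--Codazzi equations for $u$ (real, $C^2$), a constant $H$ and a function $Q$ are $$u_{z\bar z}-H^2e^{2u}+\tfrac14|Q|^2e^{-2u}=0,\qquad Q_{\bar z}=0 .$$ Throughout take $H=\tfrac12$ and $Q=2/(zH)$. Given $u$, put $v=u-\tfrac12\log|Q|$ and $x=4|z|^{1/2}$. \textbf{Statement.} (1) Let $U\subset\mathbb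 C\setminus\{0\}$ be open and let $u$ be a solution on $U$ of these equations such that $u(z)$ depends only on $|z|$. Then $e^v$ is a function $y$ of $x$ on the open set $\{4|z|^{1/2}:z\in U\}$, and $y$ satisfies $$y''=\frac{(y')^2}{y}-\frac{y'}{x}+y^3-\frac1y,$$ the Painlev\'e III equation $y''=\frac1y(y')^2-\frac1xy'+\frac1x(\alpha y^2+\beta)+\gamma y^3+\frac{\delta}{y}$ with $\alpha=\beta=0$, $\gamma=1$, $\delta=-1$. (2) Let $a>0$. For some $\rho>0$, $\gamma_0^{-1}L$ has an Iwasawa factorization on $\{|z|<\rho\}-(-\rho,0]$. For every open neighbourhood $V$ of $0$ and every Iwasawa factorization $\gamma_0^{-1}L=FwB$ on $U=V\cap(\mathbb C-(-\infty,0])$: $B$ is homogeneous, i.e. $B(\epsilon^2z,\epsilon\lambda)=d(\epsilon)^{-1}B(z,\lambda)d(\epsilon)$ whenever $\epsilon,\lambda\in S^1$ and $z,\epsilon^2z\in U$; the function $u$ defined by $e^u=k^2/H$ depends only on $|z|$ and satisfies the Gauss--Codazzi equations on $U$; and $y=e^v$, as a function of $x$ on $\{4|z|^{1/2}:z\in U\}$,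 satisfies the Painlev\'e III equation with $\alpha=\beta=0$, $\gamma=1$, $\delta=-1$, and $$y\sim-\tfrac14x\,(a+4\log x-4\log4)\qquad\text{as }x\to0^+ .$$ -/

import Mathlib

open Filter Topology Asymptotics
open scoped ContDiff Matrix

namespace TTStar

noncomputable section

/-- Complex `2 × 2` matrices. -/
abbrev Mat2 := Matrix (Fin 2) (Fin 2) ℂ

/-- The matrix `D = diag(1, -1)`. -/
def Dmat : Mat2 := !![1, 0; 0, -1]

/-- The conjugate-linear involution `C(A) = D (Āᵗ)⁻¹ D` of `SL₂ℂ`, whose fixed points are the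
elements of `SU(1,1)`. -/
def realInvolution (A : Mat2) : Mat2 := Dmat * (Aᴴ)⁻¹ * Dmat

/-- A loop of matrices, parametrized by the unit circle. -/
abbrev Loop := Circle → Mat2

/-- A loop is smooth when its entries are smooth functions of the angle. -/
def Loop.Smooth (g : Loop) : Prop :=
  ∀ i j, ContDiff ℝ ∞ (fun θ : ℝ => g (Circle.exp θ) i j)

/-- The twisted loop group `(Λ SL₂ℂ)_σ`: smooth loops `g` with `det g = 1` and
`D g(-l) D = g(l)`. -/
def twistedLoopSL2 : Set Loop :=
  {g | g.Smooth ∧ (∀ l, (g l).det = 1) ∧ ∀ l, Dmat * g (-l) * Dmat = g l}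

/-- The twisted loop group `(Λ SU₁₁)_σ`.  On the unit circle `1 / l̄ = l`, so that the involution
`C` of the loop group acts pointwise. -/
def twistedLoopSU11 : Set Loop :=
  {g | g ∈ twistedLoopSL2 ∧ ∀ l, realInvolution (g l) = g l}

/-- `g = c + O(l)`: the loop `g` extends to a map that is continuous on the closed unit disk and
holomorphic in its interior, with value `c` at the origin. -/
def Loop.ExtendsToDisk (g : Loop) (c : Mat2) : Prop :=
  ∃ G : ℂ → Mat2, (∀ i j, DiffContOnCl ℂ (fun l => G l i j) (Metric.ball 0 1)) ∧
    (∀ l : Circle, G l = g l) ∧ G 0 = c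

/-- A family `g z` of loops, `z ∈ U`, is smooth: its entries are smooth functions
of `z` and of the angle jointly. -/
def SmoothLoopFamily (g : ℂ → Loop) (U : Set ℂ) : Prop :=
  ∀ i j, ContDiffOn ℝ ∞ (fun p : ℂ × ℝ => g p.1 (Circle.exp p.2) i j) (U ×ˢ Set.univ)

/-- The representative `w` of the second open Iwasawa orbit. -/
def wLoop : Loop := fun l => !![0, (l : ℂ); -(l : ℂ)⁻¹, 0]

/-- `G = F w B` is an Iwasawa factorization on `U`, with `F` in `(Λ SU₁₁)_σ`, with `B` in
`(Λ₊ SL₂ℂ)_σ`, and with `B = diag(k, k⁻¹) + O(l)`, `k > 0`. -/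
structure IsIwasawaFactorization (G : ℂ → Loop) (U : Set ℂ) (F B : ℂ → Loop) (k : ℂ → ℝ) :
    Prop where
  mem_SU11 : ∀ z ∈ U, F z ∈ twistedLoopSU11
  mem_SL2 : ∀ z ∈ U, B z ∈ twistedLoopSL2
  extends_to_disk : ∀ z ∈ U, (B z).ExtendsToDisk !![(k z : ℂ), 0; 0, (k z : ℂ)⁻¹]
  pos : ∀ z ∈ U, 0 < k z
  smooth_left : SmoothLoopFamily F U
  smooth_right : SmoothLoopFamily B U
  eq_mul : ∀ z ∈ U, ∀ l, G z l = F z l * wLoop l * B z l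

/-- The matrix `d(ε) = diag(1, ε)`. -/
def dmat (e : Circle) : Mat2 := !![1, 0; 0, (e : ℂ)]

/-- Homogeneity on `U`: `B(ε² z, ε l) = d(ε)⁻¹ B(z, l) d(ε)` for `ε` in the unit circle. -/
def IsHomogeneousOn (B : ℂ → Loop) (U : Set ℂ) : Prop :=
  ∀ e : Circle, ∀ z ∈ U, (e : ℂ) ^ 2 * z ∈ U →
    ∀ l, B ((e : ℂ) ^ 2 * z) (e * l) = (dmat e)⁻¹ * B z l * dmat e

/-- `f₀(z) = ∑_{i ≥ 0} zⁱ / ((i!)² l²ⁱ)`. -/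
def f0 (l z : ℂ) : ℂ := ∑' i : ℕ, z ^ i / ((i.factorial : ℂ) ^ 2 * l ^ (2 * i))

/-- `f₁(z) = -(2/l) ∑_{i ≥ 1} (1 + 1/2 + ⋯ + 1/i) zⁱ / ((i!)² l²ⁱ)`; the term `i = 0` vanishes. -/
def f1 (l z : ℂ) : ℂ :=
  -(2 / l) * ∑' i : ℕ, ((harmonic i : ℚ) : ℂ) * z ^ i / ((i.factorial : ℂ) ^ 2 * l ^ (2 * i))

/-- The derivation `∂ = z d/dz`. -/
def eulerDeriv (f : ℂ → ℂ) (z : ℂ) : ℂ := z * deriv f z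

/-- The holomorphic factor `L₀`, with `L₀(0) = I`. -/
def L0 (z : ℂ) : Loop := fun l =>
  !![f0 l z, l * eulerDeriv (f0 l) z;
     f1 l z, f0 l z + l * eulerDeriv (f1 l) z]

/-- The solution `L = exp((log z) N / l) L₀` of `L⁻¹ dL = (1/l) (0, 1; 1/z, 0) dz` on the slit
plane, where `N = (0, 0; 1, 0)` has square zero. -/
def Lsol (z : ℂ) : Loop := fun l => !![1, 0; Complex.log z / l, 1] * L0 z l

/-- The loop `γ₀` with parameter `a > 0`. -/
def gamma0 (a : ℝ) : Loop := fun l =>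
  !![((1 / √a : ℝ) : ℂ), -(l : ℂ) / ((√a : ℝ) : ℂ); 0, ((√a : ℝ) : ℂ)]

/-- The map `γ₀⁻¹ L`. -/
def translatedL (a : ℝ) (z : ℂ) : Loop := fun l => (gamma0 a l)⁻¹ * Lsol z l

/-- The Gauss-Codazzi equations of a spacelike surface in `ℝ^{2,1}` with metric
`4 e^{2u} (dx² + dy²)`, constant mean curvature `H` and Hopf differential `Q dz²`:
`u_{z z̄} - H² e^{2u} + |Q|² e^{-2u} / 4 = 0` and `Q_{z̄} = 0`, where `4 u_{z z̄} = Δ u`. -/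
def GaussCodazzi (H : ℝ) (Q : ℂ → ℂ) (u : ℂ → ℝ) (U : Set ℂ) : Prop :=
  ContDiffOn ℝ 2 u U ∧ DifferentiableOn ℂ Q U ∧
    ∀ z ∈ U, Laplacian.laplacian u z / 4 - H ^ 2 * Real.exp (2 * u z)
      + ‖Q z‖ ^ 2 * Real.exp (-2 * u z) / 4 = 0

/-- The Hopf differential `Q = 2 / (z H)`. -/
def hopf (H : ℝ) (z : ℂ) : ℂ := 2 / (z * H)

/-- The function `u` with `e^u = k² / H`. -/
def metricExponent (H : ℝ) (k : ℂ → ℝ) (z : ℂ) : ℝ := Real.log (k z ^ 2 / H)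

/-- The function `v = u - (1/2) log |Q|`. -/
def shiftedExponent (H : ℝ) (u : ℂ → ℝ) (z : ℂ) : ℝ := u z - 1 / 2 * Real.log ‖hopf H z‖

/-- `u(z)` depends only on `|z|`, for `z ∈ U`. -/
def IsRadialOn (u : ℂ → ℝ) (U : Set ℂ) : Prop :=
  ∀ z ∈ U, ∀ z' ∈ U, ‖z‖ = ‖z'‖ → u z = u z'

/-- The variable `x = 4 r^{1/2}`, `r = |z|`. -/
def xvar (z : ℂ) : ℝ := 4 * √‖z‖

/-- On the set `S`, the function `y` is a nowhere zero solution of the third Painlevé equation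
`y'' = (y')²/y - y'/x + (α y² + β)/x + γ y³ + δ/y`. -/
def IsPainleveIII (α β γ δ : ℝ) (y : ℝ → ℝ) (S : Set ℝ) : Prop :=
  IsOpen S ∧ ContDiffOn ℝ 2 y S ∧ ∀ x ∈ S, x ≠ 0 ∧ y x ≠ 0 ∧
    deriv (deriv y) x = 1 / y x * (deriv y x) ^ 2 - 1 / x * deriv y x
      + 1 / x * (α * y x ^ 2 + β) + γ * y x ^ 3 + δ / y x

end

end TTStar

open TTStar

/-! Write M = γ₀⁻¹L. If M = FwB, then Fᴴ D F = D and wᴴ D w = -D eliminate F, and Bᴴ D B = -Mᴴ D M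
=: Φ (`hermitianForm`). Thus B is an indefinite spectral factor of an explicit Hermitian loop Φ, in
which log z survives only through log|z|. All properties of B are read off from Φ.

Uniqueness and symmetry. Two factors B, B' of Φ with the normalization at l = 0 differ by T = B
B'⁻¹, which extends to the disk and lies in SU(1,1) on the circle. Each entry of T is then the
conjugate of another entry that also extends, so T is constant by Liouville
(`IsDiskBoundary.eq_const_of_eq_conj`), and positivity of k forces T = 1. Since Φ(ε²z, εl) = d(ε)⁻¹
Φ(z, l) d(ε), uniqueness makes B homogeneous and k radial (`eq_of_hermitianForm_factorization`).

Existence and asymptotics. Put s² = -(a + 2 log|z|), which tends to +∞ at z = 0. The middle factor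
of Φ is Tᴴ D T with T upper triangular and diagonal (s, 1/s). Conjugating by T⁻¹ turns Φ into D(1 +
E) with E = O(s⁴|z|) → 0 as an operator on ℓ¹(ℤ, ℂ²). A linear problem, invertible for small E,
gives a Birkhoff factorization of 1 + E (`birkhoffLoop_spec`), whence k² = s² c with c → 1. As e^v =
(x/8) e^u = (x/4) k² and |z| = x²/16, the asymptotics of y follow from those of c.

Gauss-Codazzi. The derivatives of Bᴴ D B = -Mᴴ D M in the two real directions, with M⁻¹dM = A dz,
determine ∂̄B·B⁻¹ by Liouville. The Laplacian of the identity then has a (0,0) entry whose real part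
is constant on the circle; its value at l = 0 is the equation for log k
(`IsIwasawaFactorization.laplacian_identity`). Smoothness of k is itself proved from data on the
circle, by the maximum principle. Finally a radial u satisfies an ordinary equation in r = |z|, and
r = x²/16 turns it into Painlevé III (`exists_painleve`). -/

namespace TTStar

noncomputable section

/-! ### Boundary values of holomorphic functions on the disk, and Liouville's theorem. -/

/-- The function `f` on the unit circle extends continuously to the closed unit disk,
holomorphically to its interior, with value `c` at the origin. -/
def IsDiskBoundary (f : Circle → ℂ) (c : ℂ) : Prop :=
  ∃ G : ℂ → ℂ, DiffContOnCl ℂ G (Metric.ball 0 1) ∧ (∀ l : Circle, G l = f l) ∧ G 0 = c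

namespace IsDiskBoundary

variable {f g : Circle → ℂ} {c d : ℂ}

theorem congr (hf : IsDiskBoundary f c) (h : ∀ l, f l = g l) (hc : c = d) :
    IsDiskBoundary g d := by
  obtain rfl : f = g := funext h
  exact hc ▸ hf

theorem const (c : ℂ) : IsDiskBoundary (fun _ => c) c :=
  ⟨fun _ => c, diffContOnCl_const, fun _ => rfl, rfl⟩

theorem coe : IsDiskBoundary (fun l => (l : ℂ)) 0 :=
  ⟨fun l => l, differentiable_id.diffContOnCl, fun _ => rfl, rfl⟩

theorem add (hf : IsDiskBoundary f c) (hg : IsDiskBoundary g d) :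
    IsDiskBoundary (fun l => f l + g l) (c + d) := by
  obtain ⟨F, hF, hFf, rfl⟩ := hf
  obtain ⟨G, hG, hGg, rfl⟩ := hg
  exact ⟨F + G, hF.add hG, fun l => by simp [hFf, hGg], rfl⟩

theorem mul (hf : IsDiskBoundary f c) (hg : IsDiskBoundary g d) :
    IsDiskBoundary (fun l => f l * g l) (c * d) := by
  obtain ⟨F, hF, hFf, rfl⟩ := hf
  obtain ⟨G, hG, hGg, rfl⟩ := hg
  exact ⟨fun z => F z • G z, hF.smul hG, fun l => by simp [hFf, hGg], rfl⟩

theorem const_mul (a : ℂ) (hf : IsDiskBoundary f c) : IsDiskBoundary (fun l => a * f l) (a * c) :=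
  (const a).mul hf

theorem neg (hf : IsDiskBoundary f c) : IsDiskBoundary (fun l => -f l) (-c) :=
  (hf.const_mul (-1)).congr (fun l => by ring) (by ring)

theorem sub (hf : IsDiskBoundary f c) (hg : IsDiskBoundary g d) :
    IsDiskBoundary (fun l => f l - g l) (c - d) :=
  (hf.add hg.neg).congr (fun l => by ring) (by ring)

theorem comp_mul (hf : IsDiskBoundary f c) (e : Circle) :
    IsDiskBoundary (fun l => f (e * l)) c := by
  obtain ⟨F, hF, hFf, rfl⟩ := hf
  refine ⟨fun z => F (e * z), ?_, fun l => by simp [← hFf], by simp⟩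
  refine hF.comp (differentiable_id.const_mul (e : ℂ)).diffContOnCl fun z hz => ?_
  simpa [Circle.norm_coe] using hz

/-- The zero at the origin is removable, by `dslope`. Off-diagonal entries vanish at the origin, so
this gains one power of l in the Liouville arguments. -/
theorem div_coe (hf : IsDiskBoundary f 0) : ∃ d, IsDiskBoundary (fun l => f l * (l : ℂ)⁻¹) d := by
  obtain ⟨F, hF, hFf, hF0⟩ := hf
  have h0 : Metric.ball (0 : ℂ) 1 ∈ 𝓝 (0 : ℂ) := Metric.ball_mem_nhds _ one_pos
  refine ⟨dslope F 0 0, dslope F 0, ⟨?_, ?_⟩, fun l => ?_, rfl⟩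
  · exact (Complex.differentiableOn_dslope h0).2 hF.differentiableOn
  · rw [continuousOn_dslope (mem_of_superset h0 subset_closure)]
    exact ⟨hF.continuousOn, hF.differentiableAt' h0⟩
  · rw [dslope_of_ne _ l.coe_ne_zero, slope_def_field, hFf, hF0]
    simp [div_eq_mul_inv]

/-- The maximum principle for boundary values. -/
theorem norm_le_of_forall {F : ℂ → ℂ} (hF : DiffContOnCl ℂ F (Metric.ball 0 1)) {C : ℝ}
    (h : ∀ l : Circle, ‖F l‖ ≤ C) {z : ℂ} (hz : z ∈ Metric.closedBall (0 : ℂ) 1) : ‖F z‖ ≤ C := by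
  refine Complex.norm_le_of_forall_mem_frontier_norm_le Metric.isBounded_ball hF
    (fun w hw => ?_) (by rwa [closure_ball _ one_ne_zero])
  rw [frontier_ball _ one_ne_zero] at hw
  exact h ⟨w, by simpa [Submonoid.unitSphere] using hw⟩

/-- The maximum principle for exp(sF) with s = ±i bounds the imaginary part from both sides by 0 on
the disk; a holomorphic function with constant imaginary part is constant. -/
theorem eq_const_of_im_eq_zero (hf : IsDiskBoundary f c) (h : ∀ l, (f l).im = 0) :
    c.im = 0 ∧ ∀ l, f l = c := by
  obtain ⟨F, hF, hFf, rfl⟩ := hf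
  have key : ∀ s : ℂ, (∀ l : Circle, (s * F l).re = 0) → ∀ z ∈ Metric.closedBall (0 : ℂ) 1,
      (s * F z).re ≤ 0 := by
    intro s hs z hz
    have h1 : DiffContOnCl ℂ (fun z => Complex.exp (s * F z)) (Metric.ball 0 1) :=
      Complex.differentiable_exp.comp_diffContOnCl (hF.const_smul s)
    have := norm_le_of_forall h1 (C := 1) (fun l => by rw [Complex.norm_exp, hs, Real.exp_zero]) hz
    rwa [Complex.norm_exp, Real.exp_le_one_iff] at this
  have him : ∀ z ∈ Metric.closedBall (0 : ℂ) 1, (F z).im = 0 := by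
    intro z hz
    have h1 := key Complex.I (fun l => by simp [hFf, h]) z hz
    have h2 := key (-Complex.I) (fun l => by simp [hFf, h]) z hz
    simp at h1 h2
    linarith
  obtain ⟨b, hb⟩ := AnalyticOnNhd.eq_const_of_im_eq_const (c₀ := 0)
    (hF.differentiableOn.analyticOnNhd Metric.isOpen_ball)
    (fun z hz => him z (Metric.ball_subset_closedBall hz)) Metric.isOpen_ball
    ⟨⟨0, by simp⟩, (convex_ball (0 : ℂ) 1).isPreconnected⟩
  have hb0 : F 0 = b := hb 0 (by simp)
  have : Set.EqOn F (fun _ => b) (closure (Metric.ball 0 1)) :=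
    Set.EqOn.of_subset_closure hb hF.continuousOn continuousOn_const subset_closure subset_rfl
  refine ⟨him 0 (by simp), fun l => ?_⟩
  rw [hb0, ← hFf]
  exact this (by rw [closure_ball _ one_ne_zero]; simp [Circle.norm_coe])

/-- Liouville's theorem: a function on the circle that extends to both sides is constant. -/
theorem eq_const_of_eq_conj (hf : IsDiskBoundary f c) (hg : IsDiskBoundary g d)
    (h : ∀ l, f l = star (g l)) : c = star d ∧ ∀ l, f l = c := by
  -- If f is the conjugate of g on the circle, then f + g and i(f - g) are both real there.
  obtain ⟨h1, h1'⟩ := (hf.add hg).eq_const_of_im_eq_zero (fun l => by simp [h])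
  obtain ⟨h2, h2'⟩ := ((hf.sub hg).const_mul Complex.I).eq_const_of_im_eq_zero
    (fun l => by simp [h])
  simp at h1 h2
  refine ⟨Complex.ext (by simp; linarith) (by simp; linarith), fun l => ?_⟩
  have := h1' l
  have h3 := mul_left_cancel₀ Complex.I_ne_zero (h2' l)
  linear_combination this / 2 + h3 / 2

/-- Boundary values with constant real part are constant. -/
theorem re_eq_of_re_const (hf : IsDiskBoundary f c) {x : ℝ} (h : ∀ l, (f l).re = x) :
    c.re = x := by
  obtain ⟨h1, h1'⟩ := ((hf.sub (const (x : ℂ))).const_mul Complex.I).eq_const_of_im_eq_zero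
    (fun l => by simp [h])
  simp at h1
  linarith

/-- Boundary values are closed under uniform limits. -/
theorem of_tendstoUniformly {ι : Type*} {l : Filter ι} [l.NeBot] {f : ι → Circle → ℂ}
    {f₀ : Circle → ℂ} {c : ι → ℂ} (hf : ∀ᶠ i in l, IsDiskBoundary (f i) (c i))
    (h : TendstoUniformly f f₀ l) : ∃ c₀, IsDiskBoundary f₀ c₀ ∧ Tendsto c l (𝓝 c₀) := by
  -- The hypothesis holds only eventually; the extension is taken to be 0 at the remaining indices.
  have hex : ∀ i, ∃ G : ℂ → ℂ, IsDiskBoundary (f i) (c i) →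
      DiffContOnCl ℂ G (Metric.ball 0 1) ∧ (∀ l : Circle, G l = f i l) ∧ G 0 = c i := by
    intro i
    by_cases hi : IsDiskBoundary (f i) (c i)
    · exact hi.imp fun G hG _ => hG
    · exact ⟨0, fun h => absurd h hi⟩
  choose G hG using hex
  -- The maximum principle carries the uniform Cauchy property from the circle to the closed disk.
  have hcau : UniformCauchySeqOn G l (Metric.closedBall 0 1) := by
    intro u hu
    obtain ⟨ε, hε, hεu⟩ := Metric.mem_uniformity_dist.1 hu
    have h1 := (tendstoUniformlyOn_univ.2 h).uniformCauchySeqOn _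
      (Metric.dist_mem_uniformity (half_pos hε))
    filter_upwards [h1, hf.prod_mk hf] with ⟨i, j⟩ hij ⟨hi, hj⟩ z hz
    refine hεu (lt_of_le_of_lt ?_ (half_lt_self hε))
    rw [dist_eq_norm]
    refine norm_le_of_forall ((hG i hi).1.sub (hG j hj).1) (fun w => ?_) hz
    have : dist (f i w) (f j w) < ε / 2 := hij w (Set.mem_univ w)
    rw [dist_eq_norm] at this
    simpa [(hG i hi).2.1, (hG j hj).2.1] using this.le
  have hlim : ∀ z, ∃ w, z ∈ Metric.closedBall (0 : ℂ) 1 → Tendsto (fun i => G i z) l (𝓝 w) := by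
    intro z
    by_cases hz : z ∈ Metric.closedBall (0 : ℂ) 1
    · obtain ⟨w, hw⟩ := cauchy_map_iff_exists_tendsto.1 (hcau.cauchy_map hz)
      exact ⟨w, fun _ => hw⟩
    · exact ⟨0, fun h => absurd h hz⟩
  choose F hF using hlim
  have hunif : TendstoUniformlyOn G F l (Metric.closedBall 0 1) :=
    hcau.tendstoUniformlyOn_of_tendsto hF
  refine ⟨F 0, ⟨F, ⟨?_, ?_⟩, fun w => ?_, rfl⟩, ?_⟩
  · refine (hunif.mono Metric.ball_subset_closedBall).tendstoLocallyUniformlyOn.differentiableOn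
      (hf.mono fun i hi => (hG i hi).1.differentiableOn) Metric.isOpen_ball
  · rw [closure_ball _ one_ne_zero]
    refine hunif.continuousOn (hf.mono fun i hi => ?_).frequently
    simpa [closure_ball] using (hG i hi).1.continuousOn
  · have h2 : Tendsto (fun i => G i w) l (𝓝 (f₀ w)) :=
      (h.tendsto_at w).congr' (hf.mono fun i hi => ((hG i hi).2.1 w).symm)
    exact tendsto_nhds_unique (hF w (by simp [Circle.norm_coe])) h2
  · exact (hF 0 (by simp)).congr' (hf.mono fun i hi => (hG i hi).2.2)

end IsDiskBoundary

/-- Differentiation of a smooth one-parameter family of boundary values. -/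
theorem exists_hasDerivAt_of_isDiskBoundary {f : ℝ → Circle → ℂ} {κ : ℝ → ℂ} {J : Set ℝ}
    (hJ : IsOpen J)
    (hf : ContDiffOn ℝ ∞ (fun p : ℝ × ℝ => f p.1 (Circle.exp p.2)) (J ×ˢ Set.univ))
    (h : ∀ t ∈ J, IsDiskBoundary (f t) (κ t)) :
    ContDiffOn ℝ ∞ (fun p : ℝ × ℝ => deriv (fun s => f s (Circle.exp p.2)) p.1)
      (J ×ˢ Set.univ) ∧
    (∀ t ∈ J, IsDiskBoundary (fun l => deriv (fun s => f s l) t) (deriv κ t)) ∧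
    (∀ t ∈ J, DifferentiableAt ℝ κ t) ∧
    ∀ t ∈ J, ∀ l, DifferentiableAt ℝ (fun s => f s l) t := by
  set F : ℝ × ℝ → ℂ := fun p => f p.1 (Circle.exp p.2) with hFdef
  have hopen : IsOpen (J ×ˢ (Set.univ : Set ℝ)) := hJ.prod isOpen_univ
  have hpart : ∀ t ∈ J, ∀ θ : ℝ,
      HasDerivAt (fun s => f s (Circle.exp θ)) (fderiv ℝ F (t, θ) (1, 0)) t := by
    intro t ht θ
    have h1 : HasFDerivAt F (fderiv ℝ F (t, θ)) (t, θ) :=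
      ((hf.contDiffAt (hopen.mem_nhds ⟨ht, trivial⟩)).differentiableAt (by simp)).hasFDerivAt
    exact h1.comp_hasDerivAt t ((hasDerivAt_id t).prodMk (hasDerivAt_const t θ))
  have hsm : ContDiffOn ℝ ∞ (fun p : ℝ × ℝ => deriv (fun s => f s (Circle.exp p.2)) p.1)
      (J ×ˢ Set.univ) := by
    have h1 : ContDiffOn ℝ ∞ (fun p => fderiv ℝ F p (1, 0)) (J ×ˢ Set.univ) :=
      (hf.fderiv_of_isOpen hopen (by simp)).clm_apply contDiffOn_const
    exact h1.congr fun p hp => (hpart p.1 hp.1 p.2).deriv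
  have hsurj : ∀ l : Circle, ∃ θ ∈ Set.Icc (-Real.pi) Real.pi, Circle.exp θ = l := fun l =>
    ⟨Complex.arg l, ⟨(Complex.neg_pi_lt_arg _).le, Complex.arg_le_pi _⟩, Circle.exp_arg l⟩
  have hdiff : ∀ t ∈ J, ∀ l, DifferentiableAt ℝ (fun s => f s l) t := by
    intro t ht l
    obtain ⟨θ, -, rfl⟩ := hsurj l
    exact (hpart t ht θ).differentiableAt
  have main : ∀ t ∈ J, ∃ d, IsDiskBoundary (fun l => deriv (fun s => f s l) t) d ∧
      HasDerivAt κ d t := by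
    intro t ht
    -- Angles are confined to a compact interval, so joint continuity of the derivative gives
    -- uniformity over the circle.
    have hu : TendstoUniformly (fun (s : ℝ) (θ : Set.Icc (-Real.pi) Real.pi) =>
        deriv (fun s => f s (Circle.exp θ)) s) (fun θ => deriv (fun s => f s (Circle.exp θ)) t)
        (𝓝 t) := by
      refine ContinuousOn.tendstoUniformly (hJ.mem_nhds ht) ?_
      refine hsm.continuousOn.comp (f := fun p : ℝ × Set.Icc (-Real.pi) Real.pi => (p.1, (p.2 : ℝ)))
        (by fun_prop) fun p hp => ⟨hp.1, trivial⟩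
    have hs : TendstoUniformly (fun (s : ℝ) (l : Circle) => slope (fun s => f s l) t s)
        (fun l => deriv (fun s => f s l) t) (𝓝[≠] t) := by
      rw [Metric.tendstoUniformly_iff] at hu ⊢
      intro ε hε
      obtain ⟨δ, hδ, hδ'⟩ := Metric.eventually_nhds_iff_ball.1
        ((hu (ε / 2) (half_pos hε)).and (hJ.mem_nhds ht))
      rw [eventually_nhdsWithin_iff]
      filter_upwards [Metric.ball_mem_nhds t hδ] with s hs hst l
      obtain ⟨θ, hθ, rfl⟩ := hsurj l
      set D := deriv (fun s => f s (Circle.exp θ)) t with hD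
      -- Mean value inequality for f - sD, where D is the derivative at t: it makes the difference
      -- quotients converge uniformly in l.
      have hb := (convex_ball t δ).norm_image_sub_le_of_norm_hasDerivWithin_le
        (f := fun s => f s (Circle.exp θ) - s * D)
        (f' := fun s => deriv (fun s => f s (Circle.exp θ)) s - D) (C := ε / 2)
        (fun x hx => by
          have h1 := ((hdiff x (hδ' x hx).2 (Circle.exp θ)).hasDerivAt.sub
            (((hasDerivAt_id x).ofReal_comp).mul_const D))
          rw [Complex.ofReal_one, one_mul] at h1
          exact h1.hasDerivWithinAt)
        (fun x hx => by
          have := (hδ' x hx).1 ⟨θ, hθ⟩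
          rw [dist_comm, dist_eq_norm] at this
          exact this.le) (Metric.mem_ball_self hδ) hs
      have hst' : (s : ℂ) - t ≠ 0 := by
        rw [sub_ne_zero]; exact_mod_cast hst
      rw [dist_comm, dist_eq_norm, slope_def_module]
      have e : (s - t)⁻¹ • (f s (Circle.exp θ) - f t (Circle.exp θ)) - D =
          ((s : ℂ) - t)⁻¹ * (f s (Circle.exp θ) - s * D - (f t (Circle.exp θ) - t * D)) := by
        rw [Complex.real_smul]
        push_cast
        field_simp
        ring
      rw [e, norm_mul, norm_inv, ← Complex.ofReal_sub, Complex.norm_real]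
      refine lt_of_le_of_lt ?_ (half_lt_self hε)
      rw [inv_mul_le_iff₀ (norm_pos_iff.2 (sub_ne_zero.2 hst))]
      linarith
    have hev : ∀ᶠ s in 𝓝[≠] t,
        IsDiskBoundary (fun l => slope (fun s => f s l) t s) (slope κ t s) := by
      filter_upwards [nhdsWithin_le_nhds (hJ.mem_nhds ht)] with s hs
      refine (((h s hs).sub (h t ht)).const_mul ((s : ℂ) - t)⁻¹).congr (fun l => ?_) ?_ <;>
      · rw [slope_def_module, Complex.real_smul]
        push_cast
        rfl
    obtain ⟨d, hd, hd'⟩ := IsDiskBoundary.of_tendstoUniformly hev hs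
    exact ⟨d, hd, hasDerivAt_iff_tendsto_slope.2 hd'⟩
  refine ⟨hsm, fun t ht => ?_, fun t ht => ?_, hdiff⟩
  · obtain ⟨d, hd, hd'⟩ := main t ht
    rwa [hd'.deriv]
  · obtain ⟨d, hd, hd'⟩ := main t ht
    exact hd'.differentiableAt

/-- The value at the origin of a smooth family of boundary values is smooth. -/
theorem contDiffOn_of_isDiskBoundary {J : Set ℝ} (hJ : IsOpen J) (n : ℕ) :
    ∀ {f : ℝ → Circle → ℂ} {κ : ℝ → ℂ},
    ContDiffOn ℝ ∞ (fun p : ℝ × ℝ => f p.1 (Circle.exp p.2)) (J ×ˢ Set.univ) →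
    (∀ t ∈ J, IsDiskBoundary (f t) (κ t)) → ContDiffOn ℝ n κ J := by
  -- The family of derivatives satisfies the same two hypotheses, with the derivative of κ as value
  -- at the origin; hence the induction runs over all f and κ.
  induction n with
  | zero =>
    intro f κ hf h
    obtain ⟨-, -, h3, -⟩ := exists_hasDerivAt_of_isDiskBoundary hJ hf h
    rw [Nat.cast_zero, contDiffOn_zero]
    exact fun t ht => (h3 t ht).continuousAt.continuousWithinAt
  | succ n ih =>
    intro f κ hf h
    obtain ⟨h1, h2, h3, -⟩ := exists_hasDerivAt_of_isDiskBoundary hJ hf h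
    rw [Nat.cast_succ, contDiffOn_succ_iff_deriv_of_isOpen hJ]
    exact ⟨fun t ht => (h3 t ht).differentiableWithinAt, by simp, ih h1 h2⟩


/-! ### Uniqueness of the indefinite spectral factorization. -/

theorem Loop.extendsToDisk_iff {g : Loop} {c : Mat2} :
    g.ExtendsToDisk c ↔ ∀ i j, IsDiskBoundary (fun l => g l i j) (c i j) := by
  constructor
  · rintro ⟨G, hG, hGg, rfl⟩ i j
    exact ⟨fun l => G l i j, hG i j, fun l => by simp [hGg], rfl⟩
  · intro h
    choose G hG using h
    exact ⟨fun l i j => G i j l, fun i j => (hG i j).1, fun l => by ext i j; exact (hG i j).2.1 l,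
      by ext i j; exact (hG i j).2.2⟩

theorem Dmat_mul_self : Dmat * Dmat = 1 := by
  ext i j; fin_cases i <;> fin_cases j <;> simp [Dmat]

theorem conjTranspose_Dmat : Dmatᴴ = Dmat := by
  ext i j; fin_cases i <;> fin_cases j <;> simp [Dmat]

/-- The entries of an element of `SU(1,1)`. -/
theorem entries_of_conjTranspose_mul {A : Mat2} (hdet : A.det = 1) (h : Aᴴ * Dmat * A = Dmat) :
    A 1 1 = star (A 0 0) ∧ A 1 0 = star (A 0 1) := by
  have h1 : Aᴴ * Dmat = Dmat * A.adjugate := by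
    calc Aᴴ * Dmat = Aᴴ * Dmat * A * A.adjugate := by
          rw [Matrix.mul_assoc _ A, Matrix.mul_adjugate, hdet, one_smul, Matrix.mul_one]
      _ = _ := by rw [h]
  have h00 := congrFun (congrFun h1 0) 0
  have h11 := congrFun (congrFun h1 0) 1
  simp [Dmat, Matrix.mul_apply, Matrix.adjugate_fin_two, Fin.sum_univ_two] at h00 h11
  refine ⟨h00.symm, ?_⟩
  rw [← h11]
  simp

/-- Uniqueness of the indefinite spectral factorization `Bᴴ D B`. -/
theorem eq_of_conjTranspose_mul_eq {B B' : Loop} {k k' : ℝ} (hk : 0 < k) (hk' : 0 < k')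
    (hB : ∀ l, (B l).det = 1) (hB' : ∀ l, (B' l).det = 1)
    (hd : B.ExtendsToDisk !![(k : ℂ), 0; 0, (k : ℂ)⁻¹])
    (hd' : B'.ExtendsToDisk !![(k' : ℂ), 0; 0, (k' : ℂ)⁻¹])
    (h : ∀ l, (B l)ᴴ * Dmat * B l = (B' l)ᴴ * Dmat * B' l) : k = k' ∧ B = B' := by
  rw [Loop.extendsToDisk_iff] at hd hd'
  have hadj : ∀ l, B' l * (B' l).adjugate = 1 := fun l => by
    rw [Matrix.mul_adjugate, hB', one_smul]
  have hadj' : ∀ l, (B' l).adjugate * B' l = 1 := fun l => by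
    rw [Matrix.adjugate_mul, hB', one_smul]
  -- T = B B'⁻¹ extends to the disk and preserves D; the relations between the entries of an SU(1,1)
  -- matrix then feed Liouville's theorem.
  set T : Loop := fun l => B l * (B' l).adjugate with hT
  have hTdet : ∀ l, (T l).det = 1 := fun l => by
    rw [hT, Matrix.det_mul, hB, Matrix.det_adjugate, hB']; simp
  have hTD : ∀ l, (T l)ᴴ * Dmat * T l = Dmat := fun l => by
    calc (T l)ᴴ * Dmat * T l
        = ((B' l).adjugate)ᴴ * ((B l)ᴴ * Dmat * B l) * (B' l).adjugate := by
          simp only [hT, Matrix.conjTranspose_mul, Matrix.mul_assoc]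
      _ = (B' l * (B' l).adjugate)ᴴ * Dmat * (B' l * (B' l).adjugate) := by
          rw [h]; simp only [Matrix.conjTranspose_mul, Matrix.mul_assoc]
      _ = Dmat := by rw [hadj]; simp
  have hent := fun l => entries_of_conjTranspose_mul (hTdet l) (hTD l)
  have hTe : ∀ l i j, T l i j = B l i 0 * (B' l).adjugate 0 j + B l i 1 * (B' l).adjugate 1 j :=
    fun l i j => by simp [hT, Matrix.mul_apply, Fin.sum_univ_two]
  have ha : ∀ i j, IsDiskBoundary (fun l => (B' l).adjugate i j)
      ((!![(k' : ℂ), 0; 0, (k' : ℂ)⁻¹] : Mat2).adjugate i j) := by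
    intro i j
    fin_cases i <;> fin_cases j
    · exact (hd' 1 1).congr (fun l => by simp [Matrix.adjugate_fin_two]) (by simp)
    · exact (hd' 0 1).neg.congr (fun l => by simp [Matrix.adjugate_fin_two]) (by simp)
    · exact (hd' 1 0).neg.congr (fun l => by simp [Matrix.adjugate_fin_two]) (by simp)
    · exact (hd' 0 0).congr (fun l => by simp [Matrix.adjugate_fin_two]) (by simp)
  have hTd : ∀ i j, IsDiskBoundary (fun l => T l i j)
      ((!![(k : ℂ) * (k' : ℂ)⁻¹, 0; 0, (k : ℂ)⁻¹ * k'] : Mat2) i j) := by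
    intro i j
    refine (((hd i 0).mul (ha 0 j)).add ((hd i 1).mul (ha 1 j))).congr (fun l => (hTe l i j).symm) ?_
    fin_cases i <;> fin_cases j <;> simp [Matrix.adjugate_fin_two]
  obtain ⟨h1, h2⟩ := (hTd 1 1).eq_const_of_eq_conj (hTd 0 0) (fun l => (hent l).1)
  obtain ⟨-, h3⟩ := (hTd 1 0).eq_const_of_eq_conj (hTd 0 1) (fun l => (hent l).2)
  -- The values of T₁₁ and T₀₀ at the origin are conjugate, and both are positive ratios of k and
  -- k'.
  have hkk : k = k' := by
    have : k⁻¹ * k' = k * k'⁻¹ := by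
      have := h1
      simp at this
      exact_mod_cast this
    field_simp at this
    nlinarith
  subst hkk
  have hk0 : (k : ℂ) ≠ 0 := by exact_mod_cast hk.ne'
  have hT1 : ∀ l, T l = 1 := by
    intro l
    have e11 := h2 l
    have e10 := h3 l
    have e00 := (hent l).1
    have e01 := (hent l).2
    simp [hk0] at e11 e10
    rw [e11] at e00
    rw [e10] at e01
    ext i j
    fin_cases i <;> fin_cases j
    · have := congrArg star e00; simpa using this.symm
    · have := congrArg star e01; simpa using this.symm
    · simpa using e10
    · simpa using e11
  refine ⟨rfl, funext fun l => ?_⟩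
  calc B l = T l * B' l := by rw [hT]; simp only [Matrix.mul_assoc, hadj', Matrix.mul_one]
    _ = B' l := by rw [hT1, Matrix.one_mul]


/-! ### Entire series, evaluated both at complex numbers and at operators. -/

section EntireSum

/-- The sum of a power series in a Banach algebra. -/
def entireSum {A : Type*} [NormedRing A] [NormedAlgebra ℂ A] (c : ℕ → ℂ) (x : A) : A :=
  ∑' i, c i • x ^ i

variable {A : Type*} [NormedRing A] [NormedAlgebra ℂ A] {c : ℕ → ℂ}

@[simp]
theorem entireSum_zero (c : ℕ → ℂ) : entireSum c (0 : A) = c 0 • 1 := by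
  rw [entireSum, tsum_eq_single 0 fun i hi => by simp [hi]]
  simp

variable [CompleteSpace A]

theorem summable_two_pow_div_factorial_mul_pow (r : ℝ) :
    Summable fun i : ℕ => 2 ^ i / (i.factorial : ℝ) * r ^ i :=
  (Real.summable_pow_div_factorial (2 * r)).congr fun i => by rw [mul_pow]; ring

theorem summable_entireSum (hc : ∀ i, ‖c i‖ ≤ 2 ^ i / (i.factorial : ℝ)) (x : A) :
    Summable fun i => c i • x ^ i := by
  -- The term i = 0 is split off because ‖1‖ ≤ 1 is not assumed in the algebra.
  rw [← summable_nat_add_iff 1]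
  refine Summable.of_norm_bounded
    ((summable_nat_add_iff 1).2 (summable_two_pow_div_factorial_mul_pow ‖x‖)) fun i => ?_
  rw [norm_smul]
  exact mul_le_mul (hc _) (norm_pow_le' x i.succ_pos) (norm_nonneg _) (by positivity)

theorem contDiff_entireSum (hc : ∀ i, ‖c i‖ ≤ 2 ^ i / (i.factorial : ℝ)) {n : WithTop ℕ∞} :
    ContDiff ℂ n (entireSum c : A → A) := by
  have hr : (FormalMultilinearSeries.ofScalars A c).radius = ⊤ := by
    refine FormalMultilinearSeries.radius_eq_top_of_summable_norm _ fun r => ?_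
    rw [← summable_nat_add_iff 1]
    refine Summable.of_norm_bounded
      ((summable_nat_add_iff 1).2 (summable_two_pow_div_factorial_mul_pow r)) fun i => ?_
    rw [norm_mul, norm_norm, norm_pow, NNReal.norm_eq]
    gcongr
    exact (FormalMultilinearSeries.ofScalars_norm_le A c _ i.succ_pos).trans (hc _)
  have h := (FormalMultilinearSeries.ofScalars A c).hasFPowerSeriesOnBall (by rw [hr]; simp)
  have e : (FormalMultilinearSeries.ofScalars A c).sum = entireSum c :=
    FormalMultilinearSeries.ofScalarsSum_eq_tsum c
  rw [e, hr] at h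
  rw [← contDiffOn_univ]
  have h2 := h.analyticOnNhd
  simp only [Metric.eball_top] at h2
  exact h2.contDiffOn uniqueDiffOn_univ

theorem hasDerivAt_entireSum (hc : ∀ i, ‖c i‖ ≤ 2 ^ i / (i.factorial : ℝ)) (q : ℂ) :
    HasDerivAt (entireSum c) (entireSum (fun i => (i + 1) * c (i + 1)) q) q := by
  set u : ℕ → ℝ := fun i => i * (2 ^ i / (i.factorial : ℝ)) * (‖q‖ + 1) ^ (i - 1)
  have hu : Summable u := by
    rw [← summable_nat_add_iff 1]
    refine ((Real.summable_pow_div_factorial (2 * (‖q‖ + 1))).mul_left 2).congr fun i => ?_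
    simp only [u]
    rw [Nat.factorial_succ, mul_pow]
    push_cast
    have : ((i : ℝ) + 1) ≠ 0 := by positivity
    field_simp
    simp [pow_succ, mul_comm]
  have hb : ∀ (i : ℕ) (z : ℂ), ‖z‖ ≤ ‖q‖ + 1 → ‖c i * (i * z ^ (i - 1))‖ ≤ u i := by
    intro i z hz
    rw [norm_mul, norm_mul, norm_pow, Complex.norm_natCast]
    calc ‖c i‖ * (i * ‖z‖ ^ (i - 1)) ≤ 2 ^ i / (i.factorial : ℝ) * (i * (‖q‖ + 1) ^ (i - 1)) := by
          gcongr; exact hc i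
      _ = _ := by ring
  have h := hasDerivAt_tsum_of_isPreconnected (t := Metric.ball (0 : ℂ) (‖q‖ + 1))
    (g := fun i z => c i • z ^ i) (g' := fun i z => c i * (i * z ^ (i - 1)))
    (y₀ := 0) (y := q) hu Metric.isOpen_ball (convex_ball _ _).isPreconnected
    (fun i z _ => by simpa using (hasDerivAt_pow i z).const_mul (c i))
    (fun i z hz => hb i z (by simpa using (Metric.mem_ball.1 hz).le)) (by simp; positivity)
    (summable_entireSum hc 0) (by simp)
  refine h.congr_deriv ?_
  rw [(Summable.of_norm_bounded hu fun i => hb i q (by linarith)).tsum_eq_zero_add, entireSum]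
  simp
  exact tsum_congr fun i => by ring

theorem mul_entireSum_succ (hc : ∀ i, ‖c i‖ ≤ 2 ^ i / (i.factorial : ℝ)) (h0 : c 0 = 0) (q : ℂ) :
    q * entireSum (fun i => c (i + 1)) q = entireSum c q := by
  rw [entireSum, entireSum, (summable_entireSum hc q).tsum_eq_zero_add, ← tsum_mul_left, h0]
  simp
  exact tsum_congr fun i => by ring

end EntireSum

/-! ### The coefficients of f₀, f₁ and their differential equations. -/

section Coefficients

/-- The coefficients `1 / (i!)²`. -/
def phiCoeff (i : ℕ) : ℂ := 1 / (i.factorial : ℂ) ^ 2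

/-- The coefficients `i / (i!)²`. -/
def phiCoeff' (i : ℕ) : ℂ := i / (i.factorial : ℂ) ^ 2

/-- The coefficients `(1 + 1/2 + ⋯ + 1/i) / (i!)²`. -/
def psiCoeff (i : ℕ) : ℂ := ((harmonic i : ℚ) : ℂ) / (i.factorial : ℂ) ^ 2

/-- The coefficients `i (1 + 1/2 + ⋯ + 1/i) / (i!)²`. -/
def psiCoeff' (i : ℕ) : ℂ := i * ((harmonic i : ℚ) : ℂ) / (i.factorial : ℂ) ^ 2

theorem harmonic_le (i : ℕ) : harmonic i ≤ i := by
  induction i with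
  | zero => simp
  | succ n ih =>
    rw [harmonic_succ]
    push_cast
    have : ((n : ℚ) + 1)⁻¹ ≤ 1 := inv_le_one_of_one_le₀ (by linarith [n.cast_nonneg (α := ℚ)])
    linarith

theorem norm_harmonic_le (i : ℕ) : ‖((harmonic i : ℚ) : ℂ)‖ ≤ i := by
  have h0 : 0 ≤ harmonic i := Finset.sum_nonneg fun j _ => by positivity
  rw [Complex.norm_ratCast, abs_of_nonneg (by exact_mod_cast h0)]
  exact_mod_cast harmonic_le i

/-- A single bound serves all four coefficient sequences; it rests on i ≤ i! and i ≤ 2ⁱ. -/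
theorem div_factorial_sq_le {x : ℝ} {i : ℕ} (hx : x ≤ i * i) :
    x / (i.factorial : ℝ) ^ 2 ≤ 2 ^ i / i.factorial := by
  have h1 : (0 : ℝ) < i.factorial := by exact_mod_cast i.factorial_pos
  have h2 : (i : ℝ) ≤ i.factorial := by exact_mod_cast i.self_le_factorial
  have h3 : (i : ℝ) ≤ 2 ^ i := by exact_mod_cast i.lt_two_pow_self.le
  rw [div_le_div_iff₀ (by positivity) h1]
  calc x * i.factorial ≤ (i * i) * i.factorial := by gcongr
    _ ≤ 2 ^ i * i.factorial * i.factorial := by gcongr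
    _ = _ := by ring

theorem norm_phiCoeff_le (i : ℕ) : ‖phiCoeff i‖ ≤ 2 ^ i / (i.factorial : ℝ) := by
  rw [phiCoeff, norm_div, norm_pow, Complex.norm_natCast, norm_one]
  rcases i.eq_zero_or_pos with rfl | h
  · simp
  · exact div_factorial_sq_le (by exact_mod_cast Nat.mul_pos h h)

theorem norm_phiCoeff'_le (i : ℕ) : ‖phiCoeff' i‖ ≤ 2 ^ i / (i.factorial : ℝ) := by
  rw [phiCoeff', norm_div, norm_pow, Complex.norm_natCast, Complex.norm_natCast]
  exact div_factorial_sq_le (by exact_mod_cast Nat.le_mul_self i)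

theorem norm_psiCoeff_le (i : ℕ) : ‖psiCoeff i‖ ≤ 2 ^ i / (i.factorial : ℝ) := by
  rw [psiCoeff, norm_div, norm_pow, Complex.norm_natCast]
  exact div_factorial_sq_le ((norm_harmonic_le i).trans (by exact_mod_cast Nat.le_mul_self i))

theorem norm_psiCoeff'_le (i : ℕ) : ‖psiCoeff' i‖ ≤ 2 ^ i / (i.factorial : ℝ) := by
  rw [psiCoeff', norm_div, norm_pow, Complex.norm_natCast, norm_mul, Complex.norm_natCast]
  exact div_factorial_sq_le (mul_le_mul_of_nonneg_left (norm_harmonic_le i) i.cast_nonneg)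

theorem natCast_factorial_succ (i : ℕ) :
    ((i + 1).factorial : ℂ) = (i + 1) * (i.factorial : ℂ) := by
  rw [Nat.factorial_succ]; push_cast; ring

theorem hasDerivAt_entireSum_deriv {c : ℕ → ℂ} (hc : ∀ i, ‖c i‖ ≤ 2 ^ i / (i.factorial : ℝ)) (q : ℂ) :
    HasDerivAt (entireSum c) (deriv (entireSum c) q) q :=
  ((hasDerivAt_entireSum hc q).differentiableAt).hasDerivAt

theorem mul_deriv_phi (q : ℂ) :
    q * deriv (entireSum phiCoeff) q = entireSum phiCoeff' q := by
  rw [(hasDerivAt_entireSum norm_phiCoeff_le q).deriv,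
    ← mul_entireSum_succ norm_phiCoeff'_le (by simp [phiCoeff'])]
  congr 2
  ext i
  simp only [phiCoeff, phiCoeff']
  push_cast
  ring

theorem mul_deriv_psi (q : ℂ) :
    q * deriv (entireSum psiCoeff) q = entireSum psiCoeff' q := by
  rw [(hasDerivAt_entireSum norm_psiCoeff_le q).deriv,
    ← mul_entireSum_succ norm_psiCoeff'_le (by simp [psiCoeff'])]
  congr 2
  ext i
  simp only [psiCoeff, psiCoeff']
  push_cast
  ring

/-- With φ the sum of `phiCoeff`, this is the Bessel-type equation (qφ')' = φ. -/
theorem hasDerivAt_phi' (q : ℂ) :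
    HasDerivAt (entireSum phiCoeff') (entireSum phiCoeff q) q := by
  refine (hasDerivAt_entireSum norm_phiCoeff'_le q).congr_deriv ?_
  congr 1
  ext i
  have h1 : ((i : ℂ) + 1) ≠ 0 := by exact_mod_cast i.succ_ne_zero
  have h2 : (i.factorial : ℂ) ≠ 0 := by exact_mod_cast i.factorial_ne_zero
  rw [phiCoeff', phiCoeff, natCast_factorial_succ]
  push_cast
  field_simp

/-- The companion equation (qψ')' = ψ + φ'; the inhomogeneous term comes from the increment 1/(i+1)
of the harmonic numbers. -/
theorem hasDerivAt_psi' (q : ℂ) :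
    HasDerivAt (entireSum psiCoeff')
      (entireSum psiCoeff q + deriv (entireSum phiCoeff) q) q := by
  have hd := (hasDerivAt_entireSum norm_phiCoeff_le q).deriv
  refine (hasDerivAt_entireSum norm_psiCoeff'_le q).congr_deriv ?_
  have hs : Summable fun i : ℕ => ((i + 1) * phiCoeff (i + 1)) • q ^ i := by
    refine (summable_entireSum (c := fun i => (i + 1) * phiCoeff (i + 1)) (fun i => ?_) q)
    have h1 : ((i : ℂ) + 1) * phiCoeff (i + 1) = phiCoeff' i.succ := by
      simp only [phiCoeff', phiCoeff]; push_cast; ring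
    have h2 : phiCoeff' i.succ = phiCoeff i / (i + 1) := by
      have h1 : ((i : ℂ) + 1) ≠ 0 := by exact_mod_cast i.succ_ne_zero
      have h2 : (i.factorial : ℂ) ≠ 0 := by exact_mod_cast i.factorial_ne_zero
      rw [phiCoeff', phiCoeff, Nat.succ_eq_add_one, natCast_factorial_succ]
      push_cast
      field_simp
    rw [h1, h2, norm_div]
    refine (div_le_self (norm_nonneg _) ?_).trans (norm_phiCoeff_le i)
    rw [← Nat.cast_succ, Complex.norm_natCast]
    exact_mod_cast i.succ_pos
  rw [hd, entireSum, entireSum, entireSum, ← (summable_entireSum norm_psiCoeff_le q).tsum_add hs]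
  refine tsum_congr fun i => ?_
  have h1 : ((i : ℂ) + 1) ≠ 0 := by exact_mod_cast i.succ_ne_zero
  have h2 : (i.factorial : ℂ) ≠ 0 := by exact_mod_cast i.factorial_ne_zero
  rw [psiCoeff', psiCoeff, phiCoeff, natCast_factorial_succ, harmonic_succ, ← add_smul]
  congr 1
  push_cast
  field_simp

/-- This is det L₀ = 1 in the variable q = z/l². The two differential equations make the expression
constant, and it is 1 at q = 0. -/
theorem wronskian_eq_one (q : ℂ) :
    entireSum phiCoeff q * (entireSum phiCoeff q - 2 * entireSum psiCoeff' q) +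
      2 * entireSum phiCoeff' q * entireSum psiCoeff q = 1 := by
  have hd : ∀ q : ℂ, HasDerivAt (fun q : ℂ =>
      entireSum phiCoeff q * (entireSum phiCoeff q - 2 * entireSum psiCoeff' q) +
      2 * entireSum phiCoeff' q * entireSum psiCoeff q) 0 q := by
    intro q
    have h1 := hasDerivAt_entireSum_deriv norm_phiCoeff_le q
    have h2 := hasDerivAt_entireSum_deriv norm_psiCoeff_le q
    refine ((h1.mul (h1.sub ((hasDerivAt_psi' q).const_mul 2))).add
      (((hasDerivAt_phi' q).const_mul 2).mul h2)).congr_deriv ?_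
    simp only [Pi.sub_apply]
    rw [← mul_deriv_phi, ← mul_deriv_psi]
    ring
  have := is_const_of_deriv_eq_zero (fun q => (hd q).differentiableAt) (fun q => (hd q).deriv) q 0
  rw [this]
  simp [phiCoeff, phiCoeff', psiCoeff, psiCoeff']

end Coefficients

/-! ### The solution L and its logarithmic derivative. -/

section Solution

theorem f0_eq (l z : ℂ) : f0 l z = entireSum phiCoeff (z / l ^ 2) := by
  rw [f0, entireSum]
  refine tsum_congr fun i => ?_
  rw [phiCoeff, smul_eq_mul, div_pow, ← pow_mul]
  ring

theorem f1_eq (l z : ℂ) : f1 l z = -(2 / l) * entireSum psiCoeff (z / l ^ 2) := by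
  rw [f1, entireSum]
  congr 1
  refine tsum_congr fun i => ?_
  rw [psiCoeff, smul_eq_mul, div_pow, ← pow_mul]
  ring

theorem eulerDeriv_f0 (l z : ℂ) : eulerDeriv (f0 l) z = entireSum phiCoeff' (z / l ^ 2) := by
  have h := (hasDerivAt_entireSum_deriv norm_phiCoeff_le (z / l ^ 2)).comp z
    ((hasDerivAt_id z).div_const (l ^ 2))
  have e : f0 l = entireSum phiCoeff ∘ fun z => id z / l ^ 2 := funext fun z => f0_eq l z
  rw [eulerDeriv, e, h.deriv, ← mul_deriv_phi]
  ring

theorem eulerDeriv_f1 (l z : ℂ) :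
    eulerDeriv (f1 l) z = -(2 / l) * entireSum psiCoeff' (z / l ^ 2) := by
  have h := ((hasDerivAt_entireSum_deriv norm_psiCoeff_le (z / l ^ 2)).comp z
    ((hasDerivAt_id z).div_const (l ^ 2))).const_mul (-(2 / l))
  have e : f1 l = fun z => -(2 / l) * (entireSum psiCoeff ∘ fun z => id z / l ^ 2) z :=
    funext fun z => f1_eq l z
  rw [eulerDeriv, e, h.deriv, ← mul_deriv_psi]
  ring

theorem L0_eq (z : ℂ) (l : Circle) : L0 z l =
    !![entireSum phiCoeff (z / l ^ 2), l * entireSum phiCoeff' (z / l ^ 2);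
      -(2 / l) * entireSum psiCoeff (z / l ^ 2),
      entireSum phiCoeff (z / l ^ 2) - 2 * entireSum psiCoeff' (z / l ^ 2)] := by
  have hl := l.coe_ne_zero
  rw [L0, f0_eq, f1_eq, eulerDeriv_f0, eulerDeriv_f1]
  congr 5
  field_simp
  ring

theorem det_L0 (z : ℂ) (l : Circle) : (L0 z l).det = 1 := by
  have hl := l.coe_ne_zero
  rw [L0_eq, Matrix.det_fin_two_of, ← wronskian_eq_one (z / (l : ℂ) ^ 2)]
  field_simp
  ring

/-- All series depend on z/l² alone, and the remaining factors l and 1/l of the off-diagonal entries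
scale as conjugation by d(ε) does. -/
theorem L0_homogeneous (e : Circle) (z : ℂ) (l : Circle) :
    L0 ((e : ℂ) ^ 2 * z) (e * l) = (dmat e)⁻¹ * L0 z l * dmat e := by
  have hl := l.coe_ne_zero
  have he := e.coe_ne_zero
  have hq : (e : ℂ) ^ 2 * z / ((e * l : Circle) : ℂ) ^ 2 = z / (l : ℂ) ^ 2 := by
    push_cast
    field_simp
  have hd : (dmat e)⁻¹ = !![1, 0; 0, (e : ℂ)⁻¹] := by
    refine Matrix.inv_eq_left_inv ?_
    rw [dmat]
    ext i j; fin_cases i <;> fin_cases j <;> simp [he]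
  rw [L0_eq, L0_eq, hq, hd, dmat]
  ext i j
  fin_cases i <;> fin_cases j <;> simp [Matrix.mul_apply, Fin.sum_univ_two] <;> field_simp

theorem det_translatedL {a : ℝ} (ha : 0 < a) (z : ℂ) (l : Circle) : (translatedL a z l).det = 1 := by
  have hs : ((√a : ℝ) : ℂ) ≠ 0 := by exact_mod_cast (Real.sqrt_pos.2 ha).ne'
  rw [translatedL, Lsol, Matrix.det_mul, Matrix.det_mul, det_L0, Matrix.det_nonsing_inv, gamma0]
  simp [Matrix.det_fin_two_of, hs]

/-- The logarithmic derivative of `L`. -/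
def connectionMatrix (z : ℂ) (l : Circle) : Mat2 := !![0, (l : ℂ)⁻¹; (l : ℂ)⁻¹ * z⁻¹, 0]

theorem hasDerivAt_Lsol {z : ℂ} (hz : z ∈ Complex.slitPlane) (l : Circle) (i j : Fin 2) :
    HasDerivAt (fun z => Lsol z l i j) ((Lsol z l * connectionMatrix z l) i j) z := by
  have hl := l.coe_ne_zero
  have hz0 := Complex.slitPlane_ne_zero hz
  set q := z / (l : ℂ) ^ 2 with hq
  have hqd : HasDerivAt (fun z : ℂ => z / (l : ℂ) ^ 2) (1 / (l : ℂ) ^ 2) z :=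
    (hasDerivAt_id z).div_const _
  have h1 := (hasDerivAt_entireSum_deriv norm_phiCoeff_le q).comp z hqd
  have h2 := (hasDerivAt_phi' q).comp z hqd
  have h3 := (hasDerivAt_entireSum_deriv norm_psiCoeff_le q).comp z hqd
  have h4 := (hasDerivAt_psi' q).comp z hqd
  have ht := (Complex.hasDerivAt_log hz).div_const (l : ℂ)
  have p1 := mul_deriv_phi q
  have p2 := mul_deriv_psi q
  have d1 : deriv (entireSum phiCoeff) q = entireSum phiCoeff' q * (l : ℂ) ^ 2 / z := by
    rw [← p1, hq]; field_simp
  have d2 : deriv (entireSum psiCoeff) q = entireSum psiCoeff' q * (l : ℂ) ^ 2 / z := by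
    rw [← p2, hq]; field_simp
  rw [d1] at h1 h4
  rw [d2] at h3
  have e : ∀ z, Lsol z l = !![1, 0; Complex.log z / l, 1] *
    !![entireSum phiCoeff (z / l ^ 2), l * entireSum phiCoeff' (z / l ^ 2);
      -(2 / l) * entireSum psiCoeff (z / l ^ 2),
      entireSum phiCoeff (z / l ^ 2) - 2 * entireSum psiCoeff' (z / l ^ 2)] :=
    fun z => by rw [Lsol, L0_eq]
  fin_cases i <;> fin_cases j
  · refine (h1.congr_of_eventuallyEq (.of_forall fun w => ?_)).congr_deriv ?_
    · simp [e]
    · simp [e, connectionMatrix, ← hq]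
      field_simp
  · refine ((h2.const_mul (l : ℂ)).congr_of_eventuallyEq (.of_forall fun w => ?_)).congr_deriv ?_
    · simp [e]
    · simp [e, connectionMatrix, ← hq]
      field_simp
  · refine (((ht.mul h1).add (h3.const_mul (-(2 / (l : ℂ))))).congr_of_eventuallyEq
      (.of_forall fun w => ?_)).congr_deriv ?_
    · simp [e]
    · simp [e, connectionMatrix, ← hq]
      field_simp
      ring
  · refine (((ht.mul (h2.const_mul (l : ℂ))).add (h1.sub (h4.const_mul 2))).congr_of_eventuallyEq
      (.of_forall fun w => ?_)).congr_deriv ?_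
    · simp [e]
    · simp [e, connectionMatrix, ← hq]
      rw [hq]
      field_simp
      ring

theorem hasDerivAt_translatedL (a : ℝ) {z : ℂ} (hz : z ∈ Complex.slitPlane) (l : Circle)
    (i j : Fin 2) : HasDerivAt (fun z => translatedL a z l i j)
      ((translatedL a z l * connectionMatrix z l) i j) z := by
  have h := ((hasDerivAt_Lsol hz l 0 j).const_mul ((gamma0 a l)⁻¹ i 0)).add
    ((hasDerivAt_Lsol hz l 1 j).const_mul ((gamma0 a l)⁻¹ i 1))
  refine (h.congr_of_eventuallyEq (.of_forall fun w => ?_)).congr_deriv ?_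
  · simp [translatedL, Matrix.mul_apply, Fin.sum_univ_two]
  · simp only [translatedL, Matrix.mul_assoc]
    rw [Matrix.mul_apply (M := (gamma0 a l)⁻¹), Fin.sum_univ_two]

/-! ### The Hermitian form, its homogeneity, and the consequences for B and k. -/

/-- The Hermitian form `-Mᴴ D M`, `M = γ₀⁻¹ L`. -/
def hermitianForm (a : ℝ) (z : ℂ) (l : Circle) : Mat2 :=
  (L0 z l)ᴴ * !![((-(a + 2 * Real.log ‖z‖) : ℝ) : ℂ), -(l : ℂ); -(l : ℂ)⁻¹, 0] * L0 z l

/-- The logarithm enters only as log z plus its conjugate, that is 2 log|z|, so the form is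
single-valued around the origin although L is not. -/
theorem hermitianForm_eq {a : ℝ} (ha : 0 < a) (z : ℂ) (l : Circle) :
    -((translatedL a z l)ᴴ * Dmat * translatedL a z l) = hermitianForm a z l := by
  have hl := l.coe_ne_zero
  have hs : ((√a : ℝ) : ℂ) ≠ 0 := by exact_mod_cast (Real.sqrt_pos.2 ha).ne'
  have hs2 : ((√a : ℝ) : ℂ) * ((√a : ℝ) : ℂ) = a := by
    exact_mod_cast Real.mul_self_sqrt ha.le
  have hinv : (gamma0 a l)⁻¹ = !![((√a : ℝ) : ℂ), (l : ℂ) / ((√a : ℝ) : ℂ);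
      0, 1 / ((√a : ℝ) : ℂ)] := by
    refine Matrix.inv_eq_left_inv ?_
    rw [gamma0]
    ext i j; fin_cases i <;> fin_cases j <;> simp [hs]
    field_simp
    ring
  have hconj : (starRingEnd ℂ) (l : ℂ) = (l : ℂ)⁻¹ := (Circle.coe_inv_eq_conj l).symm
  have key : -(((gamma0 a l)⁻¹ * !![1, 0; Complex.log z / l, 1])ᴴ * Dmat *
      ((gamma0 a l)⁻¹ * !![1, 0; Complex.log z / l, 1])) =
      !![((-(a + 2 * Real.log ‖z‖) : ℝ) : ℂ), -(l : ℂ); -(l : ℂ)⁻¹, 0] := by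
    have hre : Complex.log z + (starRingEnd ℂ) (Complex.log z) = 2 * Real.log ‖z‖ := by
      rw [Complex.add_conj, Complex.log_re]; push_cast; ring
    rw [hinv, Dmat]
    ext i j
    fin_cases i <;> fin_cases j <;>
      simp [Matrix.mul_apply, Fin.sum_univ_two, hconj]
    · field_simp
      linear_combination (-((√a : ℝ) : ℂ) ^ 2) * hre + (-((√a : ℝ) : ℂ) ^ 2) * hs2
    · field_simp
      ring
    · field_simp
      ring
    · field_simp
      ring
  rw [hermitianForm, ← key, translatedL, Lsol]
  simp only [Matrix.conjTranspose_mul, Matrix.mul_assoc, Matrix.neg_mul, Matrix.mul_neg]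

theorem inv_dmat (e : Circle) : (dmat e)⁻¹ = !![1, 0; 0, (e : ℂ)⁻¹] := by
  refine Matrix.inv_eq_left_inv ?_
  rw [dmat]
  ext i j; fin_cases i <;> fin_cases j <;> simp

theorem dmat_mul_inv (e : Circle) : dmat e * (dmat e)⁻¹ = 1 := by
  rw [inv_dmat, dmat]
  ext i j; fin_cases i <;> fin_cases j <;> simp

theorem conjTranspose_dmat (e : Circle) : (dmat e)ᴴ = (dmat e)⁻¹ := by
  rw [inv_dmat, dmat]
  ext i j; fin_cases i <;> fin_cases j <;> simp [← Circle.coe_inv_eq_conj]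

theorem hermitianForm_homogeneous (a : ℝ) (e : Circle) (z : ℂ) (l : Circle) :
    hermitianForm a ((e : ℂ) ^ 2 * z) (e * l) = (dmat e)⁻¹ * hermitianForm a z l * dmat e := by
  have he := e.coe_ne_zero
  have hn : ‖(e : ℂ) ^ 2 * z‖ = ‖z‖ := by simp [Circle.norm_coe]
  have hmid : ∀ s : ℂ, !![s, -((e * l : Circle) : ℂ); -((e * l : Circle) : ℂ)⁻¹, 0] =
      (dmat e)⁻¹ * !![s, -(l : ℂ); -(l : ℂ)⁻¹, 0] * dmat e := by
    intro s
    rw [inv_dmat, dmat]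
    ext i j; fin_cases i <;> fin_cases j <;> simp [mul_comm]
  have hc : ((dmat e)⁻¹)ᴴ = dmat e := by rw [← conjTranspose_dmat, Matrix.conjTranspose_conjTranspose]
  have h1 : ∀ X : Mat2, dmat e * ((dmat e)⁻¹ * X) = X := fun X => by
    rw [← Matrix.mul_assoc, dmat_mul_inv, Matrix.one_mul]
  rw [hermitianForm, hn, hmid, L0_homogeneous, hermitianForm]
  simp only [Matrix.conjTranspose_mul, conjTranspose_dmat, hc, Matrix.mul_assoc, h1]

theorem conjTranspose_mul_of_mem_SU11 {g : Loop} (hg : g ∈ twistedLoopSU11) (l : Circle) :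
    (g l)ᴴ * Dmat * g l = Dmat := by
  have hdet : ((g l)ᴴ).det = 1 := by rw [Matrix.det_conjTranspose, hg.1.2.1]; simp
  have h1 : Dmat * g l * Dmat = ((g l)ᴴ)⁻¹ := by
    conv_lhs => rw [← hg.2 l, realInvolution]
    calc Dmat * (Dmat * ((g l)ᴴ)⁻¹ * Dmat) * Dmat
        = (Dmat * Dmat) * ((g l)ᴴ)⁻¹ * (Dmat * Dmat) := by simp only [Matrix.mul_assoc]
      _ = _ := by rw [Dmat_mul_self]; simp
  have h2 : (g l)ᴴ * (Dmat * g l * Dmat) = 1 := by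
    rw [h1]; exact Matrix.mul_nonsing_inv _ (by rw [hdet]; exact isUnit_one)
  calc (g l)ᴴ * Dmat * g l = (g l)ᴴ * (Dmat * g l * Dmat) * Dmat := by
        simp only [Matrix.mul_assoc, Dmat_mul_self, Matrix.mul_one]
    _ = Dmat := by rw [h2, Matrix.one_mul]

theorem wLoop_conjTranspose_mul (l : Circle) : (wLoop l)ᴴ * Dmat * wLoop l = -Dmat := by
  have hconj : (starRingEnd ℂ) (l : ℂ) = (l : ℂ)⁻¹ := (Circle.coe_inv_eq_conj l).symm
  rw [wLoop, Dmat]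
  ext i j; fin_cases i <;> fin_cases j <;> simp [Matrix.mul_apply, Fin.sum_univ_two, hconj]

variable {a : ℝ} {U : Set ℂ} {F B : ℂ → Loop} {k : ℂ → ℝ}

/-- The factor F disappears because it preserves D, and w only contributes a sign: this reduces
every question about B to the explicit form. -/
theorem IsIwasawaFactorization.conjTranspose_mul_right
    (h : IsIwasawaFactorization (translatedL a) U F B k) (ha : 0 < a) {z : ℂ} (hz : z ∈ U)
    (l : Circle) : (B z l)ᴴ * Dmat * B z l = hermitianForm a z l := by
  rw [← hermitianForm_eq ha, h.eq_mul z hz l]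
  calc (B z l)ᴴ * Dmat * B z l = -((B z l)ᴴ * (-Dmat) * B z l) := by simp
    _ = -((B z l)ᴴ * ((wLoop l)ᴴ * ((F z l)ᴴ * Dmat * F z l) * wLoop l) * B z l) := by
        rw [conjTranspose_mul_of_mem_SU11 (h.mem_SU11 z hz), wLoop_conjTranspose_mul]
    _ = _ := by simp only [Matrix.conjTranspose_mul, Matrix.mul_assoc]

/-- Spectral factorizations of the Hermitian form are homogeneous. -/
theorem eq_of_hermitianForm_factorization {B B' : Loop} {k k' : ℝ} {z : ℂ} (e : Circle)
    (hk : 0 < k) (hk' : 0 < k') (hB : ∀ l, (B l).det = 1) (hB' : ∀ l, (B' l).det = 1)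
    (hd : B.ExtendsToDisk !![(k : ℂ), 0; 0, (k : ℂ)⁻¹])
    (hd' : B'.ExtendsToDisk !![(k' : ℂ), 0; 0, (k' : ℂ)⁻¹])
    (h : ∀ l, (B l)ᴴ * Dmat * B l = hermitianForm a z l)
    (h' : ∀ l, (B' l)ᴴ * Dmat * B' l = hermitianForm a ((e : ℂ) ^ 2 * z) l) :
    k' = k ∧ ∀ l, B' (e * l) = (dmat e)⁻¹ * B l * dmat e := by
  have hDd : Dmat * (dmat e)⁻¹ = (dmat e)⁻¹ * Dmat := by
    rw [inv_dmat, Dmat]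
    ext i j; fin_cases i <;> fin_cases j <;> simp
  have hc : ((dmat e)⁻¹)ᴴ = dmat e := by rw [← conjTranspose_dmat, Matrix.conjTranspose_conjTranspose]
  have h1 : ∀ X : Mat2, dmat e * ((dmat e)⁻¹ * X) = X := fun X => by
    rw [← Matrix.mul_assoc, dmat_mul_inv, Matrix.one_mul]
  have hDd' : ∀ X : Mat2, Dmat * ((dmat e)⁻¹ * X) = (dmat e)⁻¹ * (Dmat * X) := fun X => by
    rw [← Matrix.mul_assoc, hDd, Matrix.mul_assoc]
  have hdd : ((dmat e)⁻¹).det * (dmat e).det = 1 := by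
    rw [mul_comm, ← Matrix.det_mul, dmat_mul_inv, Matrix.det_one]
  rw [Loop.extendsToDisk_iff] at hd hd'
  obtain ⟨h2, h3⟩ := eq_of_conjTranspose_mul_eq (B := fun l => B' (e * l))
    (B' := fun l => (dmat e)⁻¹ * B l * dmat e) hk' hk (fun l => hB' _)
    (fun l => by rw [Matrix.det_mul, Matrix.det_mul, hB, mul_one, hdd])
    (Loop.extendsToDisk_iff.2 fun i j => (hd' i j).comp_mul e)
    (Loop.extendsToDisk_iff.2 fun i j => by
      rw [inv_dmat, dmat]
      -- Conjugation by d(ε) multiplies the (0,1) entry by ε and the (1,0) entry by ε⁻¹, so the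
      -- diagonal value at the origin is unchanged.
      refine ((hd i j).const_mul ((!![1, e; (e : ℂ)⁻¹, 1] : Mat2) i j)).congr (fun l => ?_) ?_
      · fin_cases i <;> fin_cases j <;> simp [Matrix.mul_apply, Matrix.vecMul, dotProduct, Fin.sum_univ_two, mul_comm]
      · fin_cases i <;> fin_cases j <;> simp)
    (fun l => by
      rw [h', hermitianForm_homogeneous, ← h]
      simp only [Matrix.conjTranspose_mul, conjTranspose_dmat, hc, Matrix.mul_assoc, hDd', h1])
  exact ⟨h2, fun l => congrFun h3 l⟩

theorem exists_circle_sq_mul {z z' : ℂ} (h : ‖z‖ = ‖z'‖) :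
    ∃ e : Circle, (e : ℂ) ^ 2 * z = z' := by
  refine ⟨Circle.exp ((Complex.arg z' - Complex.arg z) / 2), ?_⟩
  rw [Circle.coe_exp, ← Complex.exp_nat_mul]
  have h1 := Complex.norm_mul_exp_arg_mul_I z
  have h2 := Complex.norm_mul_exp_arg_mul_I z'
  calc _ = Complex.exp ((2 : ℕ) * (((Complex.arg z' - Complex.arg z) / 2 : ℝ) * Complex.I)) *
        (‖z‖ * Complex.exp (Complex.arg z * Complex.I)) := by rw [h1]
    _ = ‖z‖ * Complex.exp (Complex.arg z' * Complex.I) := by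
        rw [mul_left_comm, ← Complex.exp_add]
        congr 2
        push_cast
        ring
    _ = z' := by rw [h, h2]

theorem IsIwasawaFactorization.eq_of_sq_mul
    (h : IsIwasawaFactorization (translatedL a) U F B k) (ha : 0 < a) {z : ℂ} (hz : z ∈ U)
    (e : Circle) (he : (e : ℂ) ^ 2 * z ∈ U) :
    k ((e : ℂ) ^ 2 * z) = k z ∧
      ∀ l, B ((e : ℂ) ^ 2 * z) (e * l) = (dmat e)⁻¹ * B z l * dmat e :=
  eq_of_hermitianForm_factorization e (h.pos z hz) (h.pos _ he) (h.mem_SL2 z hz).2.1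
    (h.mem_SL2 _ he).2.1 (h.extends_to_disk z hz) (h.extends_to_disk _ he)
    (fun l => h.conjTranspose_mul_right ha hz l) (fun l => h.conjTranspose_mul_right ha he l)

theorem IsIwasawaFactorization.isHomogeneousOn
    (h : IsIwasawaFactorization (translatedL a) U F B k) (ha : 0 < a) : IsHomogeneousOn B U :=
  fun e _ hz he l => (h.eq_of_sq_mul ha hz e he).2 l

theorem IsIwasawaFactorization.isRadialOn
    (h : IsIwasawaFactorization (translatedL a) U F B k) (ha : 0 < a) :
    IsRadialOn k U := by
  intro z hz z' hz' hzz
  obtain ⟨e, rfl⟩ := exists_circle_sq_mul hzz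
  exact (h.eq_of_sq_mul ha hz e hz').1.symm

end Solution


/-! ### The Laplacian along lines and on radial functions. -/

section Laplacian

theorem hasDerivAt_deriv_of_contDiffAt {g : ℝ → ℝ} {x : ℝ} (hg : ContDiffAt ℝ 2 g x) :
    HasDerivAt (deriv g) (deriv (deriv g) x) x := by
  have h : DifferentiableAt ℝ (fderiv ℝ g) x :=
    (hg.fderiv_right (m := 1) (by norm_num)).differentiableAt (by simp)
  have e : deriv g = fun t => fderiv ℝ g t 1 := funext fun t => fderiv_apply_one_eq_deriv.symm
  rw [e]
  exact (h.clm_apply (differentiableAt_const 1)).hasDerivAt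

theorem hasDerivAt_line (z e : ℂ) (t : ℝ) : HasDerivAt (fun t : ℝ => z + t * e) e t := by
  simpa using ((hasDerivAt_id t).ofReal_comp.mul_const e).const_add z

theorem laplacian_eq_deriv_lines {u : ℂ → ℝ} {z : ℂ} (hu : ContDiffAt ℝ 2 u z) :
    Laplacian.laplacian u z = deriv (deriv fun t : ℝ => u (z + t * 1)) 0 +
      deriv (deriv fun t : ℝ => u (z + t * Complex.I)) 0 := by
  have key : ∀ e : ℂ, deriv (deriv fun t : ℝ => u (z + t * e)) 0 =
      iteratedFDeriv ℝ 2 u z ![e, e] := by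
    intro e
    have hc : Tendsto (fun t : ℝ => z + t * e) (𝓝 0) (𝓝 z) := by
      have := (hasDerivAt_line z e 0).continuousAt.tendsto
      simpa using this
    have hd : ∀ᶠ w in 𝓝 z, DifferentiableAt ℝ u w :=
      (hu.eventually (by simp)).mono fun w hw => hw.differentiableAt (by simp)
    have h1 : deriv (fun t : ℝ => u (z + t * e)) =ᶠ[𝓝 0] fun t => fderiv ℝ u (z + t * e) e :=
      (hc.eventually hd).mono fun t ht =>
        (ht.hasFDerivAt.comp_hasDerivAt t (hasDerivAt_line z e t)).deriv
    have h2 : DifferentiableAt ℝ (fderiv ℝ u) z :=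
      (hu.fderiv_right (m := 1) (by norm_num)).differentiableAt (by simp)
    have h3 : HasDerivAt (fun t : ℝ => fderiv ℝ u (z + t * e)) (fderiv ℝ (fderiv ℝ u) z e) 0 := by
      have h4 : HasFDerivAt (fderiv ℝ u) (fderiv ℝ (fderiv ℝ u) z) (z + (0 : ℝ) * e) := by
        simpa using h2.hasFDerivAt
      exact h4.comp_hasDerivAt 0 (hasDerivAt_line z e 0)
    rw [h1.deriv_eq, (h3.clm_apply (hasDerivAt_const 0 e)).deriv, iteratedFDeriv_two_apply]
    simp
  rw [key, key, InnerProductSpace.laplacian_eq_iteratedFDeriv_complexPlane]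

/-- Second derivative of a radial function along a line. -/
theorem deriv_deriv_radial_line {g : ℝ → ℝ} {z e : ℂ} (hz : z ≠ 0) (he : ‖e‖ = 1)
    (hg : ContDiffAt ℝ 2 g ‖z‖) :
    deriv (deriv fun t : ℝ => g ‖z + t * e‖) 0 =
      deriv (deriv g) ‖z‖ * ((z * star e).re / ‖z‖) ^ 2 +
        deriv g ‖z‖ * ((1 - ((z * star e).re / ‖z‖) ^ 2) / ‖z‖) := by
  set p := (z * star e).re with hp
  set n : ℝ → ℝ := fun t => ‖z + t * e‖ with hn
  have hr : 0 < ‖z‖ := norm_pos_iff.2 hz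
  have hn0 : n 0 = ‖z‖ := by simp [hn]
  have he2 : e.re ^ 2 + e.im ^ 2 = 1 := by
    have := Complex.sq_norm e
    rw [he, Complex.normSq_apply] at this
    linarith
  have hsq : ∀ t, n t = √(‖z‖ ^ 2 + 2 * p * t + t ^ 2) := by
    intro t
    simp only [hn]
    rw [← Real.sqrt_sq (norm_nonneg (z + t * e))]
    congr 1
    rw [Complex.sq_norm, Complex.sq_norm, Complex.normSq_apply, Complex.normSq_apply, hp]
    simp
    linear_combination t ^ 2 * he2
  have hcn : Continuous n := by fun_prop
  have hpos : ∀ᶠ t in 𝓝 0, n t ≠ 0 :=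
    hcn.continuousAt.eventually_ne (by rw [hn0]; exact hr.ne')
  have hnd : ∀ t, n t ≠ 0 → HasDerivAt n ((p + t) / n t) t := by
    intro t ht
    have h1 : HasDerivAt (fun t : ℝ => ‖z‖ ^ 2 + 2 * p * t + t ^ 2) (2 * p + 2 * t) t := by
      have := (((hasDerivAt_id t).const_mul (2 * p)).const_add (‖z‖ ^ 2)).add (hasDerivAt_pow 2 t)
      exact this.congr_deriv (by simp)
    have h2 := h1.sqrt (fun h => ht (by rw [hsq, h, Real.sqrt_zero]))
    rw [← hsq] at h2
    refine (h2.congr_of_eventuallyEq (.of_forall hsq)).congr_deriv ?_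
    field_simp
  have hgd : ∀ᶠ r in 𝓝 ‖z‖, DifferentiableAt ℝ g r :=
    (hg.eventually (by simp)).mono fun w hw => hw.differentiableAt (by simp)
  have hcn0 : Tendsto n (𝓝 0) (𝓝 ‖z‖) := by rw [← hn0]; exact hcn.continuousAt
  have h1 : deriv (fun t : ℝ => g (n t)) =ᶠ[𝓝 0] fun t => deriv g (n t) * ((p + t) / n t) := by
    filter_upwards [hpos, hcn0.eventually hgd] with t ht ht'
    exact (ht'.hasDerivAt.comp t (hnd t ht)).deriv
  have hg2 : HasDerivAt (deriv g) (deriv (deriv g) ‖z‖) (n 0) := by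
    rw [hn0]
    exact hasDerivAt_deriv_of_contDiffAt hg
  have hn00 : n 0 ≠ 0 := by rw [hn0]; exact hr.ne'
  have h2 := (hg2.comp 0 (hnd 0 hn00)).mul
    ((((hasDerivAt_id (0 : ℝ)).const_add p)).div (hnd 0 hn00) hn00)
  rw [h1.deriv_eq]
  refine h2.deriv.trans ?_
  simp [hn0]
  field_simp

/-- In the directions 1 and i the quotients p/‖z‖ of `deriv_deriv_radial_line` are the cosine and
sine of arg z, whose squares add up to 1. -/
theorem laplacian_radial {u : ℂ → ℝ} {g : ℝ → ℝ} {z : ℂ} (hz : z ≠ 0)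
    (hu : u =ᶠ[𝓝 z] fun w => g ‖w‖) (hg : ContDiffAt ℝ 2 g ‖z‖) :
    Laplacian.laplacian u z = deriv (deriv g) ‖z‖ + deriv g ‖z‖ / ‖z‖ := by
  have hr : 0 < ‖z‖ := norm_pos_iff.2 hz
  have hn : ContDiffAt ℝ 2 (fun w : ℂ => ‖w‖) z := contDiffAt_norm ℝ hz
  rw [(InnerProductSpace.laplacian_congr_nhds hu).eq_of_nhds,
    laplacian_eq_deriv_lines (u := fun w => g ‖w‖) (hg.comp z hn),
    deriv_deriv_radial_line hz (by simp) hg, deriv_deriv_radial_line hz (by simp) hg]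
  have h2 : ‖z‖ ^ 2 = z.re ^ 2 + z.im ^ 2 := by
    rw [Complex.sq_norm, Complex.normSq_apply]; ring
  simp
  field_simp
  linear_combination (-deriv (deriv g) ‖z‖ * ‖z‖ + deriv g ‖z‖) * h2

end Laplacian

/-! ### From the radial Gauss-Codazzi equation to Painlevé III. -/

section Reduction

/-- The radial Gauss-Codazzi equation becomes the third Painlevé equation. -/
theorem painleve_of_radial {g : ℝ → ℝ} {x : ℝ} (hx : 0 < x) (hg : ContDiffAt ℝ 2 g (x ^ 2 / 16))
    (h : deriv (deriv g) (x ^ 2 / 16) + deriv g (x ^ 2 / 16) / (x ^ 2 / 16) =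
      Real.exp (2 * g (x ^ 2 / 16)) - 16 / (x ^ 2 / 16) ^ 2 * Real.exp (-2 * g (x ^ 2 / 16)))
    {y : ℝ → ℝ} (hy : y =ᶠ[𝓝 x] fun x => Real.exp (g (x ^ 2 / 16)) * (x / 8)) :
    ContDiffAt ℝ 2 y x ∧ y x ≠ 0 ∧
    deriv (deriv y) x = 1 / y x * (deriv y x) ^ 2 - 1 / x * deriv y x
      + 1 / x * (0 * y x ^ 2 + 0) + 1 * y x ^ 3 + (-1) / y x := by
  have hsq : ∀ x : ℝ, HasDerivAt (fun x : ℝ => x ^ 2 / 16) (x / 8) x := fun x =>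
    ((hasDerivAt_pow 2 x).div_const 16).congr_deriv (by simp; ring)
  have hcs : ContDiffAt ℝ 2 (fun x : ℝ => x ^ 2 / 16) x := by fun_prop
  have hgd : ∀ᶠ t in 𝓝 x, DifferentiableAt ℝ g (t ^ 2 / 16) :=
    (hsq x).continuousAt.eventually
      ((hg.eventually (by simp)).mono fun w hw => hw.differentiableAt (by simp))
  have hY : ∀ t, DifferentiableAt ℝ g (t ^ 2 / 16) →
      HasDerivAt (fun x => Real.exp (g (x ^ 2 / 16)) * (x / 8))
        (Real.exp (g (t ^ 2 / 16)) * (deriv g (t ^ 2 / 16) * (t ^ 2 / 64) + 1 / 8)) t := by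
    intro t ht
    refine (((ht.hasDerivAt.comp t (hsq t)).exp).mul ((hasDerivAt_id t).div_const 8)).congr_deriv ?_
    simp
    ring
  have h1 : deriv y =ᶠ[𝓝 x] fun t =>
      Real.exp (g (t ^ 2 / 16)) * (deriv g (t ^ 2 / 16) * (t ^ 2 / 64) + 1 / 8) :=
    hy.deriv.trans (hgd.mono fun t ht => (hY t ht).deriv)
  have hg1 : DifferentiableAt ℝ g (x ^ 2 / 16) := hg.differentiableAt (by simp)
  have hg2 : HasDerivAt (deriv g) (deriv (deriv g) (x ^ 2 / 16)) (x ^ 2 / 16) :=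
    hasDerivAt_deriv_of_contDiffAt hg
  have h2 := ((hg1.hasDerivAt.comp x (hsq x)).exp).mul
    (((hg2.comp x (hsq x)).mul ((hasDerivAt_pow 2 x).div_const 64)).add_const (1 / 8 : ℝ))
  have h3 := h1.deriv_eq.trans h2.deriv
  have hyx := hy.eq_of_nhds
  have hy1 := h1.eq_of_nhds
  have hE := Real.exp_pos (g (x ^ 2 / 16))
  refine ⟨((hg.comp x hcs).exp.mul (by fun_prop)).congr_of_eventuallyEq hy, ?_, ?_⟩
  · rw [hyx]; positivity
  · rw [h3, hy1, hyx]
    have e2 : Real.exp (2 * g (x ^ 2 / 16)) = Real.exp (g (x ^ 2 / 16)) ^ 2 := by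
      rw [← Real.exp_nat_mul]; simp
    have e3 : Real.exp (-2 * g (x ^ 2 / 16)) = (Real.exp (g (x ^ 2 / 16)) ^ 2)⁻¹ := by
      rw [← e2, ← Real.exp_neg]; congr 1; ring
    rw [e2, e3] at h
    have h' : deriv (deriv g) (x ^ 2 / 16) = Real.exp (g (x ^ 2 / 16)) ^ 2 -
      16 / (x ^ 2 / 16) ^ 2 * (Real.exp (g (x ^ 2 / 16)) ^ 2)⁻¹ -
      deriv g (x ^ 2 / 16) / (x ^ 2 / 16) := by linarith
    simp only [Function.comp_apply, Pi.mul_apply]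
    rw [h']
    field_simp
    ring

theorem norm_hopf (z : ℂ) : ‖hopf (1 / 2) z‖ = 4 / ‖z‖ := by
  rw [hopf]
  simp
  ring

/-- For H = 1/2 one has |Q| = 4/|z|, so |Q|^(-1/2) = |z|^(1/2)/2 = x/8. -/
theorem exp_shiftedExponent (u : ℂ → ℝ) {z : ℂ} (hz : z ≠ 0) :
    Real.exp (shiftedExponent (1 / 2) u z) = Real.exp (u z) * (xvar z / 8) := by
  have hr : 0 < ‖z‖ := norm_pos_iff.2 hz
  have hs : 0 < √‖z‖ := Real.sqrt_pos.2 hr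
  have h1 : 1 / 2 * Real.log (4 / ‖z‖) = -Real.log (√‖z‖ / 2) := by
    rw [Real.log_div (by norm_num) hr.ne', Real.log_div hs.ne' (by norm_num),
      Real.log_sqrt hr.le, show (4 : ℝ) = 2 ^ 2 by norm_num, Real.log_pow]
    push_cast
    ring
  rw [shiftedExponent, norm_hopf, h1, sub_neg_eq_add, Real.exp_add, Real.exp_log (by positivity),
    xvar]
  ring

theorem exists_painleve {U : Set ℂ} {u : ℂ → ℝ} (hU : IsOpen U) (h0 : (0 : ℂ) ∉ U)
    (hG : GaussCodazzi (1 / 2) (hopf (1 / 2)) u U) (hrad : IsRadialOn u U) :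
    ∃ y : ℝ → ℝ, (∀ z ∈ U, y (xvar z) = Real.exp (shiftedExponent (1 / 2) u z)) ∧
      IsPainleveIII 0 0 1 (-1) y (xvar '' U) := by
  classical
  have hnorm : ∀ {z w : ℂ}, xvar z = xvar w → ‖z‖ = ‖w‖ := by
    intro z w h
    have : √‖z‖ = √‖w‖ := by rw [xvar, xvar] at h; linarith
    exact (Real.sqrt_inj (norm_nonneg _) (norm_nonneg _)).1 this
  -- A preimage of x is chosen; radiality of u makes the choice immaterial. Off the image the value
  -- 0 is a mere default.
  set y : ℝ → ℝ := fun x =>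
    if h : ∃ z ∈ U, xvar z = x then Real.exp (shiftedExponent (1 / 2) u h.choose) else 0 with hy
  have hyU : ∀ z ∈ U, y (xvar z) = Real.exp (shiftedExponent (1 / 2) u z) := by
    intro z hz
    have h : ∃ w ∈ U, xvar w = xvar z := ⟨z, hz, rfl⟩
    simp only [hy, dif_pos h]
    rw [shiftedExponent, shiftedExponent, norm_hopf, norm_hopf, hnorm h.choose_spec.2,
      hrad _ h.choose_spec.1 _ hz (hnorm h.choose_spec.2)]
  have local_form : ∀ z ∈ U, 0 < xvar z ∧ ∃ c : ℝ → ℂ, (∀ᶠ x in 𝓝 (xvar z), c x ∈ U ∧ xvar (c x) = x) ∧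
      ContDiffAt ℝ 2 y (xvar z) ∧ y (xvar z) ≠ 0 ∧ deriv (deriv y) (xvar z) =
      1 / y (xvar z) * (deriv y (xvar z)) ^ 2 - 1 / (xvar z) * deriv y (xvar z)
      + 1 / (xvar z) * (0 * y (xvar z) ^ 2 + 0) + 1 * y (xvar z) ^ 3 + (-1) / y (xvar z) := by
    intro z hz
    have hz0 : z ≠ 0 := fun h => h0 (h ▸ hz)
    have hr : 0 < ‖z‖ := norm_pos_iff.2 hz0
    have hrC : (‖z‖ : ℂ) ≠ 0 := by exact_mod_cast hr.ne'
    set e : ℂ := z / ‖z‖ with he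
    have he1 : ‖e‖ = 1 := by rw [he, norm_div, Complex.norm_real, norm_norm, div_self hr.ne']
    have hre : (‖z‖ : ℂ) * e = z := by rw [he]; field_simp
    have hxz : 0 < xvar z := by rw [xvar]; positivity
    have hxsq : xvar z ^ 2 / 16 = ‖z‖ := by
      rw [xvar, mul_pow, Real.sq_sqrt hr.le]; ring
    -- The profile of u on the ray through z. The map x ↦ (x²/16)e is a local section of `xvar`,
    -- which also shows that the image of U is open.
    set g : ℝ → ℝ := fun r => u (r * e) with hgdef
    have huz : ContDiffAt ℝ 2 u z := hG.1.contDiffAt (hU.mem_nhds hz)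
    have hg : ContDiffAt ℝ 2 g ‖z‖ := by
      have h1 : ContDiffAt ℝ 2 (fun r : ℝ => (r : ℂ) * e) ‖z‖ :=
        (Complex.ofRealCLM.contDiff.contDiffAt).mul contDiffAt_const
      exact ContDiffAt.comp (g := u) ‖z‖ (by rw [hre]; exact huz) h1
    have hmem : ∀ᶠ r in 𝓝 ‖z‖, ((r : ℝ) : ℂ) * e ∈ U := by
      have : ContinuousAt (fun r : ℝ => (r : ℂ) * e) ‖z‖ := by fun_prop
      exact this.eventually_mem (hU.mem_nhds (by rwa [hre]))
    have hug : u =ᶠ[𝓝 z] fun w => g ‖w‖ := by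
      filter_upwards [hU.mem_nhds hz, continuous_norm.continuousAt.eventually hmem] with w hw hw'
      exact hrad w hw _ hw' (by rw [norm_mul, he1, Complex.norm_real, norm_norm, mul_one])
    have hsqc : Tendsto (fun x : ℝ => x ^ 2 / 16) (𝓝 (xvar z)) (𝓝 ‖z‖) := by
      have : ContinuousAt (fun x : ℝ => x ^ 2 / 16) (xvar z) := by fun_prop
      rw [ContinuousAt, hxsq] at this
      exact this
    have hxc : ∀ x : ℝ, 0 < x → xvar (((x ^ 2 / 16 : ℝ) : ℂ) * e) = x := by
      intro x hx
      rw [xvar, norm_mul, he1, Complex.norm_real, Real.norm_of_nonneg (by positivity), mul_one,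
        Real.sqrt_div' _ (by norm_num), Real.sqrt_sq hx.le, show (16 : ℝ) = 4 ^ 2 by norm_num,
        Real.sqrt_sq (by norm_num)]
      ring
    have hyg : y =ᶠ[𝓝 (xvar z)] fun x => Real.exp (g (x ^ 2 / 16)) * (x / 8) := by
      filter_upwards [hsqc.eventually hmem, lt_mem_nhds hxz] with x hx hx0
      have := hyU _ hx
      rw [hxc x hx0, exp_shiftedExponent u (fun h => h0 (h ▸ hx)), hxc x hx0] at this
      exact this
    have hode : deriv (deriv g) ‖z‖ + deriv g ‖z‖ / ‖z‖ =
        Real.exp (2 * g ‖z‖) - 16 / ‖z‖ ^ 2 * Real.exp (-2 * g ‖z‖) := by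
      have h1 := hG.2.2 z hz
      rw [laplacian_radial hz0 hug hg, norm_hopf, hug.eq_of_nhds] at h1
      rw [div_pow] at h1
      linear_combination 4 * h1
    rw [← hxsq] at hode hg
    refine ⟨hxz, fun x => ((x ^ 2 / 16 : ℝ) : ℂ) * e, ?_, painleve_of_radial hxz hg hode hyg⟩
    filter_upwards [hsqc.eventually hmem, lt_mem_nhds hxz] with x hx hx0
    exact ⟨hx, hxc x hx0⟩
  refine ⟨y, hyU, ?_, ?_, ?_⟩
  · rw [isOpen_iff_mem_nhds]
    rintro _ ⟨z, hz, rfl⟩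
    obtain ⟨-, c, hc, -⟩ := local_form z hz
    exact hc.mono fun x hx => ⟨c x, hx.1, hx.2⟩
  · rintro _ ⟨z, hz, rfl⟩
    obtain ⟨-, c, -, h, -⟩ := local_form z hz
    exact h.contDiffWithinAt
  · rintro _ ⟨z, hz, rfl⟩
    obtain ⟨hx, c, -, -, h⟩ := local_form z hz
    exact ⟨hx.ne', h⟩

end Reduction


/-! ### Diagonalization of a Hermitian loop by a Birkhoff factorization. -/

section Birkhoff

theorem Loop.ExtendsToDisk.mul {g h : Loop} {c d : Mat2} (hg : g.ExtendsToDisk c)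
    (hh : h.ExtendsToDisk d) : Loop.ExtendsToDisk (fun l => g l * h l) (c * d) := by
  rw [Loop.extendsToDisk_iff] at hg hh ⊢
  intro i j
  exact (((hg i 0).mul (hh 0 j)).add ((hg i 1).mul (hh 1 j))).congr
    (fun l => by simp only [Matrix.mul_apply, Fin.sum_univ_two])
    (by simp only [Matrix.mul_apply, Fin.sum_univ_two])

theorem Loop.ExtendsToDisk.adjugate {g : Loop} {c : Mat2} (hg : g.ExtendsToDisk c) :
    Loop.ExtendsToDisk (fun l => (g l).adjugate) c.adjugate := by
  rw [Loop.extendsToDisk_iff] at hg ⊢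
  intro i j
  fin_cases i <;> fin_cases j
  · exact (hg 1 1).congr (fun l => by simp [Matrix.adjugate_fin_two]) (by simp [Matrix.adjugate_fin_two])
  · exact (hg 0 1).neg.congr (fun l => by simp [Matrix.adjugate_fin_two]) (by simp [Matrix.adjugate_fin_two])
  · exact (hg 1 0).neg.congr (fun l => by simp [Matrix.adjugate_fin_two]) (by simp [Matrix.adjugate_fin_two])
  · exact (hg 0 0).congr (fun l => by simp [Matrix.adjugate_fin_two]) (by simp [Matrix.adjugate_fin_two])

theorem Loop.extendsToDisk_const (c : Mat2) : Loop.ExtendsToDisk (fun _ => c) c :=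
  Loop.extendsToDisk_iff.2 fun _ _ => .const _

theorem Loop.ExtendsToDisk.det {g : Loop} {c : Mat2} (hg : g.ExtendsToDisk c) :
    IsDiskBoundary (fun l => (g l).det) c.det := by
  rw [Loop.extendsToDisk_iff] at hg
  exact (((hg 0 0).mul (hg 1 1)).sub ((hg 0 1).mul (hg 1 0))).congr
    (fun l => (Matrix.det_fin_two _).symm) (Matrix.det_fin_two _).symm

theorem Loop.ExtendsToDisk.comp_neg {g : Loop} {c : Mat2} (hg : g.ExtendsToDisk c) :
    Loop.ExtendsToDisk (fun l => g (-l)) c := by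
  rw [Loop.extendsToDisk_iff] at hg ⊢
  exact fun i j => ((hg i j).comp_mul (-1)).congr (fun l => by simp) rfl

/-- Liouville's theorem for loops of matrices. -/
theorem Loop.ExtendsToDisk.eq_const {g : Loop} {c d : Mat2} (hg : g.ExtendsToDisk c)
    (hd : Loop.ExtendsToDisk (fun l => (g l)ᴴ) d) : d = cᴴ ∧ ∀ l, g l = c := by
  rw [Loop.extendsToDisk_iff] at hg hd
  have h := fun i j => (hg i j).eq_const_of_eq_conj (hd j i) (fun l => by simp)
  exact ⟨by ext i j; rw [Matrix.conjTranspose_apply, (h j i).1, star_star],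
    fun l => by ext i j; exact (h i j).2 l⟩

theorem det_Dmat : Dmat.det = -1 := by simp [Dmat]

theorem eq_of_adjugate_mul_eq_one {A B : Mat2} (hA : A.det = 1) (h : A.adjugate * B = 1) : B = A := by
  calc B = A * A.adjugate * B := by rw [Matrix.mul_adjugate, hA, one_smul, Matrix.one_mul]
    _ = A := by rw [Matrix.mul_assoc, h, Matrix.mul_one]

/-- A Birkhoff factorization `P = Z Y⁻¹` of a loop with `D Pᴴ D = P` diagonalizes `D P`. -/
theorem diagonalize_of_birkhoff {P Y : Loop} {Z₀ : Mat2} (hP : ∀ l, (P l).det = 1)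
    (hPD : ∀ l, (P l)ᴴ * Dmat = Dmat * P l) (hPt : ∀ l, Dmat * P (-l) * Dmat = P l)
    (hY : Y.ExtendsToDisk 1) (hZ : Loop.ExtendsToDisk (fun l => (P l * Y l)ᴴ) Z₀ᴴ) :
    (∀ l, (Y l).det = 1) ∧ ∃ c : ℝ, Z₀ 0 0 = c ∧ c ≠ 0 ∧
      ∀ l, (Y l)ᴴ * (Dmat * P l) * Y l = !![(c : ℂ), 0; 0, -(c : ℂ)⁻¹] := by
  have hDD : ∀ X : Mat2, Dmat * (Dmat * X) = X := fun X => by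
    rw [← Matrix.mul_assoc, Dmat_mul_self, Matrix.one_mul]
  -- Since det P = 1, det Y equals det(PY): one extends inside the disk, the conjugate of the other
  -- does too.
  have hYdet : ∀ l, (Y l).det = 1 := by
    have h1 := (hY.det.eq_const_of_eq_conj hZ.det fun l => by
      rw [Matrix.det_conjTranspose, Matrix.det_mul, hP, one_mul, star_star]).2
    simpa using h1
  have hZdet : ∀ l, (P l * Y l).det = 1 := fun l => by rw [Matrix.det_mul, hP, hYdet, one_mul]
  -- With Z = PY, the loop Y⁻¹ D Y(-l) D equals Z⁻¹ D Z(-l) D, so it extends to both sides and is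
  -- constant.
  have hYt : ∀ l, Dmat * Y (-l) * Dmat = Y l := by
    have h1 : Loop.ExtendsToDisk (fun l => (Y l).adjugate * (Dmat * Y (-l) * Dmat)) 1 := by
      have := hY.adjugate.mul (((Loop.extendsToDisk_const Dmat).mul hY.comp_neg).mul
        (Loop.extendsToDisk_const Dmat))
      simpa [Dmat_mul_self] using this
    have h2 : Loop.ExtendsToDisk (fun l => ((Y l).adjugate * (Dmat * Y (-l) * Dmat))ᴴ)
        (Dmat * Z₀ᴴ * Dmat * (Z₀ᴴ).adjugate) := by
      have := (((Loop.extendsToDisk_const Dmat).mul hZ.comp_neg).mul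
        (Loop.extendsToDisk_const Dmat)).mul hZ.adjugate
      convert this using 1
      funext l
      rw [← Matrix.adjugate_conjTranspose]
      conv_lhs => rw [Matrix.conjTranspose_mul]
      have e1 : (Y l).adjugate = (P l * Y l).adjugate * P l := by
        rw [Matrix.adjugate_mul_distrib, Matrix.mul_assoc, Matrix.adjugate_mul, hP, one_smul,
          Matrix.mul_one]
      have e2 : P l * (Dmat * Y (-l) * Dmat) = Dmat * (P (-l) * Y (-l)) * Dmat := by
        rw [← hPt l]
        simp only [Matrix.mul_assoc, hDD]
      rw [← Matrix.conjTranspose_mul, e1, Matrix.mul_assoc, e2]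
      simp only [Matrix.conjTranspose_mul, conjTranspose_Dmat, Matrix.mul_assoc]
    intro l
    exact eq_of_adjugate_mul_eq_one (hYdet l) ((h1.eq_const h2).2 l)
  -- K = D Zᴴ D Y = D Yᴴ D Z. The first expression extends inside the disk, and so does the adjoint
  -- of the second; hence K is constant, equal to Z₀.
  set K : Loop := fun l => Dmat * ((P l * Y l)ᴴ * Dmat * Y l) with hK
  have hK' : ∀ l, K l = Dmat * ((Y l)ᴴ * Dmat * (P l * Y l)) := fun l => by
    simp only [hK, Matrix.conjTranspose_mul]
    rw [Matrix.mul_assoc _ (P l)ᴴ, hPD]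
    simp only [Matrix.mul_assoc]
  have hK1 : K.ExtendsToDisk (Dmat * (Z₀ᴴ * Dmat)) := by
    have := (Loop.extendsToDisk_const Dmat).mul
      ((hZ.mul (Loop.extendsToDisk_const Dmat)).mul hY)
    rwa [Matrix.mul_one] at this
  have hK2 : Loop.ExtendsToDisk (fun l => (K l)ᴴ) Z₀ᴴ := by
    have := ((hZ.mul (Loop.extendsToDisk_const Dmat)).mul hY).mul (Loop.extendsToDisk_const Dmat)
    convert this using 1
    · funext l
      rw [hK']
      simp only [Matrix.conjTranspose_mul, conjTranspose_Dmat, Matrix.mul_assoc,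
        Matrix.conjTranspose_conjTranspose]
    · rw [Matrix.mul_one, Matrix.mul_assoc, Dmat_mul_self, Matrix.mul_one]
  obtain ⟨h3, h4⟩ := hK1.eq_const hK2
  have h5 : Z₀ = Dmat * (Z₀ᴴ * Dmat) := by
    simpa using congrArg Matrix.conjTranspose h3
  rw [← h5] at h4
  -- The twisting of P and Y passes to the constant K, which kills the off-diagonal entries of Z₀.
  have h6 : Dmat * Z₀ * Dmat = Z₀ := by
    rw [← h4 1]
    conv_lhs => rw [h4 1, ← h4 (-1)]
    rw [hK', hK', ← hYt 1, ← hPt 1]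
    simp only [Matrix.conjTranspose_mul, conjTranspose_Dmat, Matrix.mul_assoc, hDD, Dmat_mul_self,
      Matrix.mul_one]
  have h7 : Z₀.det = 1 := by
    rw [← h4 1, hK', Matrix.det_mul, Matrix.det_mul, Matrix.det_mul, hZdet,
      Matrix.det_conjTranspose, hYdet, det_Dmat]
    simp
  have e01 : Z₀ 0 1 = 0 := by
    have := congrFun (congrFun h6 0) 1
    simp [Dmat, Matrix.mul_apply, Matrix.vecMul, dotProduct, Fin.sum_univ_two] at this
    linear_combination (-1 / 2 : ℂ) * this
  have e10 : Z₀ 1 0 = 0 := by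
    have := congrFun (congrFun h6 1) 0
    simp [Dmat, Matrix.mul_apply, Matrix.vecMul, dotProduct, Fin.sum_univ_two] at this
    linear_combination (-1 / 2 : ℂ) * this
  have e00 : (starRingEnd ℂ) (Z₀ 0 0) = Z₀ 0 0 := by
    have := congrFun (congrFun h5 0) 0
    simp [Dmat, Matrix.mul_apply, Fin.sum_univ_two] at this
    exact this.symm
  obtain ⟨c, hc⟩ := Complex.conj_eq_iff_real.1 e00
  have e11 : (c : ℂ) * Z₀ 1 1 = 1 := by
    rw [Matrix.det_fin_two, e01, e10, hc] at h7
    simpa using h7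
  have hc0 : (c : ℂ) ≠ 0 := left_ne_zero_of_mul_eq_one e11
  refine ⟨hYdet, c, hc, by exact_mod_cast hc0, fun l => ?_⟩
  have h8 : (Y l)ᴴ * (Dmat * P l) * Y l = Dmat * Z₀ := by
    rw [← h4 l, hK', hDD]
    simp only [Matrix.mul_assoc]
  have e11' : Z₀ 1 1 = (c : ℂ)⁻¹ := by
    rw [eq_comm, inv_eq_iff_eq_inv]
    exact eq_inv_of_mul_eq_one_left e11
  rw [h8, Matrix.eta_fin_two Z₀, e01, e10, hc, e11', Dmat]
  ext i j
  fin_cases i <;> fin_cases j <;> simp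

end Birkhoff

/-! ### Absolutely convergent Laurent series as ℓ¹ sequences, and multiplication operators on them.
-/

section SequenceSpace

/-- The Banach space `ℓ¹(ℤ, ℂ²)`. -/
abbrev SeqSpace : Type := ↥(lp (fun _ : ℤ => Fin 2 → ℂ) 1)

theorem SeqSpace.summable_norm (x : SeqSpace) : Summable fun n => ‖x n‖ := by
  simpa using (lp.memℓp x).summable (by simp)

theorem SeqSpace.norm_eq (x : SeqSpace) : ‖x‖ = ∑' n, ‖x n‖ := by
  simpa using lp.norm_eq_tsum_rpow (p := 1) (by simp) x

theorem memℓp_seq (σ : ℤ ≃ ℤ) (A : ℤ → (Fin 2 → ℂ) →L[ℂ] (Fin 2 → ℂ)) {C : ℝ}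
    (hA : ∀ n, ‖A n‖ ≤ C) (x : SeqSpace) : Memℓp (fun n => A n (x (σ n))) 1 := by
  refine memℓp_gen ?_
  simpa using Summable.of_nonneg_of_le (fun _ => norm_nonneg _)
    (fun n => (A n).le_of_opNorm_le (hA n) _) ((σ.summable_iff.2 x.summable_norm).mul_left C)

theorem norm_seq_le (σ : ℤ ≃ ℤ) (A : ℤ → (Fin 2 → ℂ) →L[ℂ] (Fin 2 → ℂ)) {C : ℝ}
    (hA : ∀ n, ‖A n‖ ≤ C) (x : SeqSpace) :
    ‖(⟨fun n => A n (x (σ n)), memℓp_seq σ A hA x⟩ : SeqSpace)‖ ≤ C * ‖x‖ := by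
  have hs : Summable fun n => C * ‖x (σ n)‖ := (σ.summable_iff.2 x.summable_norm).mul_left C
  have hb : ∀ n, ‖A n (x (σ n))‖ ≤ C * ‖x (σ n)‖ := fun n => (A n).le_of_opNorm_le (hA n) _
  rw [SeqSpace.norm_eq, SeqSpace.norm_eq]
  calc ∑' n, ‖A n (x (σ n))‖ ≤ ∑' n, C * ‖x (σ n)‖ :=
        (Summable.of_nonneg_of_le (fun _ => norm_nonneg _) hb hs).tsum_le_tsum hb hs
    _ = C * ∑' n, ‖x n‖ := by rw [tsum_mul_left, σ.tsum_eq fun n => ‖x n‖]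

/-- The operator `(T x)ₙ = Aₙ x_{σ n}`. -/
def seqOp (σ : ℤ ≃ ℤ) (A : ℤ → (Fin 2 → ℂ) →L[ℂ] (Fin 2 → ℂ)) (C : ℝ) (hA : ∀ n, ‖A n‖ ≤ C) :
    SeqSpace →L[ℂ] SeqSpace :=
  LinearMap.mkContinuous
    { toFun := fun x => ⟨fun n => A n (x (σ n)), memℓp_seq σ A hA x⟩
      map_add' := fun x y => lp.ext (funext fun n => (A n).map_add (x (σ n)) (y (σ n)))
      map_smul' := fun c x => lp.ext (funext fun n => (A n).map_smul c (x (σ n))) }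
    C (norm_seq_le σ A hA)

@[simp]
theorem seqOp_apply (σ : ℤ ≃ ℤ) (A : ℤ → (Fin 2 → ℂ) →L[ℂ] (Fin 2 → ℂ)) (C : ℝ)
    (hA : ∀ n, ‖A n‖ ≤ C) (x : SeqSpace) (n : ℤ) : seqOp σ A C hA x n = A n (x (σ n)) := rfl

theorem norm_seqOp_le (σ : ℤ ≃ ℤ) (A : ℤ → (Fin 2 → ℂ) →L[ℂ] (Fin 2 → ℂ)) {C : ℝ} (hC : 0 ≤ C)
    (hA : ∀ n, ‖A n‖ ≤ C) : ‖seqOp σ A C hA‖ ≤ C :=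
  LinearMap.mkContinuous_norm_le _ hC (norm_seq_le σ A hA)

/-- Evaluation of a Laurent series with absolutely summable coefficients. -/
def evalCLM (l : Circle) : SeqSpace →L[ℂ] (Fin 2 → ℂ) :=
  (lp.tsumCLM ℂ ℤ (Fin 2 → ℂ)).comp (seqOp (Equiv.refl ℤ) (fun n => ((l : ℂ) ^ n) • .id ℂ _) 1
    (fun n => by simp [norm_smul, Circle.norm_coe]))

theorem evalCLM_apply (l : Circle) (x : SeqSpace) : evalCLM l x = ∑' n, ((l : ℂ) ^ n) • x n := rfl

theorem summable_eval (l : Circle) (x : SeqSpace) : Summable fun n : ℤ => ((l : ℂ) ^ n) • x n :=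
  .of_norm (x.summable_norm.congr fun n => by simp [norm_smul, Circle.norm_coe])

/-- The shift `(S x)ₙ = xₙ₋ⱼ`, multiplication by `lʲ`. -/
def shiftOp (j : ℤ) : SeqSpace →L[ℂ] SeqSpace :=
  seqOp (Equiv.subRight j) (fun _ => .id ℂ _) 1 fun _ => by simp

/-- Multiplication by a constant matrix. -/
def matOp (M : Mat2) : SeqSpace →L[ℂ] SeqSpace :=
  seqOp (Equiv.refl ℤ) (fun _ => M.mulVecLin.toContinuousLinearMap) _ fun _ => le_rfl

/-- Projection onto the coefficients of positive index. -/
def posProj : SeqSpace →L[ℂ] SeqSpace :=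
  seqOp (Equiv.refl ℤ) (fun n => if 0 < n then .id ℂ _ else 0) 1 fun n => by split_ifs <;> simp

theorem norm_posProj_le : ‖posProj‖ ≤ 1 := norm_seqOp_le _ _ zero_le_one _

/-- The operator `T` is multiplication by the scalar function `t`. -/
def HasScalarSymbol (T : SeqSpace →L[ℂ] SeqSpace) (t : Circle → ℂ) : Prop :=
  ∀ l x, evalCLM l (T x) = t l • evalCLM l x

/-- The operator `T` is multiplication by the matrix function `M`. -/
def HasSymbol (T : SeqSpace →L[ℂ] SeqSpace) (M : Loop) : Prop :=
  ∀ l x, evalCLM l (T x) = M l *ᵥ evalCLM l x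

theorem hasScalarSymbol_shiftOp (j : ℤ) : HasScalarSymbol (shiftOp j) fun l => (l : ℂ) ^ j := by
  intro l x
  rw [evalCLM_apply, evalCLM_apply, ← tsum_const_smul'',
    ← (Equiv.subRight j).tsum_eq fun n => (l : ℂ) ^ j • (l : ℂ) ^ n • x n]
  refine tsum_congr fun n => ?_
  rw [smul_smul, ← zpow_add₀ l.coe_ne_zero]
  simp [shiftOp]

theorem hasScalarSymbol_one : HasScalarSymbol 1 fun _ => 1 := fun l x => by simp

theorem HasScalarSymbol.mul {T T' : SeqSpace →L[ℂ] SeqSpace} {t t' : Circle → ℂ}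
    (h : HasScalarSymbol T t) (h' : HasScalarSymbol T' t') :
    HasScalarSymbol (T * T') fun l => t l * t' l := fun l x => by
  rw [mul_apply_eq_comp, h, h', smul_smul]

theorem HasScalarSymbol.sub {T T' : SeqSpace →L[ℂ] SeqSpace} {t t' : Circle → ℂ}
    (h : HasScalarSymbol T t) (h' : HasScalarSymbol T' t') :
    HasScalarSymbol (T - T') fun l => t l - t' l := fun l x => by
  rw [sub_apply, map_sub, h, h', sub_smul]

theorem HasScalarSymbol.smul {T : SeqSpace →L[ℂ] SeqSpace} {t : Circle → ℂ} (c : ℂ)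
    (h : HasScalarSymbol T t) : HasScalarSymbol (c • T) fun l => c * t l := fun l x => by
  rw [smul_apply, map_smul, h, smul_smul]

theorem HasScalarSymbol.pow {T : SeqSpace →L[ℂ] SeqSpace} {t : Circle → ℂ}
    (h : HasScalarSymbol T t) (n : ℕ) : HasScalarSymbol (T ^ n) fun l => t l ^ n := by
  induction n with
  | zero => simpa using hasScalarSymbol_one
  | succ n ih => simpa only [pow_succ] using ih.mul h

/-- Evaluation at l is continuous and linear, so it passes through the operator-norm convergent
series. -/
theorem HasScalarSymbol.entireSum {T : SeqSpace →L[ℂ] SeqSpace} {t : Circle → ℂ}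
    (h : HasScalarSymbol T t) {c : ℕ → ℂ} (hc : ∀ i, ‖c i‖ ≤ 2 ^ i / (i.factorial : ℝ)) :
    HasScalarSymbol (entireSum c T) fun l => TTStar.entireSum c (t l) := by
  intro l x
  have h1 := (summable_entireSum hc T).hasSum.mapL
    ((evalCLM l).comp (ContinuousLinearMap.apply ℂ SeqSpace x))
  have h2 := (summable_entireSum hc (t l)).hasSum.smul_const (evalCLM l x)
  refine h1.unique (h2.congr_fun fun i => ?_)
  have := (h.pow i).smul (c i) l x
  simpa using this

theorem HasSymbol.mul {T T' : SeqSpace →L[ℂ] SeqSpace} {M M' : Loop}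
    (h : HasSymbol T M) (h' : HasSymbol T' M') :
    HasSymbol (T * T') fun l => M l * M' l := fun l x => by
  rw [mul_apply_eq_comp, h, h', Matrix.mulVec_mulVec]

theorem HasSymbol.sub {T T' : SeqSpace →L[ℂ] SeqSpace} {M M' : Loop}
    (h : HasSymbol T M) (h' : HasSymbol T' M') :
    HasSymbol (T - T') fun l => M l - M' l := fun l x => by
  rw [sub_apply, map_sub, h, h', Matrix.sub_mulVec]

theorem hasSymbol_matOp (M : Mat2) : HasSymbol (matOp M) fun _ => M := by
  intro l x
  have := (summable_eval l x).hasSum.mapL M.mulVecLin.toContinuousLinearMap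
  rw [evalCLM_apply, evalCLM_apply]
  refine Eq.trans ?_ this.tsum_eq
  refine tsum_congr fun n => ?_
  simp [matOp]

/-- The operator on `ℂ²`-valued sequences with given scalar entries. -/
def blockOp (a b c d : SeqSpace →L[ℂ] SeqSpace) : SeqSpace →L[ℂ] SeqSpace :=
  matOp !![1, 0; 0, 0] * a + matOp !![0, 1; 0, 0] * b + matOp !![0, 0; 1, 0] * c +
    matOp !![0, 0; 0, 1] * d

theorem hasSymbol_blockOp {a b c d : SeqSpace →L[ℂ] SeqSpace} {a' b' c' d' : Circle → ℂ}
    (ha : HasScalarSymbol a a') (hb : HasScalarSymbol b b') (hc : HasScalarSymbol c c')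
    (hd : HasScalarSymbol d d') :
    HasSymbol (blockOp a b c d) fun l => !![a' l, b' l; c' l, d' l] := by
  intro l x
  simp only [blockOp, add_apply, mul_apply_eq_comp, map_add]
  rw [hasSymbol_matOp, hasSymbol_matOp, hasSymbol_matOp, hasSymbol_matOp, ha, hb, hc, hd]
  ext i
  fin_cases i <;> simp [Matrix.mulVec, dotProduct, Fin.sum_univ_two]

theorem blockOp_one : blockOp 1 0 0 1 = 1 := by
  ext x n i
  fin_cases i <;> simp [blockOp, matOp, dotProduct, Fin.sum_univ_two]

theorem isDiskBoundary_tsum {a : ℕ → ℂ} (ha : Summable fun n => ‖a n‖) :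
    IsDiskBoundary (fun l => ∑' n, (l : ℂ) ^ n * a n) (a 0) := by
  have hb : ∀ (n : ℕ) (z : ℂ), z ∈ Metric.closedBall (0 : ℂ) 1 → ‖z ^ n * a n‖ ≤ ‖a n‖ := by
    intro n z hz
    rw [norm_mul, norm_pow]
    exact mul_le_of_le_one_left (norm_nonneg _)
      (pow_le_one₀ (norm_nonneg _) (by simpa using hz))
  refine ⟨fun z => ∑' n, z ^ n * a n, ⟨?_, ?_⟩, fun l => rfl, ?_⟩
  · exact Complex.differentiableOn_tsum_of_summable_norm ha (fun n => by fun_prop)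
      Metric.isOpen_ball fun n z hz => hb n z (Metric.ball_subset_closedBall hz)
  · rw [closure_ball _ one_ne_zero]
    exact continuousOn_tsum (fun n => by fun_prop) ha hb
  · refine (tsum_eq_single 0 fun n hn => by simp [hn]).trans ?_
    simp

theorem isDiskBoundary_eval {x : SeqSpace} (hx : ∀ n < 0, x n = 0) (i : Fin 2) :
    IsDiskBoundary (fun l => evalCLM l x i) (x 0 i) := by
  have hs : Summable fun n : ℕ => ‖x n i‖ :=
    Summable.of_nonneg_of_le (fun _ => norm_nonneg _) (fun n => norm_le_pi_norm (x n) i)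
      (x.summable_norm.comp_injective Nat.cast_injective)
  refine (isDiskBoundary_tsum hs).congr (fun l => ?_) (by simp)
  have h1 := (summable_eval l x).hasSum.mapL (ContinuousLinearMap.proj (R := ℂ) i)
  rw [evalCLM_apply]
  refine Eq.trans ?_ h1.tsum_eq
  rw [← Function.Injective.tsum_eq (g := ((↑) : ℕ → ℤ)) Nat.cast_injective]
  · exact tsum_congr fun n => by simp
  · intro n hn
    by_contra h
    refine hn ?_
    have : n < 0 := by
      by_contra h'
      exact h ⟨n.toNat, by simp; omega⟩
    simp [hx n this]

/-- A series in nonpositive powers of l becomes, under conjugation on the circle, a series in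
nonnegative powers. -/
theorem isDiskBoundary_star_eval {x : SeqSpace} (hx : ∀ n, 0 < n → x n = 0) (i : Fin 2) :
    IsDiskBoundary (fun l => star (evalCLM l x i)) (star (x 0 i)) := by
  have hs : Summable fun n : ℕ => ‖star (x (-n) i)‖ := by
    simp only [norm_star]
    exact Summable.of_nonneg_of_le (fun _ => norm_nonneg _) (fun n => norm_le_pi_norm (x (-n)) i)
      (x.summable_norm.comp_injective (neg_injective.comp Nat.cast_injective))
  refine (isDiskBoundary_tsum hs).congr (fun l => ?_) (by simp)
  have h1 := ((summable_eval l x).hasSum.mapL (ContinuousLinearMap.proj (R := ℂ) i)).star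
  rw [evalCLM_apply]
  refine Eq.trans ?_ h1.tsum_eq
  rw [← Function.Injective.tsum_eq (g := fun n : ℕ => -(n : ℤ))
    (neg_injective.comp Nat.cast_injective)]
  · exact tsum_congr fun n => by simp [← Circle.coe_inv_eq_conj]
  · intro n hn
    by_contra h
    refine hn ?_
    have : 0 < n := by
      by_contra h'
      exact h ⟨(-n).toNat, by simp; omega⟩
    simp [hx n this]

end SequenceSpace


/-! ### The Birkhoff factorization of 1 + E for small E. -/

section LinearProblem

/-- The solution `Y = v + O(l)` of the linear problem `π₊ ((1 + E) Y) = 0`. -/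
def birkhoffColumn (E : SeqSpace →L[ℂ] SeqSpace) (v : Fin 2 → ℂ) : SeqSpace :=
  Ring.inverse (1 + posProj * E) (lp.single 1 0 v)

variable {E : SeqSpace →L[ℂ] SeqSpace}

theorem isUnit_one_add_posProj_mul (hE : ‖E‖ < 1) : IsUnit (1 + posProj * E) := by
  have h : ‖-(posProj * E)‖ < 1 := by
    rw [norm_neg]
    calc ‖posProj * E‖ ≤ ‖posProj‖ * ‖E‖ := norm_mul_le _ _
      _ ≤ 1 * ‖E‖ := by gcongr; exact norm_posProj_le
      _ < 1 := by rwa [one_mul]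
  simpa using isUnit_one_sub_of_norm_lt_one h

theorem contDiffAt_birkhoffColumn (hE : ‖E‖ < 1) (v : Fin 2 → ℂ) {n : WithTop ℕ∞} :
    ContDiffAt ℝ n (fun E => birkhoffColumn E v) E := by
  obtain ⟨u, hu⟩ := isUnit_one_add_posProj_mul hE
  have h1 : ContDiffAt ℝ n (fun E : SeqSpace →L[ℂ] SeqSpace => 1 + posProj * E) E :=
    contDiffAt_const.add (contDiffAt_const.mul contDiffAt_id)
  have h2 : ContDiffAt ℝ n Ring.inverse ((fun E : SeqSpace →L[ℂ] SeqSpace => 1 + posProj * E) E) := by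
    simp only [← hu]
    exact contDiffAt_ringInverse ℝ u
  have h3 : ContDiffAt ℝ n (fun E : SeqSpace →L[ℂ] SeqSpace => Ring.inverse (1 + posProj * E)) E :=
    ContDiffAt.comp (g := Ring.inverse) E h2 h1
  have h4 : ContDiff ℝ n fun T : SeqSpace →L[ℂ] SeqSpace => T (lp.single 1 0 v) :=
    (ContinuousLinearMap.apply ℂ SeqSpace
      (lp.single 1 0 v : SeqSpace)).contDiff.restrict_scalars ℝ
  exact ContDiffAt.comp (g := fun T : SeqSpace →L[ℂ] SeqSpace => T (lp.single 1 0 v)) E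
    h4.contDiffAt h3

/-- Indices n ≤ 0 give the normalization Y = v + O(l); indices n > 0 say that (1 + E)Y has no
positive coefficients. -/
theorem birkhoffColumn_apply (hE : ‖E‖ < 1) (v : Fin 2 → ℂ) (n : ℤ) :
    birkhoffColumn E v n =
      (lp.single 1 0 v : SeqSpace) n - if 0 < n then E (birkhoffColumn E v) n else 0 := by
  have h1 : (1 + posProj * E) (birkhoffColumn E v) = lp.single 1 0 v := by
    rw [birkhoffColumn, ← mul_apply_eq_comp,
      Ring.mul_inverse_cancel _ (isUnit_one_add_posProj_mul hE)]
    rfl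
  have h2 := congrArg (fun x : SeqSpace => x n) h1
  simp only [add_apply, mul_apply_eq_comp, lp.coeFn_add, Pi.add_apply] at h2
  rw [← h2, posProj, seqOp_apply]
  split_ifs <;> simp

/-- The loop with columns the solutions of the linear problem. -/
def birkhoffLoop (E : SeqSpace →L[ℂ] SeqSpace) : Loop :=
  fun l => Matrix.of fun i j => evalCLM l (birkhoffColumn E (Pi.single j 1)) i

theorem birkhoffLoop_extendsToDisk (hE : ‖E‖ < 1) : (birkhoffLoop E).ExtendsToDisk 1 := by
  rw [Loop.extendsToDisk_iff]
  intro i j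
  refine (isDiskBoundary_eval (x := birkhoffColumn E (Pi.single j 1)) (fun n hn => ?_) i).congr
    (fun l => rfl) ?_
  · rw [birkhoffColumn_apply hE, if_neg hn.not_gt]
    simp [Pi.single_eq_of_ne hn.ne]
  · rw [birkhoffColumn_apply hE]
    simp [Matrix.one_apply, Pi.single_apply]

/-- The columns of Y have only nonnegative powers of l and those of PY only nonpositive ones, which
is the input of `diagonalize_of_birkhoff`. The number c is the (0,0) entry of the constant
coefficient of PY. -/
theorem birkhoffLoop_spec {P : Loop} (hE : ‖E‖ < 1) (hS : HasSymbol E fun l => P l - 1)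
    (hP : ∀ l, (P l).det = 1) (hPD : ∀ l, (P l)ᴴ * Dmat = Dmat * P l)
    (hPt : ∀ l, Dmat * P (-l) * Dmat = P l) :
    (∀ l, (birkhoffLoop E l).det = 1) ∧
    ∃ c : ℝ, 1 + E (birkhoffColumn E (Pi.single 0 1)) 0 0 = c ∧ c ≠ 0 ∧
      ∀ l, (birkhoffLoop E l)ᴴ * (Dmat * P l) * birkhoffLoop E l =
        !![(c : ℂ), 0; 0, -(c : ℂ)⁻¹] := by
  set Z : Fin 2 → SeqSpace := fun j =>
    birkhoffColumn E (Pi.single j 1) + E (birkhoffColumn E (Pi.single j 1)) with hZ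
  have hPY : ∀ l i j, (P l * birkhoffLoop E l) i j = evalCLM l (Z j) i := by
    intro l i j
    rw [hZ, map_add, hS, Matrix.sub_mulVec, Matrix.one_mulVec, add_sub_cancel]
    rfl
  have hZn : ∀ j n, 0 < n → Z j n = 0 := by
    intro j n hn
    simp only [hZ, lp.coeFn_add, Pi.add_apply]
    rw [birkhoffColumn_apply hE, if_pos hn]
    simp [Pi.single_eq_of_ne hn.ne']
  have h := diagonalize_of_birkhoff (Z₀ := Matrix.of fun i j => Z j 0 i) hP hPD hPt
    (birkhoffLoop_extendsToDisk hE) (by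
      rw [Loop.extendsToDisk_iff]
      intro i j
      refine (isDiskBoundary_star_eval (hZn i) j).congr (fun l => ?_) rfl
      rw [Matrix.conjTranspose_apply, hPY])
  refine ⟨h.1, ?_⟩
  obtain ⟨c, hc, h⟩ := h.2
  refine ⟨c, ?_, h⟩
  rw [← hc]
  simp only [Matrix.of_apply, hZ, lp.coeFn_add, Pi.add_apply]
  rw [birkhoffColumn_apply hE (Pi.single 0 1) 0]
  simp

end LinearProblem

/-! ### The Hermitian form as an operator, conjugated to a perturbation of the identity. -/

section Operators

variable (z : ℂ) (s : ℝ)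

/-- The operator with symbol `L₀`. -/
def L0Op : SeqSpace →L[ℂ] SeqSpace :=
  blockOp (entireSum phiCoeff (z • shiftOp (-2)))
    (shiftOp 1 * entireSum phiCoeff' (z • shiftOp (-2)))
    ((-2 : ℂ) • shiftOp (-1) * entireSum psiCoeff (z • shiftOp (-2)))
    (entireSum phiCoeff (z • shiftOp (-2)) - (2 : ℂ) • entireSum psiCoeff' (z • shiftOp (-2)))

/-- The operator with symbol `L₀ᴴ`. -/
def L0StarOp : SeqSpace →L[ℂ] SeqSpace :=
  blockOp (entireSum phiCoeff (star z • shiftOp 2))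
    ((-2 : ℂ) • shiftOp 1 * entireSum psiCoeff (star z • shiftOp 2))
    (shiftOp (-1) * entireSum phiCoeff' (star z • shiftOp 2))
    (entireSum phiCoeff (star z • shiftOp 2) - (2 : ℂ) • entireSum psiCoeff' (star z • shiftOp 2))

/-- The operator with symbol `(s², -l; -1/l, 0)`. -/
def middleOp : SeqSpace →L[ℂ] SeqSpace :=
  blockOp (((s : ℂ) ^ 2) • 1) ((-1 : ℂ) • shiftOp 1) ((-1 : ℂ) • shiftOp (-1)) ((0 : ℂ) • 1)

/-- The operator with symbol `(s, -l/s; 0, 1/s)⁻¹`. -/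
def triOp : SeqSpace →L[ℂ] SeqSpace :=
  blockOp ((s : ℂ)⁻¹ • 1) ((s : ℂ)⁻¹ • shiftOp 1) ((0 : ℂ) • 1) ((s : ℂ) • 1)

/-- The operator with symbol the conjugate transpose of the symbol of `triOp`. -/
def triStarOp : SeqSpace →L[ℂ] SeqSpace :=
  blockOp ((s : ℂ)⁻¹ • 1) ((0 : ℂ) • 1) ((s : ℂ)⁻¹ • shiftOp (-1)) ((s : ℂ) • 1)

/-- The deviation from the identity of the conjugated Hermitian form. -/
def errorOp : SeqSpace →L[ℂ] SeqSpace :=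
  matOp Dmat * triStarOp s * (L0StarOp z * middleOp s * L0Op z - middleOp s) * triOp s

/-- The triangular loop `(s, -l/s; 0, 1/s)`. -/
def triLoop : Loop := fun l => !![(s : ℂ), -(l : ℂ) * (s : ℂ)⁻¹; 0, (s : ℂ)⁻¹]

/-- The inverse of `triLoop`. -/
def triLoopInv : Loop := fun l => !![(s : ℂ)⁻¹, (s : ℂ)⁻¹ * l; 0, s]

/-- The middle factor of the Hermitian form. -/
def middleLoop : Loop := fun l => !![(s : ℂ) ^ 2, -(l : ℂ); -(l : ℂ)⁻¹, 0]

theorem star_entireSum {c : ℕ → ℂ} (hc : ∀ i, star (c i) = c i) (q : ℂ) :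
    star (entireSum c q) = entireSum c (star q) := by
  rw [entireSum, entireSum, ← starRingEnd_apply, Complex.conj_tsum]
  refine tsum_congr fun i => ?_
  have := hc i
  simp at this
  simp [this]

theorem HasSymbol.congr {T : SeqSpace →L[ℂ] SeqSpace} {M M' : Loop} (h : HasSymbol T M)
    (hM : ∀ l, M l = M' l) : HasSymbol T M' := fun l x => by rw [h, hM]

theorem hasSymbol_L0Op : HasSymbol (L0Op z) (L0 z) := by
  have hq : HasScalarSymbol (z • shiftOp (-2)) fun l => z * (l : ℂ) ^ (-2 : ℤ) :=
    (hasScalarSymbol_shiftOp _).smul z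
  have h1 := hq.entireSum norm_phiCoeff_le
  have h2 := hq.entireSum norm_phiCoeff'_le
  have h3 := hq.entireSum norm_psiCoeff_le
  have h4 := hq.entireSum norm_psiCoeff'_le
  refine (hasSymbol_blockOp h1 ((hasScalarSymbol_shiftOp 1).mul h2)
    (((hasScalarSymbol_shiftOp (-1)).smul (-2)).mul h3) (h1.sub (h4.smul 2))).congr fun l => ?_
  have e : z * (l : ℂ) ^ (-2 : ℤ) = z / (l : ℂ) ^ 2 := by
    rw [zpow_neg, div_eq_mul_inv]; rfl
  rw [L0_eq, e]
  simp [div_eq_mul_inv]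

theorem hasSymbol_L0StarOp : HasSymbol (L0StarOp z) fun l => (L0 z l)ᴴ := by
  have hq : HasScalarSymbol (star z • shiftOp 2) fun l => star z * (l : ℂ) ^ (2 : ℤ) :=
    (hasScalarSymbol_shiftOp _).smul (star z)
  have h1 := hq.entireSum norm_phiCoeff_le
  have h2 := hq.entireSum norm_phiCoeff'_le
  have h3 := hq.entireSum norm_psiCoeff_le
  have h4 := hq.entireSum norm_psiCoeff'_le
  refine (hasSymbol_blockOp h1 (((hasScalarSymbol_shiftOp 1).smul (-2)).mul h3)
    ((hasScalarSymbol_shiftOp (-1)).mul h2) (h1.sub (h4.smul 2))).congr fun l => ?_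
  have hconj : star (l : ℂ) = (l : ℂ)⁻¹ := (Circle.coe_inv_eq_conj l).symm
  have e : star z * (l : ℂ) ^ (2 : ℤ) = star (z / (l : ℂ) ^ 2) := by
    rw [star_div₀, star_pow, hconj, inv_pow, div_inv_eq_mul]; rfl
  rw [L0_eq, e]
  rw [← star_entireSum (by simp [phiCoeff]), ← star_entireSum (by simp [psiCoeff]),
    ← star_entireSum (by simp [phiCoeff']), ← star_entireSum (by simp [psiCoeff'])]
  ext i j
  fin_cases i <;> fin_cases j <;> simp [← Circle.coe_inv_eq_conj]

theorem hasSymbol_middleOp : HasSymbol (middleOp s) (middleLoop s) :=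
  (hasSymbol_blockOp (hasScalarSymbol_one.smul _) ((hasScalarSymbol_shiftOp _).smul _)
    ((hasScalarSymbol_shiftOp _).smul _) (hasScalarSymbol_one.smul _)).congr
    fun l => by simp [middleLoop]

theorem hasSymbol_triOp : HasSymbol (triOp s) (triLoopInv s) :=
  (hasSymbol_blockOp (hasScalarSymbol_one.smul _) ((hasScalarSymbol_shiftOp _).smul _)
    (hasScalarSymbol_one.smul _) (hasScalarSymbol_one.smul _)).congr
    fun l => by simp [triLoopInv]

theorem hasSymbol_triStarOp : HasSymbol (triStarOp s) fun l => (triLoopInv s l)ᴴ :=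
  (hasSymbol_blockOp (hasScalarSymbol_one.smul _) (hasScalarSymbol_one.smul _)
    ((hasScalarSymbol_shiftOp _).smul _) (hasScalarSymbol_one.smul _)).congr fun l => by
      ext i j
      fin_cases i <;> fin_cases j <;> simp [triLoopInv, ← Circle.coe_inv_eq_conj]

/-- The conjugated Hermitian form. -/
def conjForm (a : ℝ) : Loop :=
  fun l => Dmat * (triLoopInv s l)ᴴ * hermitianForm a z l * triLoopInv s l

variable {z s}

theorem hasSymbol_errorOp {a : ℝ} (hs : s ^ 2 = -(a + 2 * Real.log ‖z‖)) (hs0 : s ≠ 0) :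
    HasSymbol (errorOp z s) fun l => conjForm z s a l - 1 := by
  have hs0' : (s : ℂ) ≠ 0 := by exact_mod_cast hs0
  refine ((((hasSymbol_matOp Dmat).mul (hasSymbol_triStarOp s)).mul
    ((((hasSymbol_L0StarOp z).mul (hasSymbol_middleOp s)).mul (hasSymbol_L0Op z)).sub
    (hasSymbol_middleOp s))).mul (hasSymbol_triOp s)).congr fun l => ?_
  -- The middle factor is Tᴴ D T, so conjugation by T⁻¹ turns it into D; what remains is the effect
  -- of L₀ ≠ 1.
  have h1 : Dmat * (triLoopInv s l)ᴴ * middleLoop s l * triLoopInv s l = 1 := by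
    ext i j
    fin_cases i <;> fin_cases j <;>
      simp [triLoopInv, middleLoop, Dmat, Matrix.mul_apply, Matrix.vecMul, dotProduct,
        Fin.sum_univ_two, ← Circle.coe_inv_eq_conj] <;> field_simp <;>
      first | ring1 | simp
  have h2 : hermitianForm a z l = (L0 z l)ᴴ * middleLoop s l * L0 z l := by
    rw [hermitianForm, middleLoop, ← hs]
    push_cast
    rfl
  rw [conjForm, ← h1, h2]
  simp only [Matrix.mul_sub, Matrix.sub_mul]

theorem triLoopInv_mul_triLoop (hs0 : s ≠ 0) (l : Circle) : triLoopInv s l * triLoop s l = 1 := by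
  have hs0' : (s : ℂ) ≠ 0 := by exact_mod_cast hs0
  ext i j
  fin_cases i <;> fin_cases j <;>
    simp [triLoopInv, triLoop, Matrix.mul_apply, Fin.sum_univ_two, hs0']
  field_simp
  ring

theorem conjTranspose_hermitianForm (a : ℝ) (z : ℂ) (l : Circle) :
    (hermitianForm a z l)ᴴ = hermitianForm a z l := by
  have h1 : ∀ x : ℝ, (!![(x : ℂ), -(l : ℂ); -(l : ℂ)⁻¹, 0] : Mat2)ᴴ =
      !![(x : ℂ), -(l : ℂ); -(l : ℂ)⁻¹, 0] := by
    intro x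
    ext i j
    fin_cases i <;> fin_cases j <;> simp [← Circle.coe_inv_eq_conj]
  rw [hermitianForm]
  simp only [Matrix.conjTranspose_mul, Matrix.conjTranspose_conjTranspose, h1, Matrix.mul_assoc]

theorem det_hermitianForm (a : ℝ) (z : ℂ) (l : Circle) : (hermitianForm a z l).det = -1 := by
  rw [hermitianForm, Matrix.det_mul, Matrix.det_mul, Matrix.det_conjTranspose, det_L0]
  simp [Matrix.det_fin_two_of]

theorem dmat_neg_one : dmat (-1) = Dmat := by
  rw [dmat, Dmat]; simp

theorem inv_Dmat : Dmat⁻¹ = Dmat := Matrix.inv_eq_left_inv Dmat_mul_self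

theorem hermitianForm_neg (a : ℝ) (z : ℂ) (l : Circle) :
    hermitianForm a z (-l) = Dmat * hermitianForm a z l * Dmat := by
  have := hermitianForm_homogeneous a (-1) z l
  rw [dmat_neg_one, inv_Dmat] at this
  simpa using this

theorem conjForm_spec (a : ℝ) (hs0 : s ≠ 0) : (∀ l, (conjForm z s a l).det = 1) ∧
    (∀ l, (conjForm z s a l)ᴴ * Dmat = Dmat * conjForm z s a l) ∧
    ∀ l, Dmat * conjForm z s a (-l) * Dmat = conjForm z s a l := by
  have hs0' : (s : ℂ) ≠ 0 := by exact_mod_cast hs0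
  have hDD : ∀ X : Mat2, Dmat * (Dmat * X) = X := fun X => by
    rw [← Matrix.mul_assoc, Dmat_mul_self, Matrix.one_mul]
  refine ⟨fun l => ?_, fun l => ?_, fun l => ?_⟩
  · rw [conjForm, Matrix.det_mul, Matrix.det_mul, Matrix.det_mul, det_hermitianForm,
      Matrix.det_conjTranspose, det_Dmat, triLoopInv]
    simp [Matrix.det_fin_two_of, hs0']
  · simp only [conjForm, Matrix.conjTranspose_mul, conjTranspose_Dmat, conjTranspose_hermitianForm,
      Matrix.conjTranspose_conjTranspose, Matrix.mul_assoc, hDD, Dmat_mul_self, Matrix.mul_one]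
  · have h1 : triLoopInv s (-l) = Dmat * triLoopInv s l * Dmat := by
      ext i j
      fin_cases i <;> fin_cases j <;>
        simp [triLoopInv, Dmat, Matrix.mul_apply, Fin.sum_univ_two]
    simp only [conjForm, h1, hermitianForm_neg, Matrix.conjTranspose_mul, conjTranspose_Dmat,
      Matrix.mul_assoc, hDD, Dmat_mul_self, Matrix.mul_one]

end Operators


/-! ### Smallness and smoothness of the error operator near z = 0. -/

section Estimates

theorem contDiff_blockOp {V : Type*} [NormedAddCommGroup V] [NormedSpace ℝ V] {n : WithTop ℕ∞}
    {x : V} {a b c d : V → SeqSpace →L[ℂ] SeqSpace} (ha : ContDiffAt ℝ n a x)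
    (hb : ContDiffAt ℝ n b x) (hc : ContDiffAt ℝ n c x) (hd : ContDiffAt ℝ n d x) :
    ContDiffAt ℝ n (fun v => blockOp (a v) (b v) (c v) (d v)) x :=
  (((contDiffAt_const.mul ha).add (contDiffAt_const.mul hb)).add (contDiffAt_const.mul hc)).add
    (contDiffAt_const.mul hd)

theorem isBigO_blockOp {l : Filter ℂ} {g : ℂ → ℝ} {a b c d : ℂ → SeqSpace →L[ℂ] SeqSpace}
    (ha : a =O[l] g) (hb : b =O[l] g) (hc : c =O[l] g) (hd : d =O[l] g) :
    (fun v => blockOp (a v) (b v) (c v) (d v)) =O[l] g :=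
  (((ha.const_mul_left _).add (hb.const_mul_left _)).add (hc.const_mul_left _)).add
    (hd.const_mul_left _)

theorem isBigO_smul_const {l : Filter ℂ} {f : ℂ → ℂ} {g : ℂ → ℝ} (hf : f =O[l] g)
    (T : SeqSpace →L[ℂ] SeqSpace) : (fun v => f v • T) =O[l] g :=
  (IsBigO.of_bound ‖T‖ (.of_forall fun v => by rw [norm_smul, mul_comm])).trans hf

theorem contDiff_entireSum_smul {c : ℕ → ℂ} (hc : ∀ i, ‖c i‖ ≤ 2 ^ i / (i.factorial : ℝ))
    {f : ℂ → ℂ} (hf : ContDiff ℝ ∞ f) (T : SeqSpace →L[ℂ] SeqSpace) :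
    ContDiff ℝ ∞ fun z => entireSum c (f z • T) :=
  ((contDiff_entireSum hc).restrict_scalars ℝ).comp (hf.smul contDiff_const)

theorem contDiff_L0Op : ContDiff ℝ ∞ L0Op := by
  have h := fun {c : ℕ → ℂ} hc => contDiff_entireSum_smul (c := c) hc contDiff_id (shiftOp (-2))
  exact contDiff_iff_contDiffAt.2 fun z => contDiff_blockOp (h norm_phiCoeff_le).contDiffAt
    (contDiffAt_const.mul (h norm_phiCoeff'_le).contDiffAt)
    (contDiffAt_const.mul (h norm_psiCoeff_le).contDiffAt)
    ((h norm_phiCoeff_le).contDiffAt.sub ((h norm_psiCoeff'_le).contDiffAt.const_smul _))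

theorem contDiff_L0StarOp : ContDiff ℝ ∞ L0StarOp := by
  have h := fun {c : ℕ → ℂ} hc => contDiff_entireSum_smul (c := c) hc
    (f := fun z => star z) Complex.conjCLE.contDiff (shiftOp 2)
  exact contDiff_iff_contDiffAt.2 fun z => contDiff_blockOp (h norm_phiCoeff_le).contDiffAt
    (contDiffAt_const.mul (h norm_psiCoeff_le).contDiffAt)
    (contDiffAt_const.mul (h norm_phiCoeff'_le).contDiffAt)
    ((h norm_phiCoeff_le).contDiffAt.sub ((h norm_psiCoeff'_le).contDiffAt.const_smul _))

theorem L0Op_zero : L0Op 0 = 1 := by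
  rw [L0Op, ← blockOp_one]
  simp [phiCoeff, phiCoeff', psiCoeff, psiCoeff']

theorem L0StarOp_zero : L0StarOp 0 = 1 := by
  rw [L0StarOp, ← blockOp_one]
  simp [phiCoeff, phiCoeff', psiCoeff, psiCoeff']

/-- The two triangular factors are O(s). The inner difference is O(s²|z|), because L₀ and its
adjoint are 1 + O(|z|) and the middle factor is O(s²). -/
theorem isBigO_errorOp {l : Filter ℂ} (hl : l ≤ 𝓝 0) {s : ℂ → ℝ} (hs : ∀ᶠ z in l, 1 ≤ s z) :
    (fun z => errorOp z (s z)) =O[l] fun z => s z ^ 4 * ‖z‖ := by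
  have hle : ∀ {f : ℂ → ℂ} {g : ℂ → ℝ}, (∀ᶠ z in l, ‖f z‖ ≤ ‖g z‖) → f =O[l] g := fun h =>
    IsBigO.of_bound 1 (by simpa using h)
  have s1 : (fun z => (s z : ℂ)) =O[l] s := hle (.of_forall fun z => by simp)
  have s2 : (fun z => (s z : ℂ)⁻¹) =O[l] s := hle (hs.mono fun z hz => by
    rw [norm_inv, Complex.norm_real, Real.norm_of_nonneg (by linarith)]
    exact (inv_le_one_of_one_le₀ hz).trans hz)
  have s3 : (fun _ => (0 : ℂ)) =O[l] s := isBigO_zero _ _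
  have s4 : (fun z => (s z : ℂ) ^ 2) =O[l] fun z => s z ^ 2 := hle (.of_forall fun z => by simp)
  have s5 : ∀ c : ℂ, (fun _ => c) =O[l] fun z => s z ^ 2 := fun c =>
    IsBigO.of_bound ‖c‖ (hs.mono fun z hz => by
      rw [norm_pow, Real.norm_of_nonneg (by linarith)]
      exact le_mul_of_one_le_right (norm_nonneg _) (one_le_pow₀ hz))
  have t1 : (fun z => triOp (s z)) =O[l] s := isBigO_blockOp (isBigO_smul_const s2 _)
    (isBigO_smul_const s2 _) (isBigO_smul_const s3 _) (isBigO_smul_const s1 _)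
  have t2 : (fun z => triStarOp (s z)) =O[l] s := isBigO_blockOp (isBigO_smul_const s2 _)
    (isBigO_smul_const s3 _) (isBigO_smul_const s2 _) (isBigO_smul_const s1 _)
  have t3 : (fun z => middleOp (s z)) =O[l] fun z => s z ^ 2 :=
    isBigO_blockOp (isBigO_smul_const s4 _) (isBigO_smul_const (s5 _) _)
      (isBigO_smul_const (s5 _) _) (isBigO_smul_const (s5 _) _)
  have t4 : (fun z => L0Op z - 1) =O[l] fun z => ‖z‖ := by
    have := ((contDiff_L0Op.differentiable (by simp)) 0).isBigO_sub.mono hl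
    simpa [L0Op_zero] using this.norm_right
  have t5 : (fun z => L0StarOp z - 1) =O[l] fun z => ‖z‖ := by
    have := ((contDiff_L0StarOp.differentiable (by simp)) 0).isBigO_sub.mono hl
    simpa [L0StarOp_zero] using this.norm_right
  have t6 : L0Op =O[l] fun _ => (1 : ℝ) :=
    ((contDiff_L0Op.continuous.tendsto 0).mono_left hl).isBigO_one ℝ
  have t7 : (fun z => L0StarOp z * middleOp (s z) * L0Op z - middleOp (s z)) =O[l]
      fun z => ‖z‖ * s z ^ 2 := by
    have h1 := (t5.mul t3).mul t6
    have h2 := t3.mul t4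
    have h3 : (fun z => s z ^ 2 * ‖z‖) =O[l] fun z => ‖z‖ * s z ^ 2 :=
      (isBigO_refl _ l).congr_left fun z => mul_comm _ _
    refine ((h1.congr_right fun z => mul_one _).add (h2.trans h3)).congr_left fun z => ?_
    noncomm_ring
  refine (((t2.const_mul_left (matOp Dmat)).mul t7).mul t1).congr_right fun z => ?_
  ring

/-- The function `s(z)` with `s² = -(a + 2 log |z|)`. -/
def sVal (a : ℝ) (z : ℂ) : ℝ := √(-(a + 2 * Real.log ‖z‖))

theorem tendsto_log_norm : Tendsto (fun z : ℂ => Real.log ‖z‖) (𝓝[≠] 0) atBot :=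
  Real.tendsto_log_nhdsGT_zero.comp tendsto_norm_nhdsNE_zero

theorem tendsto_neg_log_norm (a : ℝ) :
    Tendsto (fun z : ℂ => -(a + 2 * Real.log ‖z‖)) (𝓝[≠] 0) atTop :=
  tendsto_neg_atBot_atTop.comp
    (tendsto_atBot_add_const_left _ _ (tendsto_log_norm.const_mul_atBot two_pos))

theorem tendsto_errorOp (a : ℝ) :
    Tendsto (fun z => errorOp z (sVal a z)) (𝓝[≠] 0) (𝓝 0) := by
  have h1 := (tendsto_neg_log_norm a).eventually_ge_atTop 1
  refine (isBigO_errorOp nhdsWithin_le_nhds (h1.mono fun z hz => ?_)).trans_tendsto ?_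
  · rw [sVal]; exact Real.one_le_sqrt.2 hz
  -- The bound s⁴ r is the square of (a + 2 log r) r^(1/2), and r^(1/2) beats the logarithm.
  · have h2 : Tendsto (fun r : ℝ => (a * r ^ (1 / 2 : ℝ) + 2 * (Real.log r * r ^ (1 / 2 : ℝ))) ^ 2)
        (𝓝[>] 0) (𝓝 0) := by
      have h3 := tendsto_log_mul_rpow_nhdsGT_zero (r := 1 / 2) (by norm_num)
      have h4 : Tendsto (fun r : ℝ => r ^ (1 / 2 : ℝ)) (𝓝[>] 0) (𝓝 0) := by
        have := (Real.continuousAt_rpow_const 0 (1 / 2) (by norm_num)).tendsto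
        rw [Real.zero_rpow (by norm_num)] at this
        exact this.mono_left nhdsWithin_le_nhds
      simpa using ((h4.const_mul a).add (h3.const_mul 2)).pow 2
    refine (h2.comp tendsto_norm_nhdsNE_zero).congr' ?_
    filter_upwards [h1] with z hz
    have e1 : sVal a z ^ 4 = (a + 2 * Real.log ‖z‖) ^ 2 := by
      rw [sVal, show 4 = 2 * 2 by norm_num, pow_mul, Real.sq_sqrt (by linarith)]
      ring
    have e2 : (‖z‖ ^ (1 / 2 : ℝ)) ^ 2 = ‖z‖ := by
      rw [← Real.sqrt_eq_rpow, Real.sq_sqrt (norm_nonneg _)]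
    have e3 : ∀ L x : ℝ, (a * x + 2 * (L * x)) ^ 2 = (a + 2 * L) ^ 2 * x ^ 2 := fun L x => by ring
    simp only [Function.comp_apply]
    rw [e1, e3, e2]

theorem contDiffAt_errorOp {s : ℂ → ℝ} {z : ℂ} (hs : ContDiffAt ℝ ∞ s z) (h0 : s z ≠ 0) :
    ContDiffAt ℝ ∞ (fun z => errorOp z (s z)) z := by
  have s1 : ContDiffAt ℝ ∞ (fun z => (s z : ℂ)) z := Complex.ofRealCLM.contDiff.contDiffAt.comp z hs
  have s2 : ContDiffAt ℝ ∞ (fun z => (s z : ℂ)⁻¹) z := s1.inv (by exact_mod_cast h0)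
  have hc : ∀ {f : ℂ → ℂ} (T : SeqSpace →L[ℂ] SeqSpace), ContDiffAt ℝ ∞ f z →
      ContDiffAt ℝ ∞ (fun z => f z • T) z := fun T hf => hf.smul contDiffAt_const
  have t1 : ContDiffAt ℝ ∞ (fun z => triOp (s z)) z := contDiff_blockOp (hc _ s2) (hc _ s2)
    (hc _ contDiffAt_const) (hc _ s1)
  have t2 : ContDiffAt ℝ ∞ (fun z => triStarOp (s z)) z := contDiff_blockOp (hc _ s2)
    (hc _ contDiffAt_const) (hc _ s2) (hc _ s1)
  have t3 : ContDiffAt ℝ ∞ (fun z => middleOp (s z)) z := contDiff_blockOp (hc _ (s1.pow 2))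
    (hc _ contDiffAt_const) (hc _ contDiffAt_const) (hc _ contDiffAt_const)
  exact ((contDiffAt_const.mul t2).mul
    (((contDiff_L0StarOp.contDiffAt.mul t3).mul contDiff_L0Op.contDiffAt).sub t3)).mul t1

end Estimates

/-! ### The plus factor near the origin. -/

section Construction

variable (a : ℝ)

/-- The diagonal entry of the constant middle factor. -/
def cVal (z : ℂ) : ℝ :=
  (1 + (errorOp z (sVal a z)) (birkhoffColumn (errorOp z (sVal a z)) (Pi.single 0 1)) 0 0).re

/-- The plus factor of the Iwasawa factorization. -/
def plusFactor (z : ℂ) : Loop := fun l =>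
  !![((√(cVal a z) : ℝ) : ℂ), 0; 0, ((√(cVal a z) : ℝ) : ℂ)⁻¹] *
    (birkhoffLoop (errorOp z (sVal a z)) l).adjugate * triLoop (sVal a z) l

/-- The points where the construction of the plus factor applies. -/
structure IsAdmissible (z : ℂ) : Prop where
  ne_zero : z ≠ 0
  pos : 0 < -(a + 2 * Real.log ‖z‖)
  norm_lt : ‖errorOp z (sVal a z)‖ < 1
  cVal_pos : 0 < cVal a z

/-- The constant coefficient of the first entry. -/
def coeffZero : SeqSpace →L[ℂ] ℂ :=
  LinearMap.mkContinuous
    { toFun := fun x => x 0 0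
      map_add' := fun _ _ => rfl
      map_smul' := fun _ _ => rfl } 1 fun x => by
    rw [one_mul]
    exact (norm_le_pi_norm (x 0) 0).trans (lp.norm_apply_le_norm one_ne_zero x 0)

theorem contDiffAt_cFun {E : SeqSpace →L[ℂ] SeqSpace} (hE : ‖E‖ < 1) :
    ContDiffAt ℝ ∞ (fun E : SeqSpace →L[ℂ] SeqSpace =>
      (1 + E (birkhoffColumn E (Pi.single 0 1)) 0 0).re) E := by
  have h1 : ContDiffAt ℝ ∞ (fun E : SeqSpace →L[ℂ] SeqSpace =>
      E (birkhoffColumn E (Pi.single 0 1))) E := by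
    have hb : ContDiff ℝ ∞ fun p : (SeqSpace →L[ℂ] SeqSpace) × SeqSpace => p.1 p.2 :=
      (isBoundedBilinearMap_apply (𝕜 := ℂ) (E := SeqSpace)
        (F := SeqSpace)).contDiff.restrict_scalars ℝ
    exact hb.contDiffAt.comp E (contDiffAt_id.prodMk (contDiffAt_birkhoffColumn hE _))
  have h2 := ((coeffZero.contDiff (n := ∞)).restrict_scalars ℝ).contDiffAt.comp E h1
  exact (Complex.reCLM.contDiff (n := ∞)).contDiffAt.comp E (contDiffAt_const.add h2)

/-- c is a continuous function of the error operator with value 1 at E = 0. This limit alone yields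
the asymptotics of y. -/
theorem tendsto_cVal : Tendsto (cVal a) (𝓝[≠] 0) (𝓝 1) := by
  have h := (contDiffAt_cFun (E := 0) (by simp)).continuousAt.tendsto.comp (tendsto_errorOp a)
  have h0 : (1 + (0 : SeqSpace →L[ℂ] SeqSpace)
      (birkhoffColumn 0 (Pi.single 0 1)) 0 0).re = 1 := by simp
  rw [h0] at h
  exact h

theorem eventually_isAdmissible : ∀ᶠ z in 𝓝[≠] 0, IsAdmissible a z := by
  have h1 := (tendsto_errorOp a).norm.eventually_lt_const (u := 1) (by simp)
  filter_upwards [self_mem_nhdsWithin, (tendsto_neg_log_norm a).eventually_gt_atTop 0, h1,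
    (tendsto_cVal a).eventually (lt_mem_nhds zero_lt_one)] with z hz hz1 hz2 hz3
  exact ⟨hz, hz1, hz2, hz3⟩

variable {a} {z : ℂ}

theorem IsAdmissible.sVal_pos (h : IsAdmissible a z) : 0 < sVal a z := Real.sqrt_pos.2 h.pos

theorem IsAdmissible.sVal_sq (h : IsAdmissible a z) :
    sVal a z ^ 2 = -(a + 2 * Real.log ‖z‖) := Real.sq_sqrt h.pos.le

/-- With C = diag(√c, 1/√c) and B = C Y⁻¹ T, one has C D C = diag(c, -1/c) = Yᴴ D P Y, so Bᴴ D B =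
Tᴴ D P T, which is the Hermitian form by the definition of P = `conjForm`. -/
theorem IsAdmissible.plusFactor_spec (h : IsAdmissible a z) :
    (∀ l, (plusFactor a z l).det = 1) ∧
    (plusFactor a z).ExtendsToDisk !![((sVal a z * √(cVal a z) : ℝ) : ℂ), 0;
      0, ((sVal a z * √(cVal a z) : ℝ) : ℂ)⁻¹] ∧
    ∀ l, (plusFactor a z l)ᴴ * Dmat * plusFactor a z l = hermitianForm a z l := by
  set s := sVal a z with hs
  set E := errorOp z s with hE
  have hs0 : s ≠ 0 := h.sVal_pos.ne'
  have hs0' : (s : ℂ) ≠ 0 := by exact_mod_cast hs0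
  obtain ⟨hp1, hp2, hp3⟩ := conjForm_spec (z := z) a hs0
  obtain ⟨hdet, c, hc, hc0, hY⟩ := birkhoffLoop_spec h.norm_lt
    (hasSymbol_errorOp h.sVal_sq hs0) hp1 hp2 hp3
  replace hY : ∀ l, (birkhoffLoop E l)ᴴ * (Dmat * conjForm z s a l) * birkhoffLoop E l =
      !![(c : ℂ), 0; 0, -(c : ℂ)⁻¹] := hY
  replace hdet : ∀ l, (birkhoffLoop E l).det = 1 := hdet
  have hcv : cVal a z = c := by
    rw [cVal, hc, Complex.ofReal_re]
  have hcpos : 0 < c := hcv ▸ h.cVal_pos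
  have hq0 : ((√c : ℝ) : ℂ) ≠ 0 := by exact_mod_cast (Real.sqrt_pos.2 hcpos).ne'
  have hqq : ((√c : ℝ) : ℂ) * ((√c : ℝ) : ℂ) = c := by
    exact_mod_cast Real.mul_self_sqrt hcpos.le
  have hdef : ∀ l, plusFactor a z l = !![((√c : ℝ) : ℂ), 0; 0, ((√c : ℝ) : ℂ)⁻¹] *
      (birkhoffLoop E l).adjugate * triLoop s l := fun l => by rw [plusFactor, hcv]
  have hadj : ∀ l, birkhoffLoop E l * (birkhoffLoop E l).adjugate = 1 := fun l => by
    rw [Matrix.mul_adjugate, hdet, one_smul]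
  refine ⟨fun l => ?_, ?_, fun l => ?_⟩
  · rw [hdef, Matrix.det_mul, Matrix.det_mul, Matrix.det_adjugate, hdet, triLoop]
    simp [Matrix.det_fin_two_of, hq0, hs0']
  · have h1 : (triLoop s).ExtendsToDisk !![(s : ℂ), 0; 0, (s : ℂ)⁻¹] := by
      rw [Loop.extendsToDisk_iff]
      intro i j
      fin_cases i <;> fin_cases j
      · exact .const _
      · exact (IsDiskBoundary.coe.neg.mul (.const (s : ℂ)⁻¹)).congr (fun l => rfl) (by simp)
      · exact .const _
      · exact .const _
    have h2 := ((Loop.extendsToDisk_const !![((√c : ℝ) : ℂ), 0; 0, ((√c : ℝ) : ℂ)⁻¹]).mul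
      (birkhoffLoop_extendsToDisk h.norm_lt).adjugate).mul h1
    rw [funext hdef, hcv]
    convert h2 using 1
    rw [Matrix.adjugate_one, Matrix.mul_one]
    ext i j
    fin_cases i <;> fin_cases j <;> simp [mul_comm]
  · have h3 : (!![((√c : ℝ) : ℂ), 0; 0, ((√c : ℝ) : ℂ)⁻¹] : Mat2)ᴴ * Dmat *
        !![((√c : ℝ) : ℂ), 0; 0, ((√c : ℝ) : ℂ)⁻¹] = !![(c : ℂ), 0; 0, -(c : ℂ)⁻¹] := by
      ext i j
      fin_cases i <;> fin_cases j <;> simp [Dmat, Matrix.mul_apply, Fin.sum_univ_two, ← hqq]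
    have hti := triLoopInv_mul_triLoop hs0 l
    have hDD : ∀ X : Mat2, Dmat * (Dmat * X) = X := fun X => by
      rw [← Matrix.mul_assoc, Dmat_mul_self, Matrix.one_mul]
    calc (plusFactor a z l)ᴴ * Dmat * plusFactor a z l
        = (triLoop s l)ᴴ * ((birkhoffLoop E l).adjugate)ᴴ *
          ((!![((√c : ℝ) : ℂ), 0; 0, ((√c : ℝ) : ℂ)⁻¹] : Mat2)ᴴ * Dmat *
            !![((√c : ℝ) : ℂ), 0; 0, ((√c : ℝ) : ℂ)⁻¹]) *
          (birkhoffLoop E l).adjugate * triLoop s l := by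
          rw [hdef]; simp only [Matrix.conjTranspose_mul, Matrix.mul_assoc]
      _ = (triLoop s l)ᴴ * (birkhoffLoop E l * (birkhoffLoop E l).adjugate)ᴴ *
          (Dmat * conjForm z s a l) * (birkhoffLoop E l * (birkhoffLoop E l).adjugate) *
          triLoop s l := by
          rw [h3, ← hY l]; simp only [Matrix.conjTranspose_mul, Matrix.mul_assoc]
      _ = (triLoopInv s l * triLoop s l)ᴴ * hermitianForm a z l *
          (triLoopInv s l * triLoop s l) := by
          rw [hadj, conjForm]
          simp only [Matrix.conjTranspose_mul, Matrix.mul_assoc, hDD, Matrix.conjTranspose_one,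
            Matrix.one_mul]
      _ = _ := by rw [hti]; simp

theorem IsAdmissible.contDiffAt_sVal (h : IsAdmissible a z) : ContDiffAt ℝ ∞ (sVal a) z := by
  have h1 : ContDiffAt ℝ ∞ (fun z : ℂ => -(a + 2 * Real.log ‖z‖)) z :=
    (contDiffAt_const.add (contDiffAt_const.mul
      ((contDiffAt_norm ℝ h.ne_zero).log (norm_ne_zero_iff.2 h.ne_zero)))).neg
  exact h1.sqrt h.pos.ne'

theorem IsAdmissible.contDiffAt_errorOp (h : IsAdmissible a z) :
    ContDiffAt ℝ ∞ (fun z => errorOp z (sVal a z)) z :=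
  TTStar.contDiffAt_errorOp h.contDiffAt_sVal h.sVal_pos.ne'

theorem IsAdmissible.contDiffAt_sqrt_cVal (h : IsAdmissible a z) :
    ContDiffAt ℝ ∞ (fun z => √(cVal a z)) z := by
  have h1 := contDiffAt_cFun h.norm_lt
  have h2 := h1.comp z h.contDiffAt_errorOp
  have h3 : ContDiffAt ℝ ∞ (cVal a) z := h2
  exact h3.sqrt h.cVal_pos.ne'

theorem contDiff_evalCLM (l : Circle) (i : Fin 2) : ContDiff ℝ ∞ fun x : SeqSpace =>
    evalCLM l x i :=
  (((ContinuousLinearMap.proj (R := ℂ) i).comp (evalCLM l)).contDiff).restrict_scalars ℝ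

theorem IsAdmissible.contDiffAt_birkhoffLoop (h : IsAdmissible a z) (l : Circle) (i j : Fin 2) :
    ContDiffAt ℝ ∞ (fun z => birkhoffLoop (errorOp z (sVal a z)) l i j) z := by
  have h1 : ContDiffAt ℝ ∞ (fun E => birkhoffColumn E (Pi.single j 1))
      (errorOp z (sVal a z)) := contDiffAt_birkhoffColumn h.norm_lt (Pi.single j 1)
  have h2 : ContDiffAt ℝ ∞ (fun E => evalCLM l (birkhoffColumn E (Pi.single j 1)) i)
      (errorOp z (sVal a z)) := (contDiff_evalCLM l i).contDiffAt.comp _ h1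
  have h3 := h2.comp z h.contDiffAt_errorOp
  exact h3

/-- Smoothness in z is established at l = 1 only: on ℓ¹, evaluation at l need not be differentiable
in l. Homogeneity later supplies the other values of l. -/
theorem plusFactor_one_eq (a : ℝ) (z : ℂ) (Y : Mat2)
    (hY : birkhoffLoop (errorOp z (sVal a z)) 1 = Y) : plusFactor a z 1 =
      !![((√(cVal a z) : ℝ) : ℂ) * (Y 1 1 * (sVal a z : ℂ)),
        ((√(cVal a z) : ℝ) : ℂ) * (-Y 1 1 * (sVal a z : ℂ)⁻¹ - Y 0 1 * (sVal a z : ℂ)⁻¹);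
        ((√(cVal a z) : ℝ) : ℂ)⁻¹ * (-Y 1 0 * (sVal a z : ℂ)),
        ((√(cVal a z) : ℝ) : ℂ)⁻¹ * (Y 1 0 * (sVal a z : ℂ)⁻¹ + Y 0 0 * (sVal a z : ℂ)⁻¹)] := by
  rw [plusFactor, hY, triLoop, Matrix.adjugate_fin_two]
  generalize (sVal a z : ℂ)⁻¹ = t
  generalize ((√(cVal a z) : ℝ) : ℂ)⁻¹ = t'
  ext i j
  fin_cases i <;> fin_cases j <;> simp <;> ring

theorem IsAdmissible.contDiffAt_plusFactor (h : IsAdmissible a z) (i j : Fin 2) :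
    ContDiffAt ℝ ∞ (fun z => plusFactor a z 1 i j) z := by
  have hs1 : ContDiffAt ℝ ∞ (fun z => (sVal a z : ℂ)) z :=
    Complex.ofRealCLM.contDiff.contDiffAt.comp z h.contDiffAt_sVal
  have hs2 : ContDiffAt ℝ ∞ (fun z => (sVal a z : ℂ)⁻¹) z :=
    hs1.inv (by exact_mod_cast h.sVal_pos.ne')
  have hc1 : ContDiffAt ℝ ∞ (fun z => ((√(cVal a z) : ℝ) : ℂ)) z :=
    Complex.ofRealCLM.contDiff.contDiffAt.comp z h.contDiffAt_sqrt_cVal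
  have hc2 : ContDiffAt ℝ ∞ (fun z => ((√(cVal a z) : ℝ) : ℂ)⁻¹) z :=
    hc1.inv (by exact_mod_cast (Real.sqrt_pos.2 h.cVal_pos).ne')
  have hY := h.contDiffAt_birkhoffLoop 1
  have e := fun z => plusFactor_one_eq a z _ rfl
  fin_cases i <;> fin_cases j
  · exact (hc1.mul ((hY 1 1).mul hs1)).congr_of_eventuallyEq
      (.of_forall fun z => congrFun (congrFun (e z) 0) 0)
  · exact (hc1.mul (((hY 1 1).neg.mul hs2).sub ((hY 0 1).mul hs2))).congr_of_eventuallyEq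
      (.of_forall fun z => congrFun (congrFun (e z) 0) 1)
  · exact (hc2.mul ((hY 1 0).neg.mul hs1)).congr_of_eventuallyEq
      (.of_forall fun z => congrFun (congrFun (e z) 1) 0)
  · exact (hc2.mul (((hY 1 0).mul hs2).add ((hY 0 0).mul hs2))).congr_of_eventuallyEq
      (.of_forall fun z => congrFun (congrFun (e z) 1) 1)

end Construction


/-! ### Joint smoothness in z and the angle. -/

section SmoothFamilies

variable {g g' : ℂ → Loop} {U : Set ℂ}

theorem SmoothLoopFamily.smooth (h : SmoothLoopFamily g U) {z : ℂ} (hz : z ∈ U) :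
    (g z).Smooth := fun i j => by
  have h1 : ContDiff ℝ ∞ fun θ : ℝ => (z, θ) := contDiff_const.prodMk contDiff_id
  exact contDiffOn_univ.1
    ((h i j).comp h1.contDiffOn fun θ _ => ⟨hz, Set.mem_univ _⟩)

theorem SmoothLoopFamily.mul (h : SmoothLoopFamily g U) (h' : SmoothLoopFamily g' U) :
    SmoothLoopFamily (fun z l => g z l * g' z l) U := fun i j => by
  simp only [Matrix.mul_apply, Fin.sum_univ_two]
  exact ((h i 0).mul (h' 0 j)).add ((h i 1).mul (h' 1 j))

theorem SmoothLoopFamily.adjugate (h : SmoothLoopFamily g U) :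
    SmoothLoopFamily (fun z l => (g z l).adjugate) U := fun i j => by
  simp only [Matrix.adjugate_fin_two]
  fin_cases i <;> fin_cases j
  exacts [h 1 1, (h 0 1).neg, (h 1 0).neg, h 0 0]

theorem SmoothLoopFamily.congr (h : SmoothLoopFamily g U) (h' : ∀ z ∈ U, ∀ l, g' z l = g z l) :
    SmoothLoopFamily g' U := fun i j =>
  (h i j).congr fun p hp => by rw [h' p.1 hp.1]

theorem contDiff_coe_circle_exp {n : WithTop ℕ∞} :
    ContDiff ℝ n fun θ : ℝ => (Circle.exp θ : ℂ) := by
  simp only [Circle.coe_exp]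
  exact (Complex.ofRealCLM.contDiff.mul contDiff_const).cexp

theorem contDiff_coe_circle_exp_snd {n : WithTop ℕ∞} :
    ContDiff ℝ n fun p : ℂ × ℝ => (Circle.exp p.2 : ℂ) :=
  contDiff_coe_circle_exp.comp contDiff_snd

theorem contDiff_coe_circle_exp_snd_inv {n : WithTop ℕ∞} :
    ContDiff ℝ n fun p : ℂ × ℝ => (Circle.exp p.2 : ℂ)⁻¹ :=
  contDiff_coe_circle_exp_snd.inv fun p => (Circle.exp p.2).coe_ne_zero

theorem smoothLoopFamily_wLoop : SmoothLoopFamily (fun _ => wLoop) U := fun i j => by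
  simp only [wLoop]
  fin_cases i <;> fin_cases j
  exacts [contDiffOn_const, contDiff_coe_circle_exp_snd.contDiffOn,
    contDiff_coe_circle_exp_snd_inv.neg.contDiffOn, contDiffOn_const]

theorem smoothLoopFamily_gamma0 (a : ℝ) : SmoothLoopFamily (fun _ => gamma0 a) U := fun i j => by
  simp only [gamma0]
  fin_cases i <;> fin_cases j
  exacts [contDiffOn_const, (contDiff_coe_circle_exp_snd.neg.div_const _).contDiffOn,
    contDiffOn_const, contDiffOn_const]

theorem smoothLoopFamily_L0 : SmoothLoopFamily L0 U := fun i j => by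
  have hq : ContDiff ℝ ∞ fun p : ℂ × ℝ => p.1 / (Circle.exp p.2 : ℂ) ^ 2 :=
    contDiff_fst.mul ((contDiff_coe_circle_exp_snd.pow 2).inv
      fun p => pow_ne_zero 2 (Circle.exp p.2).coe_ne_zero)
  have h : ∀ {c : ℕ → ℂ}, (∀ i, ‖c i‖ ≤ 2 ^ i / (i.factorial : ℝ)) →
      ContDiff ℝ ∞ fun p : ℂ × ℝ => entireSum c (p.1 / (Circle.exp p.2 : ℂ) ^ 2) :=
    fun {c} hc => ((contDiff_entireSum hc).restrict_scalars ℝ).comp hq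
  have hl : ContDiff ℝ ∞ fun p : ℂ × ℝ => -(2 / (Circle.exp p.2 : ℂ)) :=
    (contDiff_const.mul contDiff_coe_circle_exp_snd_inv).neg
  simp only [L0_eq]
  fin_cases i <;> fin_cases j
  exacts [(h norm_phiCoeff_le).contDiffOn,
    (contDiff_coe_circle_exp_snd.mul (h norm_phiCoeff'_le)).contDiffOn,
    (hl.mul (h norm_psiCoeff_le)).contDiffOn,
    ((h norm_phiCoeff_le).sub (contDiff_const.mul (h norm_psiCoeff'_le))).contDiffOn]

theorem det_gamma0 {a : ℝ} (ha : 0 < a) (l : Circle) : (gamma0 a l).det = 1 := by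
  have hs : ((√a : ℝ) : ℂ) ≠ 0 := by exact_mod_cast (Real.sqrt_pos.2 ha).ne'
  simp [gamma0, Matrix.det_fin_two_of, hs]

theorem inv_gamma0 {a : ℝ} (ha : 0 < a) (l : Circle) :
    (gamma0 a l)⁻¹ = (gamma0 a l).adjugate := by
  rw [Matrix.inv_def, det_gamma0 ha]
  simp

theorem smoothLoopFamily_translatedL {a : ℝ} (ha : 0 < a) (hU : U ⊆ Complex.slitPlane) :
    SmoothLoopFamily (translatedL a) U := by
  have h1 : SmoothLoopFamily (fun z l => !![1, 0; Complex.log z / (l : ℂ), 1]) U := fun i j => by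
    have hlog : ContDiffOn ℝ ∞ (fun p : ℂ × ℝ => Complex.log p.1) (U ×ˢ Set.univ) := fun p hp =>
      (((Complex.contDiffAt_log (hU hp.1)).restrict_scalars ℝ).comp p
        contDiffAt_fst).contDiffWithinAt
    fin_cases i <;> fin_cases j
    exacts [contDiffOn_const, contDiffOn_const, hlog.mul contDiff_coe_circle_exp_snd_inv.contDiffOn,
      contDiffOn_const]
  refine ((smoothLoopFamily_gamma0 a).adjugate.mul (h1.mul smoothLoopFamily_L0)).congr
    fun z _ l => ?_
  rw [translatedL, inv_gamma0 ha, Lsol]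

end SmoothFamilies

/-! ### The twisting and reality conditions. -/

section Twisted

/-- The twisting condition of the loop group. -/
def Loop.IsTwisted (g : Loop) : Prop := ∀ l, Dmat * g (-l) * Dmat = g l

variable {g g' : Loop}

theorem Loop.IsTwisted.mul (h : g.IsTwisted) (h' : g'.IsTwisted) :
    Loop.IsTwisted fun l => g l * g' l := fun l => by
  simp only [← h l, ← h' l]
  calc Dmat * (g (-l) * g' (-l)) * Dmat = Dmat * g (-l) * 1 * g' (-l) * Dmat := by
        simp only [Matrix.mul_assoc, Matrix.one_mul]
    _ = _ := by rw [← Dmat_mul_self]; simp only [Matrix.mul_assoc]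

theorem Loop.IsTwisted.adjugate (h : g.IsTwisted) :
    Loop.IsTwisted fun l => (g l).adjugate := fun l => by
  simp only [← h l, Matrix.adjugate_mul_distrib]
  have : Dmat.adjugate = -Dmat := by
    rw [Dmat, Matrix.adjugate_fin_two]
    ext i j; fin_cases i <;> fin_cases j <;> simp
  rw [this]
  simp [Matrix.mul_assoc]

theorem isTwisted_iff_entries : g.IsTwisted ↔
    ∀ l, g (-l) = !![g l 0 0, -g l 0 1; -g l 1 0, g l 1 1] := by
  have h : ∀ X Y : Mat2, Dmat * X * Dmat = Y ↔ X = !![Y 0 0, -Y 0 1; -Y 1 0, Y 1 1] := by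
    intro X Y
    constructor
    · rintro rfl
      ext i j; fin_cases i <;> fin_cases j <;>
        simp [Dmat, Matrix.mul_apply, Fin.sum_univ_two, Matrix.vecMul, dotProduct]
    · rintro rfl
      ext i j; fin_cases i <;> fin_cases j <;> simp [Dmat, Matrix.mul_apply, Fin.sum_univ_two]
  exact forall_congr' fun l => h _ _

theorem isTwisted_wLoop : wLoop.IsTwisted := isTwisted_iff_entries.2 fun l => by
  simp [wLoop, inv_neg]

theorem isTwisted_gamma0 (a : ℝ) : (gamma0 a).IsTwisted := isTwisted_iff_entries.2 fun l => by
  simp [gamma0, neg_div]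

theorem isTwisted_L0 (z : ℂ) : (L0 z).IsTwisted := isTwisted_iff_entries.2 fun l => by
  rw [L0_eq, L0_eq]
  simp [div_neg]

theorem isTwisted_translatedL {a : ℝ} (ha : 0 < a) (z : ℂ) : (translatedL a z).IsTwisted := by
  have h1 : Loop.IsTwisted fun l => !![1, 0; Complex.log z / (l : ℂ), 1] :=
    isTwisted_iff_entries.2 fun l => by simp [div_neg]
  have h2 := (isTwisted_gamma0 a).adjugate.mul (h1.mul (isTwisted_L0 z))
  intro l
  simp only [translatedL, inv_gamma0 ha]
  exact h2 l

theorem realInvolution_eq_self {A : Mat2} (h : Aᴴ * Dmat * A = Dmat) : realInvolution A = A := by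
  have h1 : (Aᴴ)⁻¹ = Dmat * A * Dmat := Matrix.inv_eq_right_inv (by
    rw [← Matrix.mul_assoc, ← Matrix.mul_assoc, h, Dmat_mul_self])
  rw [realInvolution, h1]
  calc Dmat * (Dmat * A * Dmat) * Dmat = (Dmat * Dmat) * A * (Dmat * Dmat) := by
        simp only [Matrix.mul_assoc]
    _ = A := by simp [Dmat_mul_self]

theorem det_wLoop (l : Circle) : (wLoop l).det = 1 := by
  simp [wLoop, Matrix.det_fin_two_of, l.coe_ne_zero]

end Twisted

/-! ### Existence of the Iwasawa factorization near the origin. -/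

section Existence

variable {a : ℝ} {U : Set ℂ} {z : ℂ}

/-- The diagonal entry at the origin of the plus factor. -/
def kVal (a : ℝ) (z : ℂ) : ℝ := sVal a z * √(cVal a z)

theorem IsAdmissible.kVal_pos (h : IsAdmissible a z) : 0 < kVal a z :=
  mul_pos h.sVal_pos (Real.sqrt_pos.2 h.cVal_pos)

theorem IsAdmissible.kVal_sq (h : IsAdmissible a z) :
    kVal a z ^ 2 = -(a + 2 * Real.log ‖z‖) * cVal a z := by
  rw [kVal, mul_pow, h.sVal_sq, Real.sq_sqrt h.cVal_pos.le]

theorem IsAdmissible.plusFactor_mul (e : Circle) (h : IsAdmissible a z)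
    (h' : IsAdmissible a ((e : ℂ) ^ 2 * z)) (l : Circle) :
    plusFactor a ((e : ℂ) ^ 2 * z) (e * l) = (dmat e)⁻¹ * plusFactor a z l * dmat e :=
  (eq_of_hermitianForm_factorization e h.kVal_pos h'.kVal_pos h.plusFactor_spec.1
    h'.plusFactor_spec.1 h.plusFactor_spec.2.1 h'.plusFactor_spec.2.1 h.plusFactor_spec.2.2
    h'.plusFactor_spec.2.2).2 l

/-- Homogeneity at ε = -1, where ε²z = z and d(-1) = D. -/
theorem IsAdmissible.isTwisted_plusFactor (h : IsAdmissible a z) :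
    (plusFactor a z).IsTwisted := fun l => by
  have e : ((-1 : Circle) : ℂ) ^ 2 * z = z := by simp
  have h1 := h.plusFactor_mul (-1) (by rwa [e]) l
  rw [e, dmat_neg_one, inv_Dmat, neg_one_mul] at h1
  rw [h1]
  calc Dmat * (Dmat * plusFactor a z l * Dmat) * Dmat
      = (Dmat * Dmat) * plusFactor a z l * (Dmat * Dmat) := by simp only [Matrix.mul_assoc]
    _ = plusFactor a z l := by simp [Dmat_mul_self]

/-- Homogeneity gives B(z, l) = d(l)⁻¹ B(l⁻²z, 1) d(l), which trades dependence on l for dependence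
on z. The point l⁻²z may cross the slit; this is harmless because the plus factor is built from
log|z|. -/
theorem smoothLoopFamily_plusFactor
    (h : ∀ z ∈ U, ∀ e : Circle, IsAdmissible a ((e : ℂ) ^ 2 * z)) :
    SmoothLoopFamily (plusFactor a) U := by
  have h1 : ∀ z ∈ U, IsAdmissible a z := fun z hz => by simpa using h z hz 1
  have hinv : ∀ (e : Circle) (z : ℂ), (e : ℂ) ^ 2 * (((e⁻¹ : Circle) : ℂ) ^ 2 * z) = z := by
    intro e z
    have := e.coe_ne_zero
    rw [Circle.coe_inv]
    field_simp
  have hfam : SmoothLoopFamily (fun z l => plusFactor a (((l⁻¹ : Circle) : ℂ) ^ 2 * z) 1) U := by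
    intro i j p hp
    have hm : ContDiff ℝ ∞ fun p : ℂ × ℝ => (((Circle.exp p.2)⁻¹ : Circle) : ℂ) ^ 2 * p.1 := by
      simp only [Circle.coe_inv]
      exact (contDiff_coe_circle_exp_snd_inv.pow 2).mul contDiff_fst
    exact (ContDiffAt.comp p ((h p.1 hp.1 _).contDiffAt_plusFactor i j)
      hm.contDiffAt).contDiffWithinAt
  have hd : SmoothLoopFamily (fun _ => dmat) U := fun i j => by
    simp only [dmat]
    fin_cases i <;> fin_cases j
    exacts [contDiffOn_const, contDiffOn_const, contDiffOn_const,
      contDiff_coe_circle_exp_snd.contDiffOn]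
  have hd' : SmoothLoopFamily (fun _ l => (dmat l)⁻¹) U := fun i j => by
    simp only [inv_dmat]
    fin_cases i <;> fin_cases j
    exacts [contDiffOn_const, contDiffOn_const, contDiffOn_const,
      contDiff_coe_circle_exp_snd_inv.contDiffOn]
  refine ((hd'.mul hfam).mul hd).congr fun z hz l => ?_
  have h2 := (h z hz l⁻¹).plusFactor_mul l (by rw [hinv]; exact h1 z hz) 1
  rw [hinv, mul_one] at h2
  exact h2

/-- The left factor of the Iwasawa factorization. -/
def leftFactor (a : ℝ) (z : ℂ) : Loop := fun l =>
  translatedL a z l * (plusFactor a z l).adjugate * (wLoop l).adjugate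

/-- For F = M B⁻¹ w⁻¹ the two minus signs, from M against B and from w, cancel, so F preserves D. -/
theorem conjTranspose_mul_adjugate_mul_adjugate {M B W : Mat2}
    (hM : -(Mᴴ * Dmat * M) = Bᴴ * Dmat * B) (hB : B.det = 1) (hW : W.det = 1)
    (hW' : Wᴴ * Dmat * W = -Dmat) :
    (M * B.adjugate * W.adjugate)ᴴ * Dmat * (M * B.adjugate * W.adjugate) = Dmat := by
  have hB1 : B * B.adjugate = 1 := by rw [Matrix.mul_adjugate, hB, one_smul]
  have hW1 : W * W.adjugate = 1 := by rw [Matrix.mul_adjugate, hW, one_smul]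
  calc (M * B.adjugate * W.adjugate)ᴴ * Dmat * (M * B.adjugate * W.adjugate)
      = W.adjugateᴴ * B.adjugateᴴ * (Mᴴ * Dmat * M) * B.adjugate * W.adjugate := by
        simp only [Matrix.conjTranspose_mul, Matrix.mul_assoc]
    _ = W.adjugateᴴ * (B * B.adjugate)ᴴ * (-Dmat) * (B * B.adjugate) * W.adjugate := by
        rw [← neg_neg (Mᴴ * Dmat * M), hM]
        simp only [Matrix.conjTranspose_mul, Matrix.mul_assoc, Matrix.mul_neg, Matrix.neg_mul]
    _ = (W * W.adjugate)ᴴ * Dmat * (W * W.adjugate) := by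
        rw [hB1, ← hW']
        simp only [Matrix.conjTranspose_mul, Matrix.mul_assoc, Matrix.conjTranspose_one,
          Matrix.one_mul]
    _ = Dmat := by rw [hW1]; simp

theorem adjugate_mul_cancel {M B W : Mat2} (hB : B.det = 1) (hW : W.det = 1) :
    M * B.adjugate * W.adjugate * W * B = M := by
  rw [Matrix.mul_assoc _ W.adjugate, Matrix.adjugate_mul, hW, one_smul, Matrix.mul_one,
    Matrix.mul_assoc _ B.adjugate, Matrix.adjugate_mul, hB, one_smul, Matrix.mul_one]

theorem det_mul_adjugate_mul_adjugate {M B W : Mat2} (hM : M.det = 1) (hB : B.det = 1)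
    (hW : W.det = 1) : (M * B.adjugate * W.adjugate).det = 1 := by
  rw [Matrix.det_mul, Matrix.det_mul, Matrix.det_adjugate, Matrix.det_adjugate, hM, hB, hW]
  simp

theorem isIwasawaFactorization_plusFactor (ha : 0 < a)
    (hslit : U ⊆ Complex.slitPlane)
    (h : ∀ z ∈ U, ∀ e : Circle, IsAdmissible a ((e : ℂ) ^ 2 * z)) :
    IsIwasawaFactorization (translatedL a) U (leftFactor a) (plusFactor a) (kVal a) := by
  have h1 : ∀ z ∈ U, IsAdmissible a z := fun z hz => by simpa using h z hz 1
  have hB := smoothLoopFamily_plusFactor h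
  have hF : SmoothLoopFamily (leftFactor a) U :=
    ((smoothLoopFamily_translatedL ha hslit).mul hB.adjugate).mul smoothLoopFamily_wLoop.adjugate
  have hdet : ∀ z ∈ U, ∀ l, (plusFactor a z l).det = 1 := fun z hz =>
    (h1 z hz).plusFactor_spec.1
  have hspec : ∀ z ∈ U, ∀ l, (plusFactor a z l)ᴴ * Dmat * plusFactor a z l =
      hermitianForm a z l := fun z hz => (h1 z hz).plusFactor_spec.2.2
  have hext : ∀ z ∈ U, (plusFactor a z).ExtendsToDisk
      !![(kVal a z : ℂ), 0; 0, (kVal a z : ℂ)⁻¹] := fun z hz => (h1 z hz).plusFactor_spec.2.1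
  have hBt : ∀ z ∈ U, (plusFactor a z).IsTwisted := fun z hz => (h1 z hz).isTwisted_plusFactor
  have hFt : ∀ z ∈ U, (leftFactor a z).IsTwisted := fun z hz =>
    ((isTwisted_translatedL ha z).mul (hBt z hz).adjugate).mul isTwisted_wLoop.adjugate
  have hFdet : ∀ z ∈ U, ∀ l, (leftFactor a z l).det = 1 := fun z hz l =>
    det_mul_adjugate_mul_adjugate (det_translatedL ha z l) (hdet z hz l) (det_wLoop l)
  have hFr : ∀ z ∈ U, ∀ l, realInvolution (leftFactor a z l) = leftFactor a z l := fun z hz l =>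
    realInvolution_eq_self (conjTranspose_mul_adjugate_mul_adjugate
      ((hermitianForm_eq ha z l).trans (hspec z hz l).symm) (hdet z hz l)
      (det_wLoop l) (wLoop_conjTranspose_mul l))
  generalize hP : plusFactor a = P at *
  have heq : ∀ z ∈ U, ∀ l, translatedL a z l = leftFactor a z l * wLoop l * P z l :=
    fun z hz l => by
      rw [leftFactor, hP]
      exact (adjugate_mul_cancel (hdet z hz l) (det_wLoop l)).symm
  generalize leftFactor a = G at *
  exact ⟨fun z hz => ⟨⟨hF.smooth hz, hFdet z hz, hFt z hz⟩, hFr z hz⟩,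
    fun z hz => ⟨hB.smooth hz, hdet z hz, hBt z hz⟩, hext, fun z hz => (h1 z hz).kVal_pos,
    hF, hB, heq⟩

theorem exists_isAdmissible (a : ℝ) : ∃ ρ > 0, ∀ z : ℂ, z ≠ 0 → ‖z‖ < ρ → IsAdmissible a z := by
  obtain ⟨ρ, hρ, h⟩ := Metric.mem_nhdsWithin_iff.1 (eventually_isAdmissible a)
  exact ⟨ρ, hρ, fun z hz hz' => h ⟨mem_ball_zero_iff.2 hz', hz⟩⟩

theorem exists_isIwasawaFactorization (ha : 0 < a) : ∃ ρ > 0,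
    IsIwasawaFactorization (translatedL a) (Metric.ball 0 ρ ∩ Complex.slitPlane)
      (leftFactor a) (plusFactor a) (kVal a) := by
  obtain ⟨ρ, hρ, h⟩ := exists_isAdmissible a
  refine ⟨ρ, hρ, isIwasawaFactorization_plusFactor ha Set.inter_subset_right
    fun z hz e => h _ (mul_ne_zero (pow_ne_zero 2 e.coe_ne_zero)
      (Complex.slitPlane_ne_zero hz.2)) ?_⟩
  simpa [Circle.norm_coe] using hz.1

end Existence


/-! ### Derivatives of the identity Bᴴ D B = -Mᴴ D M along a line. -/

section MatrixCalculus

/-- Entrywise derivative of a matrix-valued function of a real variable. -/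
def HasMatDerivAt (f : ℝ → Mat2) (f' : Mat2) (t : ℝ) : Prop :=
  ∀ i j, HasDerivAt (fun s => f s i j) (f' i j) t

variable {f g : ℝ → Mat2} {f' g' : Mat2} {t : ℝ}

theorem HasMatDerivAt.mul (hf : HasMatDerivAt f f' t) (hg : HasMatDerivAt g g' t) :
    HasMatDerivAt (fun s => f s * g s) (f' * g t + f t * g') t := fun i j => by
  simp only [Matrix.add_apply, Matrix.mul_apply, Fin.sum_univ_two]
  exact (((hf i 0).mul (hg 0 j)).add ((hf i 1).mul (hg 1 j))).congr_deriv (by ring)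

theorem HasMatDerivAt.add (hf : HasMatDerivAt f f' t) (hg : HasMatDerivAt g g' t) :
    HasMatDerivAt (fun s => f s + g s) (f' + g') t := fun i j => (hf i j).add (hg i j)

theorem HasMatDerivAt.conjTranspose (hf : HasMatDerivAt f f' t) :
    HasMatDerivAt (fun s => (f s)ᴴ) (f'ᴴ) t := fun i j => (hf j i).star

theorem HasMatDerivAt.mul_const (hf : HasMatDerivAt f f' t) (M : Mat2) :
    HasMatDerivAt (fun s => f s * M) (f' * M) t := by
  have h : HasMatDerivAt (fun _ => M) 0 t := fun i j => hasDerivAt_const _ _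
  simpa using hf.mul h

theorem HasMatDerivAt.neg_unique (hf : HasMatDerivAt f f' t) (hg : HasMatDerivAt g g' t)
    (h : ∀ᶠ s in 𝓝 t, f s = -g s) : f' = -g' := by
  ext i j
  exact (hf i j).unique (((hg i j).neg).congr_of_eventuallyEq
    (h.mono fun s hs => by simp [hs]))

/-- Derivative of the hermitian form of a moving frame. -/
theorem HasMatDerivAt.gram (hf : HasMatDerivAt f f' t) :
    HasMatDerivAt (fun s => (f s)ᴴ * Dmat * f s) (f'ᴴ * Dmat * f t + (f t)ᴴ * Dmat * f') t :=
  (hf.conjTranspose.mul_const Dmat).mul hf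

theorem gram_deriv_eq {b m b' m' : ℝ → Mat2} {b2 m2 : Mat2} {t : ℝ}
    (hb : ∀ᶠ s in 𝓝 t, HasMatDerivAt b (b' s) s) (hm : ∀ᶠ s in 𝓝 t, HasMatDerivAt m (m' s) s)
    (hb2 : HasMatDerivAt b' b2 t) (hm2 : HasMatDerivAt m' m2 t)
    (h : ∀ᶠ s in 𝓝 t, (b s)ᴴ * Dmat * b s = -((m s)ᴴ * Dmat * m s)) :
    (b' t)ᴴ * Dmat * b t + (b t)ᴴ * Dmat * b' t =
      -((m' t)ᴴ * Dmat * m t + (m t)ᴴ * Dmat * m' t) ∧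
    b2ᴴ * Dmat * b t + (2 : ℂ) • ((b' t)ᴴ * Dmat * b' t) + (b t)ᴴ * Dmat * b2 =
      -(m2ᴴ * Dmat * m t + (2 : ℂ) • ((m' t)ᴴ * Dmat * m' t) + (m t)ᴴ * Dmat * m2) := by
  have h1 : ∀ᶠ s in 𝓝 t, (b' s)ᴴ * Dmat * b s + (b s)ᴴ * Dmat * b' s =
      -((m' s)ᴴ * Dmat * m s + (m s)ᴴ * Dmat * m' s) := by
    filter_upwards [hb, hm, h.eventually_nhds] with s hbs hms hs
    exact hbs.gram.neg_unique hms.gram hs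
  refine ⟨h1.self_of_nhds, ?_⟩
  have key : ∀ {b b' : ℝ → Mat2} {b2 : Mat2}, HasMatDerivAt b (b' t) t → HasMatDerivAt b' b2 t →
      HasMatDerivAt (fun s => (b' s)ᴴ * Dmat * b s + (b s)ᴴ * Dmat * b' s)
        (b2ᴴ * Dmat * b t + (2 : ℂ) • ((b' t)ᴴ * Dmat * b' t) + (b t)ᴴ * Dmat * b2) t := by
    intro b b' b2 h1 h2
    convert ((h2.conjTranspose.mul_const Dmat).mul h1).add
      ((h1.conjTranspose.mul_const Dmat).mul h2) using 1
    rw [two_smul]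
    abel
  exact (key hb.self_of_nhds hb2).neg_unique (key hm.self_of_nhds hm2) h1

end MatrixCalculus

/-! ### Algebra of the first and second order identities. -/

section Algebra

/-- Conjugation by Y = B⁻¹ replaces derivatives of B by right logarithmic derivatives. -/
theorem gram_conj {B Y X X' : Mat2} (h : B * Y = 1) :
    Yᴴ * (Xᴴ * Dmat * B + Bᴴ * Dmat * X') * Y = (X * Y)ᴴ * Dmat + Dmat * (X' * Y) := by
  have h' : Yᴴ * Bᴴ = 1 := by rw [← Matrix.conjTranspose_mul, h, Matrix.conjTranspose_one]
  calc _ = Yᴴ * Xᴴ * Dmat * (B * Y) + (Yᴴ * Bᴴ) * Dmat * X' * Y := by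
        simp only [Matrix.mul_add, Matrix.add_mul, Matrix.mul_assoc]
    _ = _ := by
        rw [h, h', Matrix.conjTranspose_mul]
        simp only [Matrix.mul_one, Matrix.one_mul, Matrix.mul_assoc]

/-- In direction c the derivative of M is cMA. Since the forms of B and M agree up to sign, MA may
be replaced by BA, so the logarithmic derivative of B and cBAB⁻¹ have the same D-Hermitian part. -/
theorem gram_gauge {B Y M A : Mat2} (hM : Bᴴ * Dmat * B = -(Mᴴ * Dmat * M)) (h : B * Y = 1)
    (c : ℂ) {X : Mat2} (hX : Xᴴ * Dmat * B + Bᴴ * Dmat * X =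
      -((c • (M * A))ᴴ * Dmat * M + Mᴴ * Dmat * (c • (M * A)))) :
    (X * Y)ᴴ * Dmat + Dmat * (X * Y) =
      (c • (B * A * Y))ᴴ * Dmat + Dmat * (c • (B * A * Y)) := by
  rw [← gram_conj h, hX]
  have e : -((c • (M * A))ᴴ * Dmat * M + Mᴴ * Dmat * (c • (M * A))) =
      (c • (B * A))ᴴ * Dmat * B + Bᴴ * Dmat * (c • (B * A)) := by
    have e1 : ∀ Z : Mat2, (c • (Z * A))ᴴ * Dmat * Z + Zᴴ * Dmat * (c • (Z * A)) =
        star c • (Aᴴ * (Zᴴ * Dmat * Z)) + c • ((Zᴴ * Dmat * Z) * A) := fun Z => by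
      simp only [Matrix.conjTranspose_smul, Matrix.conjTranspose_mul, Matrix.smul_mul,
        Matrix.mul_smul, Matrix.mul_assoc]
    rw [e1, e1, hM]
    simp only [Matrix.mul_neg, Matrix.neg_mul, smul_neg, neg_add]
  rw [e, gram_conj h, Matrix.smul_mul]

/-- The `∂`- and `∂̄`-parts of a logarithmic derivative. -/
theorem wirtinger_first_order {P₁ P₂ n : Mat2}
    (h₁ : P₁ᴴ * Dmat + Dmat * P₁ = ((1 : ℂ) • n)ᴴ * Dmat + Dmat * ((1 : ℂ) • n))
    (h₂ : P₂ᴴ * Dmat + Dmat * P₂ = (Complex.I • n)ᴴ * Dmat + Dmat * (Complex.I • n)) :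
    (1 / 2 : ℂ) • (P₁ - Complex.I • P₂) +
      Dmat * ((1 / 2 : ℂ) • (P₁ + Complex.I • P₂))ᴴ * Dmat = n := by
  -- Subtracting i times the second identity from the first cancels nᴴ and leaves 2Dn.
  have e : ∀ i j, (P₁ᴴ * Dmat + Dmat * P₁) i j - Complex.I * (P₂ᴴ * Dmat + Dmat * P₂) i j =
      2 * (Dmat * n) i j := by
    intro i j
    rw [h₁, h₂]
    simp only [Matrix.add_apply, one_smul, Matrix.conjTranspose_smul, Matrix.smul_mul,
      Matrix.mul_smul, Matrix.smul_apply, smul_eq_mul, Complex.star_def, Complex.conj_I]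
    linear_combination (nᴴ * Dmat) i j * Complex.I_sq - (Dmat * n) i j * Complex.I_sq
  ext i j
  have := e i j
  fin_cases i <;> fin_cases j <;>
  · simp [Dmat, Matrix.mul_apply, Fin.sum_univ_two, Matrix.vecMul, dotProduct] at this ⊢
    first
    | linear_combination this / 2
    | linear_combination -this / 2

/-- Here Q stands for ΔB·B⁻¹, a for ∂B·B⁻¹ and b for ∂̄B·B⁻¹. Substituting n = a + D bᴴ D cancels
aᴴDa, and the terms in |b₀₀|² cancel in the (0,0) entry. -/
theorem wirtinger_second_order {Q P₁ P₂ n a b : Mat2}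
    (ha : a = (1 / 2 : ℂ) • (P₁ - Complex.I • P₂)) (hb : b = (1 / 2 : ℂ) • (P₁ + Complex.I • P₂))
    (hn : a + Dmat * bᴴ * Dmat = n)
    (h : Qᴴ * Dmat + Dmat * Q + (2 : ℂ) • (P₁ᴴ * Dmat * P₁ + P₂ᴴ * Dmat * P₂) =
      (4 : ℂ) • (nᴴ * Dmat * n)) :
    2 * (Q 0 0).re = 4 * (2 * (b 0 0 * a 0 0 + b 0 1 * a 1 0).re -
      Complex.normSq (b 0 1) + Complex.normSq (b 1 0)) := by
  have hI := Complex.I_sq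
  have e1 : P₁ = a + b := by
    rw [ha, hb]; ext i j; simp; ring
  have e2 : P₂ = Complex.I • (a - b) := by
    rw [ha, hb]; ext i j; simp
    linear_combination P₂ i j * hI
  have h00 := congrFun (congrFun h 0) 0
  rw [← hn, e1, e2] at h00
  have h00' := congrArg Complex.re h00
  simp [Dmat, Matrix.mul_apply, Fin.sum_univ_two, Matrix.vecMul, dotProduct,
    Complex.normSq_apply] at h00' ⊢
  nlinarith [h00']

end Algebra

/-! ### Liouville's theorem applied to the logarithmic derivatives. -/

section Liouville

variable {a b m q : Loop} {α β κ ν σ : ℂ}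

/-- In each entry of a + D bᴴ D = l⁻¹m, b is isolated as the conjugate of a function extending to
the disk. For the off-diagonal entries the zero of b at the origin is divided out; for the diagonal
one, the zero of m. -/
theorem antiholomorphic_part_eq (ha : a.ExtendsToDisk !![α, 0; 0, -α])
    (hb : b.ExtendsToDisk !![β, 0; 0, -β]) (hm : m.ExtendsToDisk !![0, κ; ν, 0])
    (h : ∀ l : Circle, (l : ℂ) • (a l + Dmat * (b l)ᴴ * Dmat) = m l) (l : Circle) :
    b l 0 0 = β ∧ b l 0 1 = -(l : ℂ) * star ν ∧ b l 1 0 = -(l : ℂ) * star κ := by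
  rw [Loop.extendsToDisk_iff] at ha hb hm
  have hstar : ∀ l : Circle, star (l : ℂ) = (l : ℂ)⁻¹ := fun l => (Circle.coe_inv_eq_conj l).symm
  have hent : ∀ l i j, m l i j = (l : ℂ) * (a l + Dmat * (b l)ᴴ * Dmat) i j := fun l i j => by
    rw [← h l]; rfl
  have h00 : ∀ l, m l 0 0 = l * (a l 0 0 + star (b l 0 0)) := fun l => by
    rw [hent]; simp [Dmat, Matrix.mul_apply, Fin.sum_univ_two, Matrix.vecMul, dotProduct]
  have h01 : ∀ l, m l 0 1 = l * (a l 0 1 - star (b l 1 0)) := fun l => by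
    rw [hent]; simp [Dmat, Matrix.mul_apply, Fin.sum_univ_two, Matrix.vecMul, dotProduct]; ring
  have h10 : ∀ l, m l 1 0 = l * (a l 1 0 - star (b l 0 1)) := fun l => by
    rw [hent]; simp [Dmat, Matrix.mul_apply, Fin.sum_univ_two, Matrix.vecMul, dotProduct]; ring
  have hoff : ∀ {i j : Fin 2} {i' j' : Fin 2} {c : ℂ}, IsDiskBoundary (fun l => b l i j) 0 →
      IsDiskBoundary (fun l => m l i' j') c → IsDiskBoundary (fun l => a l i' j') 0 →
      (∀ l, m l i' j' = l * (a l i' j' - star (b l i j))) → ∀ l, b l i j = -(l : ℂ) * star c := by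
    intro i j i' j' c h1 h2 h3 h4 l
    obtain ⟨d, hd⟩ := h1.div_coe
    have h5 := ((IsDiskBoundary.coe.mul h3).sub h2).eq_const_of_eq_conj hd fun l => by
      rw [h4, star_mul', star_inv₀, hstar, inv_inv]
      ring
    have h7 := h5.2 l
    have h8 := l.coe_ne_zero
    rw [h4] at h7
    have h9 : (l : ℂ) * star (b l i j) = -c := by linear_combination h7
    have h10 := congrArg star h9
    rw [star_mul', star_star, hstar, star_neg] at h10
    field_simp at h10
    rw [h10]; ring
  refine ⟨?_, hoff (hb 0 1) (hm 1 0) (ha 1 0) h10 l, hoff (hb 1 0) (hm 0 1) (ha 0 1) h01 l⟩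
  obtain ⟨d, hd⟩ := (hm 0 0).div_coe
  have h5 := (hb 0 0).eq_const_of_eq_conj (hd.sub (ha 0 0)) fun l => by
    have h8 := l.coe_ne_zero
    rw [h00, mul_right_comm, mul_inv_cancel₀ h8]
    simp
  exact h5.2 l

/-- With b known, q₀₀ minus 4(ba)₀₀ is a boundary value with constant real part, hence can be read
at the origin; there b₀₁a₁₀ vanishes. -/
theorem re_laplacian_eq (ha : a.ExtendsToDisk !![α, 0; 0, -α])
    (hb : b.ExtendsToDisk !![β, 0; 0, -β]) (hm : m.ExtendsToDisk !![0, κ; ν, 0])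
    (h : ∀ l : Circle, (l : ℂ) • (a l + Dmat * (b l)ᴴ * Dmat) = m l)
    (hq : IsDiskBoundary (fun l => q l 0 0) σ)
    (hq2 : ∀ l, 2 * (q l 0 0).re = 4 * (2 * (b l 0 0 * a l 0 0 + b l 0 1 * a l 1 0).re -
      Complex.normSq (b l 0 1) + Complex.normSq (b l 1 0))) :
    (σ - 4 * (β * α)).re = 2 * (Complex.normSq κ - Complex.normSq ν) := by
  have hbe := antiholomorphic_part_eq ha hb hm h
  rw [Loop.extendsToDisk_iff] at ha
  have h1 := hq.sub ((((ha 0 0).const_mul β).add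
    ((IsDiskBoundary.coe.mul (ha 1 0)).const_mul (-star ν))).const_mul 4)
  have h2 := h1.re_eq_of_re_const (x := 2 * (Complex.normSq κ - Complex.normSq ν)) fun l => by
    obtain ⟨e1, e2, e3⟩ := hbe l
    have h3 := hq2 l
    have hl : Complex.normSq (l : ℂ) = 1 := by
      rw [Complex.normSq_eq_norm_sq, Circle.norm_coe]; norm_num
    rw [e1, e2, e3] at h3
    simp only [Complex.normSq_mul, Complex.normSq_neg, hl, Complex.star_def,
      Complex.normSq_conj, one_mul] at h3
    have e : -(l : ℂ) * (starRingEnd ℂ) ν * a l 1 0 = -(starRingEnd ℂ) ν * (l * a l 1 0) := by ring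
    rw [e] at h3
    have h4 : ∀ x y : ℂ, (x - 4 * y).re = x.re - 4 * y.re := fun x y => by simp
    simp only [Complex.star_def, h4]
    linarith
  simpa using h2

end Liouville


/-! ### Differentiation along real lines in the z-plane. -/

section Lines

variable {a : ℝ} {U : Set ℂ} {F B : ℂ → Loop} {k : ℂ → ℝ} {G : ℂ → Loop} {z : ℂ}

theorem contDiff_line (z e : ℂ) {n : WithTop ℕ∞} : ContDiff ℝ n fun t : ℝ => z + t * e :=
  contDiff_const.add (Complex.ofRealCLM.contDiff.mul contDiff_const)

theorem isOpen_lineSet (hU : IsOpen U) (z e : ℂ) : IsOpen {t : ℝ | z + t * e ∈ U} :=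
  hU.preimage (contDiff_line z e (n := 0)).continuous

theorem zero_mem_lineSet (hz : z ∈ U) (e : ℂ) : (0 : ℝ) ∈ {t : ℝ | z + t * e ∈ U} := by
  simpa using hz

theorem SmoothLoopFamily.contDiffOn_line (h : SmoothLoopFamily B U) (z e : ℂ) (i j : Fin 2) :
    ContDiffOn ℝ ∞ (fun p : ℝ × ℝ => B (z + p.1 * e) (Circle.exp p.2) i j)
      ({t : ℝ | z + t * e ∈ U} ×ˢ Set.univ) := by
  have h1 : ContDiff ℝ ∞ fun p : ℝ × ℝ => (z + p.1 * e, p.2) :=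
    ((contDiff_line z e).comp contDiff_fst).prodMk contDiff_snd
  exact (h i j).comp h1.contDiffOn fun p hp => ⟨hp.1, Set.mem_univ _⟩

/-- The boundary-value calculus is one-dimensional, so regularity is obtained on the radial line t ↦
z + tz and transported by k(w) = k(z + (|w|/|z| - 1)z). -/
theorem contDiffAt_of_isRadialOn (hU : IsOpen U) (hz : z ∈ U) (hz0 : z ≠ 0)
    (hrad : IsRadialOn k U) {n : WithTop ℕ∞}
    (h : ContDiffAt ℝ n (fun t : ℝ => k (z + t * z)) 0) : ContDiffAt ℝ n k z := by
  have hr : ‖z‖ ≠ 0 := norm_ne_zero_iff.2 hz0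
  have h1 : ContDiffAt ℝ n (fun w : ℂ => ‖w‖ / ‖z‖ - 1) z :=
    ((contDiffAt_norm ℝ hz0).div_const _).sub contDiffAt_const
  have h2' : 0 = ‖z‖ / ‖z‖ - 1 := by simp [hr]
  have h3 : ContDiffAt ℝ n (fun w : ℂ => k (z + (‖w‖ / ‖z‖ - 1 : ℝ) * z)) z :=
    ContDiffAt.comp z (g := fun t : ℝ => k (z + t * z)) (h2' ▸ h) h1
  refine h3.congr_of_eventuallyEq ?_
  have h4 : ContinuousAt (fun w : ℂ => z + (‖w‖ / ‖z‖ - 1 : ℝ) * z) z := by fun_prop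
  have h5 : z + (‖z‖ / ‖z‖ - 1 : ℝ) * z = z := by simp [hr]
  filter_upwards [hU.mem_nhds hz, h4.preimage_mem_nhds (t := U) (by
    rw [h5]; exact hU.mem_nhds hz)] with w hw hw'
  refine hrad w hw _ hw' ?_
  have e : z + (‖w‖ / ‖z‖ - 1 : ℝ) * z = (‖w‖ / ‖z‖ : ℝ) * z := by push_cast; ring
  rw [e, norm_mul, Complex.norm_real, Real.norm_of_nonneg (by positivity)]
  field_simp

theorem IsIwasawaFactorization.isDiskBoundary_entry (h : IsIwasawaFactorization G U F B k)
    (hz : z ∈ U) (i j : Fin 2) : IsDiskBoundary (fun l => B z l i j)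
      ((!![(k z : ℂ), 0; 0, (k z : ℂ)⁻¹] : Mat2) i j) :=
  Loop.extendsToDisk_iff.1 (h.extends_to_disk z hz) i j

theorem IsIwasawaFactorization.contDiffAt
    (h : IsIwasawaFactorization (translatedL a) U F B k) (ha : 0 < a) (hU : IsOpen U)
    (hz : z ∈ U) (hz0 : z ≠ 0) : ContDiffAt ℝ 2 k z := by
  refine contDiffAt_of_isRadialOn hU hz hz0 (h.isRadialOn ha) ?_
  have h1 := contDiffOn_of_isDiskBoundary (isOpen_lineSet hU z z) 2
    (f := fun t l => B (z + t * z) l 0 0) (κ := fun t => (k (z + t * z) : ℂ))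
    (h.smooth_right.contDiffOn_line z z 0 0) fun t ht => h.isDiskBoundary_entry ht 0 0
  have h2 := h1.contDiffAt ((isOpen_lineSet hU z z).mem_nhds (zero_mem_lineSet hz z))
  exact Complex.reCLM.contDiff.contDiffAt.comp (0 : ℝ) h2

/-- The derivatives of the plus factor along a line, as loops. -/
theorem IsIwasawaFactorization.exists_line_derivatives (h : IsIwasawaFactorization G U F B k)
    (hU : IsOpen U) (hz : z ∈ U) (e : ℂ) (hk : ContDiffAt ℝ 2 k z) :
    ∃ (B' : ℝ → Loop) (B2 : Loop) (c : ℂ),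
      (∀ l, ∀ᶠ t in 𝓝 (0 : ℝ), HasMatDerivAt (fun t => B (z + t * e) l) (B' t l) t) ∧
      (∀ l, HasMatDerivAt (fun t => B' t l) (B2 l) 0) ∧
      (B' 0).ExtendsToDisk !![((deriv (fun t : ℝ => k (z + t * e)) 0 : ℝ) : ℂ), 0; 0,
        ((-deriv (fun t : ℝ => k (z + t * e)) 0 / k z ^ 2 : ℝ) : ℂ)] ∧
      IsDiskBoundary (fun l => B2 l 0 0)
        ((deriv (deriv fun t : ℝ => k (z + t * e)) 0 : ℝ) : ℂ) ∧
      IsDiskBoundary (fun l => B2 l 0 1) c := by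
  set J := {t : ℝ | z + t * e ∈ U} with hJ
  have hJo : IsOpen J := isOpen_lineSet hU z e
  have h0 : (0 : ℝ) ∈ J := zero_mem_lineSet hz e
  have hJ0 : ∀ᶠ t in 𝓝 (0 : ℝ), t ∈ J := hJo.mem_nhds h0
  set κ : Fin 2 → Fin 2 → ℝ → ℂ := fun i j t =>
    (!![(k (z + t * e) : ℂ), 0; 0, (k (z + t * e) : ℂ)⁻¹] : Mat2) i j with hκ
  have s1 := fun i j => exists_hasDerivAt_of_isDiskBoundary hJo
    (f := fun t l => B (z + t * e) l i j) (κ := κ i j) (h.smooth_right.contDiffOn_line z e i j)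
    fun t ht => h.isDiskBoundary_entry ht i j
  have s2 := fun i j => exists_hasDerivAt_of_isDiskBoundary hJo
    (f := fun t l => deriv (fun s : ℝ => B (z + s * e) l i j) t) (κ := deriv (κ i j))
    (s1 i j).1 (s1 i j).2.1
  have hk1 : ContDiffAt ℝ 2 (fun t : ℝ => k (z + t * e)) 0 :=
    ContDiffAt.comp (0 : ℝ) (by simpa using hk) (contDiff_line z e).contDiffAt
  have hd : ∀ᶠ t in 𝓝 (0 : ℝ), HasDerivAt (fun t : ℝ => k (z + t * e))
      (deriv (fun t : ℝ => k (z + t * e)) t) t :=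
    (hk1.eventually (by simp)).mono fun t ht => (ht.differentiableAt (by simp)).hasDerivAt
  have hκ0 : deriv (κ 0 0) =ᶠ[𝓝 0] fun t => ((deriv (fun t : ℝ => k (z + t * e)) t : ℝ) : ℂ) :=
    hd.mono fun t ht => ht.ofReal_comp.deriv
  refine ⟨fun t l => Matrix.of fun i j => deriv (fun s : ℝ => B (z + s * e) l i j) t,
    fun l => Matrix.of fun i j => deriv (fun t : ℝ => deriv (fun s : ℝ => B (z + s * e) l i j) t) 0,
    deriv (deriv (κ 0 1)) 0,
    fun l => hJ0.mono fun t ht i j => ((s1 i j).2.2.2 t ht l).hasDerivAt,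
    fun l i j => ((s2 i j).2.2.2 0 h0 l).hasDerivAt, ?_, ?_, (s2 0 1).2.1 0 h0⟩
  · rw [Loop.extendsToDisk_iff]
    intro i j
    refine ((s1 i j).2.1 0 h0).congr (fun l => rfl) ?_
    fin_cases i <;> fin_cases j
    · exact hκ0.self_of_nhds
    · exact deriv_const _ _
    · exact deriv_const _ _
    · have hkz : k (z + (0 : ℝ) * e) ≠ 0 := by simpa using (h.pos z hz).ne'
      have h3 := (hd.self_of_nhds.inv hkz).ofReal_comp.deriv
      have h4 : κ 1 1 = fun t : ℝ => (((k (z + t * e))⁻¹ : ℝ) : ℂ) := funext fun t => by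
        simp [hκ]
      have h5 : deriv (κ 1 1) 0 =
          ((-deriv (fun t : ℝ => k (z + t * e)) 0 / k z ^ 2 : ℝ) : ℂ) := by
        rw [h4]
        simpa using h3
      exact h5
  · refine ((s2 0 0).2.1 0 h0).congr (fun l => rfl) ?_
    rw [hκ0.deriv_eq]
    have h3 := (hasDerivAt_deriv_of_contDiffAt hk1).ofReal_comp.deriv
    exact h3

/-- The derivatives of `γ₀⁻¹ L` along a line. -/
theorem hasMatDerivAt_translatedL_line (a : ℝ) {z e : ℂ} {t : ℝ}
    (hz : z + t * e ∈ Complex.slitPlane) (l : Circle) :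
    HasMatDerivAt (fun t : ℝ => translatedL a (z + t * e) l)
      (e • (translatedL a (z + t * e) l * connectionMatrix (z + t * e) l)) t := fun i j => by
  have h := HasDerivAt.comp t (hasDerivAt_translatedL a hz l i j) (hasDerivAt_line z e t)
  exact h.congr_deriv (by rw [Matrix.smul_apply, smul_eq_mul, mul_comm])

/-- Holomorphy in z makes the second derivative in direction e equal to e² times one matrix X, so X
drops out of the sum over e = 1 and e = i. -/
theorem exists_hasMatDerivAt_translatedL_line (a : ℝ) {z : ℂ} (hz : z ∈ Complex.slitPlane)
    (l : Circle) : ∃ X : Mat2, ∀ e : ℂ, HasMatDerivAt (fun t : ℝ =>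
      e • (translatedL a (z + t * e) l * connectionMatrix (z + t * e) l)) (e ^ 2 • X) 0 := by
  have hz0 := Complex.slitPlane_ne_zero hz
  have hA : ∀ i j, DifferentiableAt ℂ (fun z => connectionMatrix z l i j) z := by
    intro i j
    simp only [connectionMatrix]
    fin_cases i <;> fin_cases j
    exacts [differentiableAt_const _, differentiableAt_const _,
      (differentiableAt_inv hz0).const_mul _, differentiableAt_const _]
  have hX : ∀ i j, DifferentiableAt ℂ
      (fun z => (translatedL a z l * connectionMatrix z l) i j) z := by
    intro i j
    have e : (fun z => (translatedL a z l * connectionMatrix z l) i j) = fun z =>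
        translatedL a z l i 0 * connectionMatrix z l 0 j +
          translatedL a z l i 1 * connectionMatrix z l 1 j :=
      funext fun z => by rw [Matrix.mul_apply, Fin.sum_univ_two]
    rw [e]
    exact ((hasDerivAt_translatedL a hz l i 0).differentiableAt.mul (hA 0 j)).add
      ((hasDerivAt_translatedL a hz l i 1).differentiableAt.mul (hA 1 j))
  refine ⟨Matrix.of fun i j =>
    deriv (fun z => (translatedL a z l * connectionMatrix z l) i j) z, fun e i j => ?_⟩
  have h1 : HasDerivAt (fun z => (translatedL a z l * connectionMatrix z l) i j)
      (deriv (fun z => (translatedL a z l * connectionMatrix z l) i j) z) (z + (0 : ℝ) * e) := by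
    simpa using (hX i j).hasDerivAt
  have h2 := (HasDerivAt.comp (0 : ℝ) h1 (hasDerivAt_line z e 0)).const_mul e
  exact h2.congr_deriv (by simp; ring)

end Lines

/-! ### The Gauss-Codazzi equations for log k. -/

section GaussCodazzi

/-- Adding the directions 1 and i, X cancels because 1² + i² = 0, and the quadratic terms add up to
2 + 2 = 4. -/
theorem gram_gauge_second {B Y M A X R₁ R₂ P₁ P₂ : Mat2}
    (hM : Bᴴ * Dmat * B = -(Mᴴ * Dmat * M)) (h : B * Y = 1)
    (h₁ : R₁ᴴ * Dmat * B + (2 : ℂ) • (P₁ᴴ * Dmat * P₁) + Bᴴ * Dmat * R₁ =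
      -(((1 : ℂ) ^ 2 • X)ᴴ * Dmat * M +
        (2 : ℂ) • (((1 : ℂ) • (M * A))ᴴ * Dmat * ((1 : ℂ) • (M * A))) +
        Mᴴ * Dmat * ((1 : ℂ) ^ 2 • X)))
    (h₂ : R₂ᴴ * Dmat * B + (2 : ℂ) • (P₂ᴴ * Dmat * P₂) + Bᴴ * Dmat * R₂ =
      -((Complex.I ^ 2 • X)ᴴ * Dmat * M +
        (2 : ℂ) • ((Complex.I • (M * A))ᴴ * Dmat * (Complex.I • (M * A))) +
        Mᴴ * Dmat * (Complex.I ^ 2 • X))) :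
    ((R₁ + R₂) * Y)ᴴ * Dmat + Dmat * ((R₁ + R₂) * Y) +
      (2 : ℂ) • ((P₁ * Y)ᴴ * Dmat * (P₁ * Y) + (P₂ * Y)ᴴ * Dmat * (P₂ * Y)) =
      (4 : ℂ) • ((B * A * Y)ᴴ * Dmat * (B * A * Y)) := by
  have e1 : (R₁ + R₂)ᴴ * Dmat * B + Bᴴ * Dmat * (R₁ + R₂) +
      (2 : ℂ) • (P₁ᴴ * Dmat * P₁ + P₂ᴴ * Dmat * P₂) = -((4 : ℂ) • (Aᴴ * (Mᴴ * Dmat * M) * A)) := by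
    have h3 := congrArg₂ (· + ·) h₁ h₂
    have hI : star Complex.I * Complex.I = 1 := by simp
    simp only [Complex.I_sq, one_pow, one_smul, neg_smul, Matrix.conjTranspose_smul,
      Matrix.conjTranspose_neg, Matrix.smul_mul, Matrix.mul_smul, smul_smul, Matrix.neg_mul,
      Matrix.mul_neg, hI, mul_comm Complex.I, Matrix.conjTranspose_mul] at h3
    refine Eq.trans ?_ (h3.trans ?_)
    · simp only [Matrix.conjTranspose_add, Matrix.add_mul, Matrix.mul_add, smul_add]
      abel
    · simp only [Matrix.mul_assoc]
      module
  calc _ = Yᴴ * ((R₁ + R₂)ᴴ * Dmat * B + Bᴴ * Dmat * (R₁ + R₂) +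
        (2 : ℂ) • (P₁ᴴ * Dmat * P₁ + P₂ᴴ * Dmat * P₂)) * Y := by
        rw [← gram_conj h]
        simp only [Matrix.mul_add, Matrix.add_mul, Matrix.conjTranspose_mul, Matrix.mul_assoc,
          Matrix.mul_smul, Matrix.smul_mul, smul_add]
    _ = Yᴴ * ((4 : ℂ) • (Aᴴ * (Bᴴ * Dmat * B) * A)) * Y := by
        rw [e1, hM]
        simp only [Matrix.mul_neg, Matrix.neg_mul, smul_neg]
    _ = _ := by
        simp only [Matrix.conjTranspose_mul, Matrix.mul_assoc, Matrix.mul_smul, Matrix.smul_mul]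

variable {a : ℝ} {U : Set ℂ} {F B : ℂ → Loop} {k : ℂ → ℝ} {z : ℂ}

theorem Loop.ExtendsToDisk.combination {g g' : Loop} {x y : ℂ} (c : ℂ)
    (h : g.ExtendsToDisk !![x, 0; 0, -x]) (h' : g'.ExtendsToDisk !![y, 0; 0, -y]) :
    Loop.ExtendsToDisk (fun l => (1 / 2 : ℂ) • (g l + c • g' l))
      !![1 / 2 * (x + c * y), 0; 0, -(1 / 2 * (x + c * y))] := by
  rw [Loop.extendsToDisk_iff] at *
  intro i j
  refine (((h i j).add ((h' i j).const_mul c)).const_mul (1 / 2)).congr (fun l => by simp) ?_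
  fin_cases i <;> fin_cases j <;> simp
  ring

/-- The left side is Δ log k. On the right, κ = k² and ν = 1/(z k²) are the off-diagonal values at l
= 0 of lBAB⁻¹, and the equation is 2(|κ|² - |ν|²). -/
theorem IsIwasawaFactorization.laplacian_identity
    (h : IsIwasawaFactorization (translatedL a) U F B k) (ha : 0 < a) (hU : IsOpen U)
    (hslit : U ⊆ Complex.slitPlane) (hz : z ∈ U) :
    (deriv (deriv fun t : ℝ => k (z + t * 1)) 0 +
        deriv (deriv fun t : ℝ => k (z + t * Complex.I)) 0) / k z -
      (deriv (fun t : ℝ => k (z + t * 1)) 0 ^ 2 +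
        deriv (fun t : ℝ => k (z + t * Complex.I)) 0 ^ 2) / k z ^ 2 =
      2 * (k z ^ 4 - 1 / (‖z‖ ^ 2 * k z ^ 4)) := by
  have hz0 : z ≠ 0 := Complex.slitPlane_ne_zero (hslit hz)
  have hk0 : k z ≠ 0 := (h.pos z hz).ne'
  have hk0' : (k z : ℂ) ≠ 0 := by exact_mod_cast hk0
  have hkd := h.contDiffAt ha hU hz hz0
  obtain ⟨B₁, R₁, c₁, f1, f2, f3, f4, f5⟩ := h.exists_line_derivatives hU hz 1 hkd
  obtain ⟨B₂, R₂, c₂, g1, g2, g3, g4, g5⟩ := h.exists_line_derivatives hU hz Complex.I hkd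
  set p := deriv (fun t : ℝ => k (z + t * 1)) 0
  set q := deriv (fun t : ℝ => k (z + t * Complex.I)) 0
  have hBY : ∀ l, B z l * (B z l).adjugate = 1 := fun l => by
    rw [Matrix.mul_adjugate, (h.mem_SL2 z hz).2.1, one_smul]
  have hM : ∀ w ∈ U, ∀ l, (B w l)ᴴ * Dmat * B w l =
      -((translatedL a w l)ᴴ * Dmat * translatedL a w l) := fun w hw l => by
    rw [h.conjTranspose_mul_right ha hw, hermitianForm_eq ha]
  have hline : ∀ e : ℂ, ∀ᶠ t : ℝ in 𝓝 0, z + t * e ∈ U := fun e =>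
    (isOpen_lineSet hU z e).mem_nhds (zero_mem_lineSet hz e)
  have hC : Loop.ExtendsToDisk (fun l => (B z l).adjugate)
      !![(k z : ℂ)⁻¹, 0; 0, (k z : ℂ)] := by
    have := (h.extends_to_disk z hz).adjugate
    rw [Matrix.adjugate_fin_two_of] at this
    simpa using this
  have hP : ∀ (B' : ℝ → Loop) (x : ℝ),
      (B' 0).ExtendsToDisk !![(x : ℂ), 0; 0, ((-x / k z ^ 2 : ℝ) : ℂ)] →
      Loop.ExtendsToDisk (fun l => B' 0 l * (B z l).adjugate)
        !![(x / k z : ℂ), 0; 0, -(x / k z : ℂ)] := by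
    intro B' x hB'
    convert hB'.mul hC using 1
    ext i j
    fin_cases i <;> fin_cases j <;> simp
    · rfl
    · field_simp
  have hpar := (hP B₁ p f3).combination (-Complex.I) (hP B₂ q g3)
  have hparbar := (hP B₁ p f3).combination Complex.I (hP B₂ q g3)
  have hm : Loop.ExtendsToDisk (fun l => B z l * !![0, 1; z⁻¹, 0] * (B z l).adjugate)
      !![0, (k z : ℂ) ^ 2; z⁻¹ * (k z : ℂ)⁻¹ ^ 2, 0] := by
    convert ((h.extends_to_disk z hz).mul (Loop.extendsToDisk_const !![0, 1; z⁻¹, 0])).mul hC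
      using 1
    ext i j
    fin_cases i <;> fin_cases j <;> simp <;> ring
  have hquad : ∀ l,
      (B₁ 0 l * (B z l).adjugate)ᴴ * Dmat + Dmat * (B₁ 0 l * (B z l).adjugate) =
        ((1 : ℂ) • (B z l * connectionMatrix z l * (B z l).adjugate))ᴴ * Dmat +
          Dmat * ((1 : ℂ) • (B z l * connectionMatrix z l * (B z l).adjugate)) ∧
      (B₂ 0 l * (B z l).adjugate)ᴴ * Dmat + Dmat * (B₂ 0 l * (B z l).adjugate) =
        (Complex.I • (B z l * connectionMatrix z l * (B z l).adjugate))ᴴ * Dmat +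
          Dmat * (Complex.I • (B z l * connectionMatrix z l * (B z l).adjugate)) ∧
      ((R₁ l + R₂ l) * (B z l).adjugate)ᴴ * Dmat + Dmat * ((R₁ l + R₂ l) * (B z l).adjugate) +
        (2 : ℂ) • ((B₁ 0 l * (B z l).adjugate)ᴴ * Dmat * (B₁ 0 l * (B z l).adjugate) +
          (B₂ 0 l * (B z l).adjugate)ᴴ * Dmat * (B₂ 0 l * (B z l).adjugate)) =
        (4 : ℂ) • ((B z l * connectionMatrix z l * (B z l).adjugate)ᴴ * Dmat *
          (B z l * connectionMatrix z l * (B z l).adjugate)) := by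
    intro l
    obtain ⟨X, hX⟩ := exists_hasMatDerivAt_translatedL_line a (hslit hz) l
    have key : ∀ e : ℂ, ∀ {B' : ℝ → Loop} {R : Loop},
        (∀ᶠ t in 𝓝 (0 : ℝ), HasMatDerivAt (fun t => B (z + t * e) l) (B' t l) t) →
        HasMatDerivAt (fun t => B' t l) (R l) 0 → _ := fun e {B' R} h1 h2 =>
      gram_deriv_eq h1 ((hline e).mono fun t ht => hasMatDerivAt_translatedL_line a (hslit ht) l)
        h2 (hX e) ((hline e).mono fun t ht => hM _ ht l)
    have k1 := key 1 (f1 l) (f2 l)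
    have k2 := key Complex.I (g1 l) (g2 l)
    simp only [Complex.ofReal_zero, zero_mul, add_zero] at k1 k2
    refine ⟨gram_gauge (hM z hz l) (hBY l) 1 k1.1, gram_gauge (hM z hz l) (hBY l) _ k2.1, ?_⟩
    exact gram_gauge_second (hM z hz l) (hBY l) k1.2 k2.2
  have hfirst : ∀ l : Circle, (l : ℂ) •
      ((1 / 2 : ℂ) • (B₁ 0 l * (B z l).adjugate + -Complex.I • (B₂ 0 l * (B z l).adjugate)) +
        Dmat * ((1 / 2 : ℂ) • (B₁ 0 l * (B z l).adjugate +
          Complex.I • (B₂ 0 l * (B z l).adjugate)))ᴴ * Dmat) =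
      B z l * !![0, 1; z⁻¹, 0] * (B z l).adjugate := by
    intro l
    rw [neg_smul, ← sub_eq_add_neg, wirtinger_first_order (hquad l).1 (hquad l).2.1]
    have hA : (l : ℂ) • connectionMatrix z l = !![0, 1; z⁻¹, 0] := by
      have hl := l.coe_ne_zero
      rw [connectionMatrix]
      ext i j
      fin_cases i <;> fin_cases j <;> simp [hl]
    rw [← hA, Matrix.mul_smul, Matrix.smul_mul]
  -- Only the existence of a value for the (0,1) second derivative matters: it is multiplied by an
  -- entry of B⁻¹ that vanishes at the origin.
  have hQ : IsDiskBoundary (fun l => ((R₁ l + R₂ l) * (B z l).adjugate) 0 0)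
      (((deriv (deriv fun t : ℝ => k (z + t * 1)) 0 +
        deriv (deriv fun t : ℝ => k (z + t * Complex.I)) 0) / k z : ℝ) : ℂ) := by
    have hC' := Loop.extendsToDisk_iff.1 hC
    refine (((f4.add g4).mul (hC' 0 0)).add ((f5.add g5).mul (hC' 1 0))).congr (fun l => ?_) ?_
    · simp [Matrix.mul_apply, Fin.sum_univ_two]
    · simp [div_eq_mul_inv]
  have hfin := re_laplacian_eq hpar hparbar hm hfirst hQ fun l =>
    wirtinger_second_order (by rw [neg_smul, ← sub_eq_add_neg]) rfl
      (by
        rw [neg_smul, ← sub_eq_add_neg]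
        exact wirtinger_first_order (hquad l).1 (hquad l).2.1) (hquad l).2.2
  have e1 : (4 : ℂ) * (1 / 2 * (p / k z + Complex.I * (q / k z)) *
      (1 / 2 * (p / k z + -Complex.I * (q / k z)))) = (((p ^ 2 + q ^ 2) / k z ^ 2 : ℝ) : ℂ) := by
    push_cast
    linear_combination -(q / k z : ℂ) ^ 2 * Complex.I_sq
  rw [e1, ← Complex.ofReal_sub, Complex.ofReal_re] at hfin
  rw [hfin]
  simp only [Complex.normSq_eq_norm_sq, norm_mul, norm_pow, norm_inv, Complex.norm_real,
    Real.norm_of_nonneg (h.pos z hz).le]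
  have hr : ‖z‖ ≠ 0 := norm_ne_zero_iff.2 hz0
  field_simp

theorem deriv_deriv_log_sq {g : ℝ → ℝ} {t c : ℝ} (hg : ContDiffAt ℝ 2 g t) (h0 : 0 < g t)
    (hc : 0 < c) : deriv (deriv fun s => Real.log (g s ^ 2 / c)) t =
      2 * (deriv (deriv g) t / g t - deriv g t ^ 2 / g t ^ 2) := by
  have hd : ∀ᶠ s in 𝓝 t, HasDerivAt g (deriv g s) s :=
    (hg.eventually (by simp)).mono fun s hs => (hs.differentiableAt (by simp)).hasDerivAt
  have h1 : deriv (fun s => Real.log (g s ^ 2 / c)) =ᶠ[𝓝 t] fun s => 2 * (deriv g s / g s) := by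
    filter_upwards [hd, hg.continuousAt.eventually (lt_mem_nhds h0)] with s hs hs0
    have h2 := ((hs.pow 2).div_const c).log (div_pos (pow_pos hs0 2) hc).ne'
    refine HasDerivAt.deriv (h2.congr_deriv ?_)
    simp
    field_simp
  rw [h1.deriv_eq]
  have h3 := (((hasDerivAt_deriv_of_contDiffAt hg).div hd.self_of_nhds h0.ne').const_mul 2).deriv
  refine h3.trans ?_
  field_simp

theorem IsIwasawaFactorization.gaussCodazzi
    (h : IsIwasawaFactorization (translatedL a) U F B k) (ha : 0 < a) (hU : IsOpen U)
    (hslit : U ⊆ Complex.slitPlane) :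
    GaussCodazzi (1 / 2) (hopf (1 / 2)) (metricExponent (1 / 2) k) U := by
  have hu : ∀ z ∈ U, ContDiffAt ℝ 2 (metricExponent (1 / 2) k) z := fun z hz =>
    (((h.contDiffAt ha hU hz (Complex.slitPlane_ne_zero (hslit hz))).pow 2).div_const _).log
      (div_ne_zero (pow_ne_zero 2 (h.pos z hz).ne') (by norm_num))
  refine ⟨fun z hz => (hu z hz).contDiffWithinAt, fun z hz => ?_, fun z hz => ?_⟩
  · refine DifferentiableAt.differentiableWithinAt ?_
    have hz0 := Complex.slitPlane_ne_zero (hslit hz)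
    exact (differentiableAt_const _).div (differentiableAt_id.mul_const _)
      (mul_ne_zero hz0 (by norm_num))
  · have hz0 := Complex.slitPlane_ne_zero (hslit hz)
    have hk := h.pos z hz
    have hr : 0 < ‖z‖ := norm_pos_iff.2 hz0
    have hline : ∀ e : ℂ, ContDiffAt ℝ 2 (fun t : ℝ => k (z + t * e)) 0 := fun e =>
      ContDiffAt.comp (0 : ℝ) (by simpa using h.contDiffAt ha hU hz hz0)
        (contDiff_line z e).contDiffAt
    have hl : ∀ e : ℂ, _ := fun e => deriv_deriv_log_sq (c := 1 / 2) (hline e)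
      (by simpa using hk) (by norm_num)
    have hid := h.laplacian_identity ha hU hslit hz
    have hexp : Real.exp (metricExponent (1 / 2) k z) = k z ^ 2 / (1 / 2) :=
      Real.exp_log (by positivity)
    have e1 : Real.exp (2 * metricExponent (1 / 2) k z) = (2 * k z ^ 2) ^ 2 := by
      rw [mul_comm, Real.exp_mul, hexp]
      norm_num
      ring
    have e2 : Real.exp (-2 * metricExponent (1 / 2) k z) = ((2 * k z ^ 2) ^ 2)⁻¹ := by
      rw [neg_mul, Real.exp_neg, e1]
    rw [laplacian_eq_deriv_lines (hu z hz), e1, e2, norm_hopf]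
    simp only [metricExponent]
    rw [hl 1, hl Complex.I]
    simp only [Complex.ofReal_zero, zero_mul, add_zero]
    have e3 : ∀ p q r s : ℝ, (2 * (p / k z - r ^ 2 / k z ^ 2) + 2 * (q / k z - s ^ 2 / k z ^ 2)) / 4
        = ((p + q) / k z - (r ^ 2 + s ^ 2) / k z ^ 2) / 2 := fun p q r s => by ring
    -- Since u = log(2k²), Δu is twice Δ log k, while H²e^{2u} = k⁴.
    rw [e3, hid]
    field_simp
    ring

end GaussCodazzi


/-! ### Behaviour of y as x → 0⁺. -/

section Asymptotics

variable {a : ℝ} {U V : Set ℂ} {F B : ℂ → Loop} {k : ℂ → ℝ}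

/-- Uniqueness, as the case ε = 1 of homogeneity: an arbitrary factorization has the same k as the
constructed one. -/
theorem IsIwasawaFactorization.eq_kVal (h : IsIwasawaFactorization (translatedL a) U F B k)
    (ha : 0 < a) {z : ℂ} (hz : z ∈ U) (hadm : IsAdmissible a z) : k z = kVal a z :=
  (eq_of_hermitianForm_factorization 1 hadm.kVal_pos (h.pos z hz) hadm.plusFactor_spec.1
    (h.mem_SL2 z hz).2.1 hadm.plusFactor_spec.2.1 (h.extends_to_disk z hz)
    hadm.plusFactor_spec.2.2 fun l => by simpa using h.conjTranspose_mul_right ha hz l).1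

theorem IsIwasawaFactorization.isEquivalent (hV : IsOpen V) (hV0 : (0 : ℂ) ∈ V)
    (h : IsIwasawaFactorization (translatedL a) (V ∩ Complex.slitPlane) F B k) (ha : 0 < a)
    {y : ℝ → ℝ} (hy : ∀ z ∈ V ∩ Complex.slitPlane,
      y (xvar z) = Real.exp (shiftedExponent (1 / 2) (metricExponent (1 / 2) k) z)) :
    y ~[𝓝[>] 0] fun x => -(1 / 4) * x * (a + 4 * Real.log x - 4 * Real.log 4) := by
  have h0 : Tendsto (fun x : ℝ => ((x ^ 2 / 16 : ℝ) : ℂ)) (𝓝[>] 0) (𝓝[≠] 0) := by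
    refine tendsto_nhdsWithin_iff.2 ⟨?_, ?_⟩
    · have : Continuous fun x : ℝ => ((x ^ 2 / 16 : ℝ) : ℂ) := by fun_prop
      simpa using (this.tendsto 0).mono_left nhdsWithin_le_nhds
    · filter_upwards [self_mem_nhdsWithin] with x hx
      have hx' : (0 : ℝ) < x := hx
      have h1 : x ^ 2 / 16 ≠ 0 := by positivity
      exact Complex.ofReal_ne_zero.2 h1
  -- Near 0⁺, y equals the model times c evaluated at the positive real point z = x²/16.
  refine isEquivalent_iff_exists_eq_mul.2
    ⟨fun x => cVal a ((x ^ 2 / 16 : ℝ) : ℂ), (tendsto_cVal a).comp h0, ?_⟩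
  filter_upwards [self_mem_nhdsWithin, h0.eventually (eventually_isAdmissible a),
    (h0.mono_right nhdsWithin_le_nhds).eventually (hV.mem_nhds hV0)] with x hx hadm hxV
  have hx' : 0 < x := hx
  have hr : 0 < x ^ 2 / 16 := by positivity
  have hz : ((x ^ 2 / 16 : ℝ) : ℂ) ∈ V ∩ Complex.slitPlane :=
    ⟨hxV, Complex.ofReal_mem_slitPlane.2 hr⟩
  have hnorm : ‖((x ^ 2 / 16 : ℝ) : ℂ)‖ = x ^ 2 / 16 := by
    rw [Complex.norm_real, Real.norm_of_nonneg hr.le]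
  have hxv : xvar ((x ^ 2 / 16 : ℝ) : ℂ) = x := by
    rw [xvar, hnorm, show x ^ 2 / 16 = (x / 4) ^ 2 by ring, Real.sqrt_sq (by positivity)]
    ring
  have h1 := hy _ hz
  have hk := h.pos _ hz
  rw [exp_shiftedExponent _ hadm.ne_zero, hxv, metricExponent, Real.exp_log (by positivity),
    h.eq_kVal ha hz hadm, hadm.kVal_sq, hnorm, Real.log_div (by positivity) (by norm_num),
    show (16 : ℝ) = 4 ^ 2 by norm_num, Real.log_pow, Real.log_pow] at h1
  rw [h1, Pi.mul_apply]
  push_cast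
  ring_nf

end Asymptotics

end

end TTStar

theorem mainTheorem3 :
    -- the homogeneity reduction with `H = 1/2`
    (∀ (U : Set ℂ) (u : ℂ → ℝ), IsOpen U → (0 : ℂ) ∉ U →
      GaussCodazzi (1 / 2) (hopf (1 / 2)) u U → IsRadialOn u U →
      ∃ y : ℝ → ℝ, (∀ z ∈ U, y (xvar z) = Real.exp (shiftedExponent (1 / 2) u z)) ∧
        IsPainleveIII 0 0 1 (-1) y (xvar '' U)) ∧
    -- the family of solutions, with parameter `a > 0`
    ∀ a : ℝ, 0 < a →
      (∃ ρ : ℝ, 0 < ρ ∧ ∃ (F B : ℂ → Loop) (k : ℂ → ℝ),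
        IsIwasawaFactorization (translatedL a) (Metric.ball 0 ρ ∩ Complex.slitPlane) F B k) ∧
      ∀ (V : Set ℂ) (F B : ℂ → Loop) (k : ℂ → ℝ), IsOpen V → (0 : ℂ) ∈ V →
        IsIwasawaFactorization (translatedL a) (V ∩ Complex.slitPlane) F B k →
        IsHomogeneousOn B (V ∩ Complex.slitPlane) ∧
        IsRadialOn (metricExponent (1 / 2) k) (V ∩ Complex.slitPlane) ∧
        GaussCodazzi (1 / 2) (hopf (1 / 2)) (metricExponent (1 / 2) k)
          (V ∩ Complex.slitPlane) ∧
        ∃ y : ℝ → ℝ,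
          (∀ z ∈ V ∩ Complex.slitPlane,
            y (xvar z) = Real.exp (shiftedExponent (1 / 2) (metricExponent (1 / 2) k) z)) ∧
          IsPainleveIII 0 0 1 (-1) y (xvar '' (V ∩ Complex.slitPlane)) ∧
          y ~[𝓝[>] 0] fun x => -(1 / 4) * x * (a + 4 * Real.log x - 4 * Real.log 4) := by
  refine ⟨fun U u hU h0 hG hrad => exists_painleve hU h0 hG hrad, fun a ha => ⟨?_, ?_⟩⟩
  · obtain ⟨ρ, hρ, h⟩ := exists_isIwasawaFactorization ha
    exact ⟨ρ, hρ, _, _, _, h⟩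
  · intro V F B k hV hV0 h
    have hU : IsOpen (V ∩ Complex.slitPlane) := hV.inter Complex.isOpen_slitPlane
    have hrad : IsRadialOn (metricExponent (1 / 2) k) (V ∩ Complex.slitPlane) :=
      fun z hz z' hz' hzz => by
        rw [metricExponent, metricExponent, h.isRadialOn ha z hz z' hz' hzz]
    have hG := h.gaussCodazzi ha hU Set.inter_subset_right
    obtain ⟨y, hy, hP⟩ := exists_painleve hU
      (fun h0 => Complex.slitPlane_ne_zero h0.2 rfl) hG hrad
    exact ⟨h.isHomogeneousOn ha, hrad, hG, y, hy, hP, h.isEquivalent hV hV0 ha hy⟩
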